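/- Let $(M,g,J,\Psi)$ be a connected (not necessarily compact) $6$-dimensional almost Calabi--Yau manifold with torsion (ACYT). That is, $M$ is a smooth connected $6$-manifold with an $SU(3)$-structure consisting of a Riemannian metric $g$, a $g$-orthogonal almost complex structure $J$ and a complex $(3,0)$-form $\Psi=\Psi^++\sqrt{-1}\,\Psi^-$ of constant (normalised) norm, i.e. at each point $\Psi=-(e_1+\sqrt{-1}e_2)\wedge(e_3+\sqrt{-1}e_4)\wedge(e_5+\sqrt{-1}e_6)$ for some orthonormal basis with $Je_1=e_2$, $Je_3=e_4$, $Je_5=e_6$; and there is a (necessarily unique) linear connection $\nabla$, the torsion connection, with $\nabla g=\nabla J=\nabla\Psi^+=\nabla\Psi^-=0$ whose torsion $T(X,Y,Z)=g(\nabla_XY-\nabla_YX-[X,Y],Z)$ is totally skew-symmetric. Let $\nabla^g$ be the Levi-Civita connection of $g$, $F=g(\cdot,J\cdot)$ the Kähler form, $N(X,Y,Z)=g([JX,JY]-[X,Y]-J[JX,Y]-J[X,JY],Z)$ the Nijenhuis tensor, $R(X,Y,Z,V)=g([\nabla_X,\nabla_Y]Z-\nabla_{[X,Y]}Z,V)$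 the curvature of $\nabla$, $Ric(X,Y)=\sum_i R(e_i,X,Y,e_i)$ its Ricci tensor, and $\delta=-*d*$ the codifferential. Consider the condition $$(\mathrm{A})\qquad R(X,Y,Z,V)=R(Z,V,X,Y),\qquad Ric=0,\qquad \|N\|^2=\mathrm{const}.$$ 1. (A) holds if and only if the torsion is parallel for both connections, $\nabla^gT=\nabla T=0$. 2. If (A) holds, then $T$ is harmonic, $dT=\delta T=0$, and $\nabla N=\nabla dF=0$. 3. (A) holds if and only if $R$ satisfies the Riemannian first Bianchi identity $R(X,Y,Z,V)+R(Y,Z,X,V)+R(Z,X,Y,V)=0$. -/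

import Mathlib

open scoped Manifold ContDiff Bundle

noncomputable section

namespace ACYT

/-- The model space of a real `6`-dimensional manifold. -/
abbrev E6 : Type := EuclideanSpace ℝ (Fin 6)

/-- A real-valued covariant tensor field with `k` arguments on a `6`-manifold `M`, given by its
values on `k`-tuples of tangent vectors. -/
abbrev Tensor (M : Type*) [TopologicalSpace M] [ChartedSpace E6 M] (k : ℕ) : Type _ :=
  ∀ x : M, (Fin k → TangentSpace (𝓡 6) x) → ℝ

/-- A linear connection on `M`; `nabla Y x (X x)` is `(∇_X Y)(x)`. -/
abbrev Connection (M : Type*) [TopologicalSpace M] [ChartedSpace E6 M]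
    [IsManifold (𝓡 6) ∞ M] : Type _ :=
  CovariantDerivative (𝓡 6) E6 (fun x : M => TangentSpace (𝓡 6) x)

section Tensors

variable {M : Type*} [TopologicalSpace M] [ChartedSpace E6 M] [IsManifold (𝓡 6) ∞ M]

/-- A vector field, smooth near `x`, which takes the value `v` at `x`. The operations below that
use it are tensorial, hence independent of the chosen extension. -/
def field {x : M} (v : TangentSpace (𝓡 6) x) : ∀ y : M, TangentSpace (𝓡 6) y :=
  FiberBundle.extend E6 v

/-- The covariant derivative of a tensor field:
`(∇A)(u, v₁, …, v_k) = u (A(V₁, …, V_k)) - ∑ i, A(v₁, …, ∇_u V_i, …, v_k)`. -/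
def covDeriv (nabla : Connection M) {k : ℕ} (A : Tensor M k) : Tensor M (k + 1) := fun x w =>
  mvfderiv (𝓡 6) (fun y => A y (fun i => field (w i.succ) y)) x (w 0)
    - ∑ i, A x (Function.update (fun j : Fin k => w j.succ) i
        (nabla (field (w i.succ)) x (w 0)))

/-- A tensor field is parallel if its covariant derivative vanishes. -/
def IsParallel (nabla : Connection M) {k : ℕ} (A : Tensor M k) : Prop :=
  ∀ (x : M) (w : Fin (k + 1) → TangentSpace (𝓡 6) x), covDeriv nabla A x w = 0

/-- The exterior derivative of a differential form of degree `n + 1`: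
`dA(V₀, …, V_{n+1}) = ∑ i, (-1)^i V_i (A(V₀, …, V̂_i, …))
  + ∑_{i < j} (-1)^(i+j) A([V_i, V_j], V₀, …, V̂_i, …, V̂_j, …)`.
The pair written `i < j` there is `(i.castSucc, j.succ)` below, whence the sign. -/
def dForm {n : ℕ} (A : Tensor M (n + 1)) : Tensor M (n + 2) := fun x v =>
  (∑ i : Fin (n + 2), (-1 : ℝ) ^ (i : ℕ) *
      mvfderiv (𝓡 6) (fun y => A y (i.removeNth (fun l => field (v l) y))) x (v i))
    - ∑ i : Fin (n + 1), ∑ j : Fin (n + 1), if i ≤ j then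
        (-1 : ℝ) ^ ((i : ℕ) + (j : ℕ)) *
          A x (Matrix.vecCons
            (VectorField.mlieBracket (𝓡 6) (field (v i.castSucc)) (field (v j.succ)) x)
            (j.removeNth (i.castSucc.removeNth v)))
      else 0

/-- The curvature `R(u, v)w` with `R(X, Y) = ∇_X ∇_Y - ∇_Y ∇_X - ∇_[X, Y]`. -/
def curvature (nabla : Connection M) (x : M) (u v w : TangentSpace (𝓡 6) x) :
    TangentSpace (𝓡 6) x :=
  nabla (fun y => nabla (field w) y (field v y)) x u
    - nabla (fun y => nabla (field w) y (field u y)) x v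
    - nabla (field w) x (VectorField.mlieBracket (𝓡 6) (field u) (field v) x)

/-- The Nijenhuis tensor `N(X, Y) = [JX, JY] - [X, Y] - J[JX, Y] - J[X, JY]`. -/
def nijenhuis (J : ∀ x : M, TangentSpace (𝓡 6) x →L[ℝ] TangentSpace (𝓡 6) x) (x : M)
    (u v : TangentSpace (𝓡 6) x) : TangentSpace (𝓡 6) x :=
  VectorField.mlieBracket (𝓡 6) (fun y => J y (field u y)) (fun y => J y (field v y)) x
    - VectorField.mlieBracket (𝓡 6) (field u) (field v) x
    - J x (VectorField.mlieBracket (𝓡 6) (fun y => J y (field u y)) (field v) x)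
    - J x (VectorField.mlieBracket (𝓡 6) (field u) (fun y => J y (field v y)) x)

end Tensors

section Metric

variable {M : Type*} [TopologicalSpace M] [ChartedSpace E6 M] [IsManifold (𝓡 6) ∞ M]
  [Bundle.RiemannianBundle (fun x : M => TangentSpace (𝓡 6) x)]

/-- The curvature with four arguments, `R(u, v, w, z) = g(R(u, v)w, z)`. -/
def R4 (nabla : Connection M) (x : M) (u v w z : TangentSpace (𝓡 6) x) : ℝ :=
  inner ℝ (curvature nabla x u v w) z

/-- An orthonormal basis `e₁, …, e₆` of the tangent space at `x`. -/
def frame (x : M) : OrthonormalBasis (Fin 6) ℝ (TangentSpace (𝓡 6) x) :=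
  haveI : FiniteDimensional ℝ (TangentSpace (𝓡 6) x) := inferInstanceAs (FiniteDimensional ℝ E6)
  (stdOrthonormalBasis ℝ (TangentSpace (𝓡 6) x)).reindex
    (finCongr (finrank_euclideanSpace_fin (𝕜 := ℝ) (n := 6)))

/-- The Ricci tensor `Ric(v, w) = ∑ i, R(e_i, v, w, e_i)`, with `e` an orthonormal basis. -/
def ricci (nabla : Connection M) (x : M) (v w : TangentSpace (𝓡 6) x) : ℝ :=
  ∑ i, R4 nabla x (frame x i) v w (frame x i)

/-- The squared norm `‖A‖² = ∑ A(e_{i₁}, …, e_{i_k})²` of a tensor field. -/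
def normSq {k : ℕ} (A : Tensor M k) (x : M) : ℝ :=
  ∑ i : Fin k → Fin 6,
    A x (fun l => frame x (i l)) ^ 2

/-- The torsion as a tensor with three arguments, `T(u, v, w) = g(T(u, v), w)`. -/
def torsionForm (nabla : Connection M) : Tensor M 3 := fun x v =>
  inner ℝ (nabla.torsion x (v 0) (v 1)) (v 2)

/-- The Nijenhuis tensor with three arguments, `N(u, v, w) = g(N(u, v), w)`. -/
def nijenhuisForm (J : ∀ x : M, TangentSpace (𝓡 6) x →L[ℝ] TangentSpace (𝓡 6) x) :
    Tensor M 3 := fun x v =>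
  inner ℝ (nijenhuis J x (v 0) (v 1)) (v 2)

/-- The Kähler form `F(u, v) = g(u, Jv)`. -/
def kaehlerForm (J : ∀ x : M, TangentSpace (𝓡 6) x →L[ℝ] TangentSpace (𝓡 6) x) :
    Tensor M 2 := fun x v =>
  inner ℝ (v 0) (J x (v 1))

/-- The Riemannian volume form `-F ∧ F ∧ F / 6`, for the orientation in which the orthonormal
frames `(e₁, Je₁, e₂, Je₂, e₃, Je₃)` are positive. -/
def volForm (J : ∀ x : M, TangentSpace (𝓡 6) x →L[ℝ] TangentSpace (𝓡 6) x) :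
    Tensor M 6 := fun x v =>
  -(1 / 48 : ℝ) * ∑ s : Equiv.Perm (Fin 6), ((Equiv.Perm.sign s : ℤ) : ℝ) *
    (kaehlerForm J x ![v (s 0), v (s 1)] * kaehlerForm J x ![v (s 2), v (s 3)] *
      kaehlerForm J x ![v (s 4), v (s 5)])

/-- The Hodge star from `p`-forms to `q`-forms, `p + q = 6`:
`(*A)(w) = (1/p!) ∑ A(e_{i₁}, …, e_{i_p}) vol(e_{i₁}, …, e_{i_p}, w₁, …, w_q)`. -/
def hodgeStar (J : ∀ x : M, TangentSpace (𝓡 6) x →L[ℝ] TangentSpace (𝓡 6) x) {p q : ℕ}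
    (h : p + q = 6) (A : Tensor M p) : Tensor M q := fun x w =>
  (1 / (p.factorial : ℝ)) *
    ∑ i : Fin p → Fin 6,
      A x (fun l => frame x (i l)) *
        volForm J x (fun a =>
          Fin.append (fun l => frame x (i l)) w
            (Fin.cast h.symm a))

/-- The codifferential `δ = - * d *` of a `3`-form. -/
def codiff (J : ∀ x : M, TangentSpace (𝓡 6) x →L[ℝ] TangentSpace (𝓡 6) x) (A : Tensor M 3) :
    Tensor M 2 := fun x v =>
  -hodgeStar J (show 4 + 2 = 6 from rfl)
    (dForm (hodgeStar J (show 3 + 3 = 6 from rfl) A)) x v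

/-- A `3`-form is harmonic if it is closed and co-closed. -/
def IsHarmonic (J : ∀ x : M, TangentSpace (𝓡 6) x →L[ℝ] TangentSpace (𝓡 6) x)
    (A : Tensor M 3) : Prop :=
  (∀ x v, dForm A x v = 0) ∧ ∀ x v, codiff J A x v = 0

/-- An `SU(3)`-structure `(g, J, Ψ)`: a smooth `g`-orthogonal almost complex structure `J` and a
smooth complex form `Ψ` of type `(3,0)` with constant (normalised) norm. The last field says that,
in an orthonormal basis `(e₁, …, e₆) = (e₁, Je₁, e₃, Je₃, e₅, Je₅)` of the tangent space,
`Ψ = -(e₁ + i e₂) ∧ (e₃ + i e₄) ∧ (e₅ + i e₆)`. -/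
structure IsSU3Structure (J : ∀ x : M, TangentSpace (𝓡 6) x →L[ℝ] TangentSpace (𝓡 6) x)
    (Psi : ∀ x : M, (Fin 3 → TangentSpace (𝓡 6) x) → ℂ) : Prop where
  smooth_J : ContMDiff (𝓡 6) ((𝓡 6).prod 𝓘(ℝ, E6 →L[ℝ] E6)) ∞
    (fun x => Bundle.TotalSpace.mk' (E6 →L[ℝ] E6)
      (E := fun x : M => TangentSpace (𝓡 6) x →L[ℝ] TangentSpace (𝓡 6) x) x (J x))
  J_sq : ∀ x v, J x (J x v) = -v
  J_orthogonal : ∀ x u v, inner ℝ (J x u) (J x v) = inner ℝ u v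
  smooth_Psi : ∀ X : Fin 3 → ∀ x : M, TangentSpace (𝓡 6) x,
    (∀ i, ContMDiff (𝓡 6) ((𝓡 6).prod 𝓘(ℝ, E6)) ∞
      (fun x => Bundle.TotalSpace.mk' E6 (E := fun x : M => TangentSpace (𝓡 6) x) x (X i x))) →
    ContMDiff (𝓡 6) 𝓘(ℝ, ℂ) ∞ (fun x => Psi x (fun i => X i x))
  adapted : ∀ x, ∃ e : OrthonormalBasis (Fin 6) ℝ (TangentSpace (𝓡 6) x),
    J x (e 0) = e 1 ∧ J x (e 2) = e 3 ∧ J x (e 4) = e 5 ∧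
    ∀ v, Psi x v = -Matrix.det (Matrix.of fun a c : Fin 3 =>
      ((inner ℝ (![e 0, e 2, e 4] a) (v c) : ℝ) : ℂ) +
        Complex.I * ((inner ℝ (![e 1, e 3, e 5] a) (v c) : ℝ) : ℂ))

variable [IsContMDiffRiemannianBundle (𝓡 6) ∞ E6 (fun x : M => TangentSpace (𝓡 6) x)]

instance isContMDiffRiemannianBundle_one :
    IsContMDiffRiemannianBundle (𝓡 6) 1 E6 (fun x : M => TangentSpace (𝓡 6) x) :=
  IsContMDiffRiemannianBundle.of_le (n := ∞) (by norm_cast)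

/-- The Levi-Civita connection: the metric connection without torsion. These two properties
determine `∇_X Y` for all differentiable vector fields `Y`. -/
structure IsLeviCivita (nabla : Connection M) : Prop where
  metric : nabla.IsMetricCompatible
  torsion_eq_zero : nabla.torsion = 0

/-- Existence of the Levi-Civita connection in the presence of a metric connection with totally
skew-symmetric torsion: it is `∇ - T/2`, that is `X ↦ ∇_X Y + T(Y, X)/2`. -/
theorem isLeviCivita_addOneForm (nabla : Connection M) (h : nabla.IsMetricCompatible)
    (hs : ∀ (x : M) (u v w : TangentSpace (𝓡 6) x),
      torsionForm nabla x ![u, v, w] = -torsionForm nabla x ![u, w, v]) :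
    IsLeviCivita (nabla.addOneForm (fun x => (1 / 2 : ℝ) • nabla.torsion x)) where
  metric := by
    rw [CovariantDerivative.isMetricCompatible_iff] at h ⊢
    intro x X σ τ hX hσ hτ
    rw [h hX hσ hτ]
    have h1 := hs x (X x) (σ x) (τ x)
    simp only [torsionForm, Matrix.cons_val] at h1
    have a1 := nabla.torsion_antisymm (X x) (σ x)
    have a2 := nabla.torsion_antisymm (X x) (τ x)
    have e : ∀ (σ : ∀ x : M, TangentSpace (𝓡 6) x), (nabla.addOneForm (fun x => (1/2:ℝ) • nabla.torsion x)) σ x (X x) = nabla σ x (X x) + (1/2:ℝ) • nabla.torsion x (σ x) (X x) := fun σ => rfl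
    beta_reduce
    rw [e, e, inner_add_left, inner_add_right, inner_smul_left, inner_smul_right]
    rw [a1, a2, inner_neg_left, inner_neg_left] at h1
    have h2 := real_inner_comm (nabla.torsion x (τ x) (X x)) (σ x)
    have : (starRingEnd ℝ) (1/2) = 1/2 := by simp
    rw [this]
    linarith
  torsion_eq_zero := by
    rw [CovariantDerivative.torsion_eq_zero_iff]
    intro X Y x hX hY
    have := nabla.torsion_apply hX hY
    have e : ∀ (σ : ∀ x : M, TangentSpace (𝓡 6) x) u, (nabla.addOneForm (fun x => (1/2:ℝ) • nabla.torsion x)) σ x u = nabla σ x u + (1/2:ℝ) • nabla.torsion x (σ x) u := fun σ u => rfl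
    rw [e, e, nabla.torsion_antisymm (Y x) (X x), this]
    module

/-- `(M, g, J, Ψ)` is an almost Calabi-Yau manifold with torsion, with torsion connection `nabla`:
a smooth linear connection with `∇g = ∇J = ∇Ψ⁺ = ∇Ψ⁻ = 0` and totally skew-symmetric torsion, on
a manifold with an `SU(3)`-structure. -/
structure IsACYT (J : ∀ x : M, TangentSpace (𝓡 6) x →L[ℝ] TangentSpace (𝓡 6) x)
    (Psi : ∀ x : M, (Fin 3 → TangentSpace (𝓡 6) x) → ℂ) (nabla : Connection M) : Prop where
  su3 : IsSU3Structure J Psi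
  smooth : CovariantDerivative.ContMDiffCovariantDerivative nabla ∞
  metric : nabla.IsMetricCompatible
  parallel_J : ∀ (x : M) (u v : TangentSpace (𝓡 6) x),
    nabla (fun y => J y (field v y)) x u = J x (nabla (field v) x u)
  parallel_re : IsParallel nabla (fun x v => (Psi x v).re)
  parallel_im : IsParallel nabla (fun x v => (Psi x v).im)
  skew : ∀ (x : M) (u v w : TangentSpace (𝓡 6) x),
    torsionForm nabla x ![u, v, w] = -torsionForm nabla x ![u, w, v]

/-- `R ∈ S²Λ²`, i.e. `R(X, Y, Z, V) = R(Z, V, X, Y)`. -/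
def IsPairSymmetric (nabla : Connection M) : Prop :=
  ∀ (x : M) (u v w z : TangentSpace (𝓡 6) x), R4 nabla x u v w z = R4 nabla x w z u v

/-- `Ric = 0`. -/
def IsRicciFlat (nabla : Connection M) : Prop :=
  ∀ (x : M) (v w : TangentSpace (𝓡 6) x), ricci nabla x v w = 0

/-- The Riemannian first Bianchi identity
`R(X, Y, Z, V) + R(Y, Z, X, V) + R(Z, X, Y, V) = 0`. -/
def RiemannianBianchi (nabla : Connection M) : Prop :=
  ∀ (x : M) (u v w z : TangentSpace (𝓡 6) x),
    R4 nabla x u v w z + R4 nabla x v w u z + R4 nabla x w u v z = 0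

end Metric

end ACYT

end

/-!
The curvature condition, parallelism of the torsion for both connections, and the Riemannian first
Bianchi identity are compared through the `4`-form
`σ(u, v, w, z) = g(T(u, v), T(w, z)) + g(T(v, w), T(u, z)) + g(T(w, u), T(v, z))`, which satisfies
`∇ᵍT = ∇T + σ/2` and measures, together with `∇T`, the failure of the first Bianchi identity
(`covDeriv_leviCivita_torsionForm`, `R4_cyclic`). In particular `∇ᵍT = ∇T = 0` implies that
identity.

*Curvature.* The curvature of `∇` takes values in `su(3)`. If it is pair symmetric, its cyclic sum
over three arguments is a `4`-form, whose contraction with the Kähler form is expressed by the Ricci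
tensor; in dimension six such a contraction determines the `4`-form. Hence pair symmetry and Ricci
flatness give the first Bianchi identity (`riemannianBianchi_of_ricci`). Conversely the identity
gives pair symmetry, and the same contraction formula gives `Ric = 0`
(`isRicciFlat_of_riemannianBianchi`).

*Parallel torsion.* Assume the first Bianchi identity. Then `∇T = -σ/3` (`covDeriv_torsionForm_eq`).
As `Ψ` is parallel, the derivative of the function `⟨T, Ψ⟩` is a multiple of the contraction of `σ`
with `Ψ`, a `1`-form of type `(1,0)` because there are no `4`-forms of type `(4,0)`: the function is
pseudo-holomorphic (`mvfderiv_J`). The derivative of a pseudo-holomorphic function vanishes on the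
image of the Nijenhuis tensor, and `⟨T, Ψ⟩` is also the only component of `N`; where it is nonzero,
`N` is onto. So `⟨T, Ψ⟩` is constant (`mvfderiv_torsion_psi`), and `σ` is of type `(2,2)`. As `J`
and `Ψ` are parallel, `∇σ` is again of type `(2,2)` in its form arguments; it is an expression
bilinear in `T` and `σ`, since `∇T = -σ/3`. These are pointwise algebraic conditions on `T`, and
they force `σ = 0` (`IsAlt3.cyclicContraction_eq_zero`). Therefore `∇T = ∇ᵍT = 0`.

*Consequences.* The tensors `N` and `dF` are combinations of `T` composed with `J` in its arguments,
so they are parallel with `T`, and `‖N‖²` is constant. The volume form is parallel for `∇ᵍ`, so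
`∇ᵍT = 0` gives `∇ᵍ(*T) = 0`, and forms which are parallel for a torsion free connection are closed.
-/

noncomputable section

set_option linter.unusedSectionVars false

namespace ACYT

open Filter Topology Bundle

/-! ### A matrix identity -/

section

open Matrix

/-- The skew-symmetric matrix of the cross product with `v`. -/
def crossMatrix (v : Fin 3 → ℂ) : Matrix (Fin 3) (Fin 3) ℂ :=
  !![0, v 2, -v 1; -v 2, 0, v 0; v 1, -v 0, 0]

/-- A Hermitian matrix `h`, built from the symmetric part `S` and the skew part `A` of a matrix,
vanishes if `h(S + A) = tr(h)(S - A)`. Contracting with `Aᴴ` gives `tr(h) ‖v‖² = 0`, contracting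
with `Sᴴ` gives `tr(h S Sᴴ) = tr(h) ‖S‖²`, so that `‖h‖² = tr(h) (‖S‖² + ‖v‖²/2)`; for `v = 0` the
right-hand side is `-‖S‖⁴`. -/
theorem hermitian_eq_zero_of_mul_eq_trace_smul (S A h : Matrix (Fin 3) (Fin 3) ℂ) (v : Fin 3 → ℂ)
    (hS : Sᵀ = S)
    (hA : A = (1 / 2 : ℂ) • crossMatrix v)
    (hh : h = (2 : ℂ) • (S * Sᴴ) - (S * Sᴴ).trace • (1 : Matrix (Fin 3) (Fin 3) ℂ)
      + (1 / 2 : ℂ) • vecMulVec (star v) v)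
    (hSv : v ᵥ* S = 0) (hv : v ᵥ* h = h.trace • v)
    (hE : h * (S + A) = h.trace • (S - A)) : h = 0 := by
  have hST : Sᴴᵀ = Sᴴ := by
    conv_rhs => rw [← hS]
    ext i j; simp
  have hAT : Aᵀ = -A := by
    rw [hA, crossMatrix]; ext i j; fin_cases i <;> fin_cases j <;> simp
  have hAHT : Aᴴᵀ = -Aᴴ := by
    have := congrArg conjTranspose hAT
    rw [conjTranspose_neg] at this
    rw [← this]; ext i j; simp
  have symanti : ∀ P Q : Matrix (Fin 3) (Fin 3) ℂ, Pᵀ = P → Qᵀ = -Q → (P * Q).trace = 0 := by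
    intro P Q hP hQ
    have := trace_transpose (P * Q)
    rw [transpose_mul, hP, hQ, neg_mul, trace_neg, trace_mul_comm] at this
    have h2 : (2 : ℂ) * (P * Q).trace = 0 := by linear_combination -this
    simpa using h2
  set n : ℂ := v ⬝ᵥ star v with hn
  set p : ℂ := (S * Sᴴ).trace with hp
  set t : ℂ := h.trace with ht
  set V := vecMulVec (star v) v with hV
  have hVh : (h * V).trace = t * n := by
    rw [trace_mul_comm, hV, vecMulVec_mul, hv, trace_vecMulVec, dotProduct_smul,
      dotProduct_comm, smul_eq_mul]
  have hVS : V * S = 0 := by rw [hV, vecMulVec_mul, hSv, vecMulVec_zero]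
  have hVA : V * A = 0 := by
    have : v ᵥ* A = 0 := by
      rw [hA, crossMatrix]
      ext j
      fin_cases j <;> simp [vecMul, dotProduct, Fin.sum_univ_three] <;> ring
    rw [hV, vecMulVec_mul, this, vecMulVec_zero]
  have hAA : A * Aᴴ = (1 / 4 : ℂ) • (n • (1 : Matrix (Fin 3) (Fin 3) ℂ) - V) := by
    rw [hV, hA, hn, crossMatrix]
    ext i j
    fin_cases i <;> fin_cases j <;>
      simp [vecMulVec, dotProduct, Fin.sum_univ_three, mul_apply, map_ofNat] <;> ring
  have htV : V.trace = n := by rw [hV, trace_vecMulVec, dotProduct_comm]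
  have hSAH : (S * Aᴴ).trace = 0 := symanti _ _ hS hAHT
  have hASH : (A * Sᴴ).trace = 0 := by rw [trace_mul_comm]; exact symanti _ _ hST hAT
  have htp : t = -p + n / 2 := by
    rw [ht, hh]
    simp only [trace_add, trace_sub, trace_smul, htV, ← hp, trace_one, smul_eq_mul,
      Fintype.card_fin]
    push_cast; ring
  -- contracting with the skew part
  have h1 : t * n = 0 := by
    have e := congrArg (fun X => (X * Aᴴ).trace) hE
    have e1 : (h * S * Aᴴ).trace = 0 := by
      have : h * S * Aᴴ = (2 : ℂ) • ((S * Sᴴ * S) * Aᴴ) - p • (S * Aᴴ) := by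
        conv_lhs => rw [hh]
        simp only [add_mul, sub_mul, smul_mul_assoc, one_mul, hVS, smul_zero, add_zero]
      rw [this, trace_sub, trace_smul, trace_smul, hSAH,
        symanti (S * Sᴴ * S) Aᴴ (by simp only [transpose_mul, hS, hST, mul_assoc]) hAHT]
      simp
    have e2 : (h * A * Aᴴ).trace = 0 := by
      rw [mul_assoc, hAA, mul_smul_comm, mul_sub, mul_smul_comm, mul_one, trace_smul, trace_sub,
        trace_smul, hVh, ← ht]
      simp only [smul_eq_mul]; ring
    have e3 : (A * Aᴴ).trace = n / 2 := by
      rw [hAA, trace_smul, trace_sub, trace_smul, htV, trace_one]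
      simp only [smul_eq_mul, Fintype.card_fin]; push_cast; ring
    simp only [mul_add, add_mul, sub_mul, smul_mul_assoc, trace_add, trace_sub, trace_smul,
      e1, e2, e3, hSAH, smul_eq_mul] at e
    linear_combination 2 * e
  -- contracting with the symmetric part
  have h2 : (h * (S * Sᴴ)).trace = t * p := by
    have e := congrArg (fun X => (X * Sᴴ).trace) hE
    have e1 : (h * A * Sᴴ).trace = 0 := by
      have : h * A * Sᴴ = (2 : ℂ) • ((S * Sᴴ * A) * Sᴴ) - p • (A * Sᴴ) := by
        conv_lhs => rw [hh]
        simp only [add_mul, sub_mul, smul_mul_assoc, one_mul, hVA, smul_zero, add_zero]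
      have e0 : (S * Sᴴ * A * Sᴴ).trace = 0 := by
        rw [trace_mul_comm, ← mul_assoc]
        exact symanti (Sᴴ * (S * Sᴴ)) A (by simp only [transpose_mul, hS, hST, mul_assoc]) hAT
      rw [this, trace_sub, trace_smul, trace_smul, hASH, e0]
      simp
    simp only [mul_add, add_mul, sub_mul, smul_mul_assoc, trace_add, trace_sub, trace_smul,
      e1, hASH, smul_eq_mul] at e
    rw [← mul_assoc, hp]
    linear_combination e
  have hherm : hᴴ = h := by
    have hpc : star p = p := by
      rw [hp, ← trace_conjTranspose, conjTranspose_mul, conjTranspose_conjTranspose]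
    rw [hh]
    simp only [conjTranspose_add, conjTranspose_sub, conjTranspose_smul, conjTranspose_mul,
      conjTranspose_conjTranspose, conjTranspose_one, hpc, hV]
    congr 1
    · simp
    · rw [conjTranspose_vecMulVec]; simp
  have h3 : (h * hᴴ).trace = t * (p + n / 2) := by
    rw [hherm]
    have : h * h = (2 : ℂ) • (h * (S * Sᴴ)) - p • h + (1 / 2 : ℂ) • (h * V) := by
      nth_rewrite 2 [hh]
      simp only [mul_add, mul_sub, mul_smul_comm, mul_one]
    rw [this, trace_add, trace_sub, trace_smul, trace_smul, trace_smul, h2, hVh, ← ht]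
    simp only [smul_eq_mul]; ring
  open ComplexOrder in
  rw [← trace_mul_conjTranspose_self_eq_zero_iff, h3]
  rcases mul_eq_zero.1 h1 with h0 | h0
  · rw [h0, zero_mul]
  · -- here `v = 0`, and `‖h‖² = -‖S‖⁴`
    have hreal : ∀ X : Matrix (Fin 3) (Fin 3) ℂ,
        (X * Xᴴ).trace = ((∑ i, ∑ j, Complex.normSq (X i j) : ℝ) : ℂ) := by
      intro X
      simp only [trace, diag, mul_apply, conjTranspose_apply, Complex.star_def, Complex.mul_conj]
      push_cast; rfl
    have e1 := hreal h
    have e2 := hreal S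
    rw [h3, htp, h0, hp, e2] at e1
    have e3 : (0 : ℝ) ≤ ∑ i, ∑ j, Complex.normSq (h i j) :=
      Finset.sum_nonneg fun i _ => Finset.sum_nonneg fun j _ => Complex.normSq_nonneg _
    have e4 : -(∑ i, ∑ j, Complex.normSq (S i j)) ^ 2 = ∑ i, ∑ j, Complex.normSq (h i j) := by
      have : ((-(∑ i, ∑ j, Complex.normSq (S i j)) ^ 2 : ℝ) : ℂ)
          = ((∑ i, ∑ j, Complex.normSq (h i j) : ℝ) : ℂ) := by
        rw [← e1]; push_cast; ring
      exact_mod_cast this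
    have e5 : ∑ i, ∑ j, Complex.normSq (S i j) = 0 := by
      have := sq_nonneg (∑ i, ∑ j, Complex.normSq (S i j))
      exact pow_eq_zero_iff (two_ne_zero) |>.1 (by linarith)
    rw [htp, h0, hp, e2, e5]; simp

end

/-! ### Components of forms in a unitary basis -/

section

/-- A skew-symmetric array with three indices. -/
structure IsAlt3 (t : Fin 6 → Fin 6 → Fin 6 → ℝ) : Prop where
  swap₁₂ : ∀ i j k, t j i k = -t i j k
  swap₂₃ : ∀ i j k, t i k j = -t i j k

namespace IsAlt3

variable {t : Fin 6 → Fin 6 → Fin 6 → ℝ} (h : IsAlt3 t)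

include h

/-- As a simplification rule, this sorts the indices and terminates, unlike `swap₁₂`. -/
theorem sort₁₂ (i j k : Fin 6) (_ : j < i) : t i j k = -t j i k := h.swap₁₂ _ _ _
theorem sort₂₃ (i j k : Fin 6) (_ : k < j) : t i j k = -t i k j := h.swap₂₃ _ _ _
theorem self₁₂ (i k : Fin 6) : t i i k = 0 := by have := h.swap₁₂ i i k; linarith
theorem self₂₃ (i k : Fin 6) : t i k k = 0 := by have := h.swap₂₃ i k k; linarith

end IsAlt3

/-- A skew-symmetric array with four indices. -/
structure IsAlt4 (s : Fin 6 → Fin 6 → Fin 6 → Fin 6 → ℝ) : Prop where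
  swap₁₂ : ∀ i j k l, s j i k l = -s i j k l
  swap₂₃ : ∀ i j k l, s i k j l = -s i j k l
  swap₃₄ : ∀ i j k l, s i j l k = -s i j k l

namespace IsAlt4

variable {s : Fin 6 → Fin 6 → Fin 6 → Fin 6 → ℝ} (h : IsAlt4 s)

include h

theorem sort₁₂ (i j k l : Fin 6) (_ : j < i) : s i j k l = -s j i k l := h.swap₁₂ _ _ _ _
theorem sort₂₃ (i j k l : Fin 6) (_ : k < j) : s i j k l = -s i k j l := h.swap₂₃ _ _ _ _
theorem sort₃₄ (i j k l : Fin 6) (_ : l < k) : s i j k l = -s i j l k := h.swap₃₄ _ _ _ _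
theorem self₁₂ (i k l : Fin 6) : s i i k l = 0 := by have := h.swap₁₂ i i k l; linarith
theorem self₂₃ (i j l : Fin 6) : s i j j l = 0 := by have := h.swap₂₃ i j j l; linarith
theorem self₃₄ (i j k : Fin 6) : s i j k k = 0 := by have := h.swap₃₄ i j k k; linarith

omit h in
theorem mem_of_strictMono (i j k l : Fin 6) : i < j → j < k → k < l →
    (i, j, k, l) ∈ [(0, 1, 2, 3), (0, 1, 2, 4), (0, 1, 2, 5), (0, 1, 3, 4), (0, 1, 3, 5),
      (0, 1, 4, 5), (0, 2, 3, 4), (0, 2, 3, 5), (0, 2, 4, 5), (0, 3, 4, 5), (1, 2, 3, 4),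
      (1, 2, 3, 5), (1, 2, 4, 5), (1, 3, 4, 5),
      ((2, 3, 4, 5) : Fin 6 × Fin 6 × Fin 6 × Fin 6)] := by
  revert i j k l
  decide +kernel

theorem eq_zero (h0 : ∀ i j k l, i < j → j < k → k < l → s i j k l = 0) (i j k l : Fin 6) :
    s i j k l = 0 := by
  have h1 : ∀ i j k l, j < k → k < l → s i j k l = 0 := by
    intro i j k l hjk hkl
    rcases lt_trichotomy i j with h' | rfl | h'
    · exact h0 _ _ _ _ h' hjk hkl
    · exact h.self₁₂ _ _ _
    rw [h.swap₁₂, neg_eq_zero]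
    rcases lt_trichotomy i k with h'' | rfl | h''
    · exact h0 _ _ _ _ h' h'' hkl
    · exact h.self₂₃ _ _ _
    rw [h.swap₂₃, neg_eq_zero]
    rcases lt_trichotomy i l with h3 | rfl | h3
    · exact h0 _ _ _ _ hjk h'' h3
    · exact h.self₃₄ _ _ _
    rw [h.swap₃₄, neg_eq_zero]
    exact h0 _ _ _ _ hjk hkl h3
  have h2 : ∀ i j k l, k < l → s i j k l = 0 := by
    intro i j k l hkl
    rcases lt_trichotomy j k with h' | rfl | h'
    · exact h1 _ _ _ _ h' hkl
    · exact h.self₂₃ _ _ _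
    rw [h.swap₂₃, neg_eq_zero]
    rcases lt_trichotomy j l with h3 | rfl | h3
    · exact h1 _ _ _ _ h' h3
    · exact h.self₃₄ _ _ _
    rw [h.swap₃₄, neg_eq_zero]
    exact h1 _ _ _ _ hkl h3
  rcases lt_trichotomy k l with h' | rfl | h'
  · exact h2 _ _ _ _ h'
  · exact h.self₃₄ _ _ _
  rw [h.swap₃₄, neg_eq_zero]
  exact h2 _ _ _ _ h'

end IsAlt4

/-- The components `∑ a, t_{ija} t'_{kla}`, summed cyclically over `i, j, k`; for `t = t'` the
components of a `3`-form, these are the components of the `4`-form `σ` built from it. -/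
def cyclicContraction (t t' : Fin 6 → Fin 6 → Fin 6 → ℝ) (i j k l : Fin 6) : ℝ :=
  ∑ a, (t i j a * t' k l a + t j k a * t' i l a + t k i a * t' j l a)

theorem IsAlt3.isAlt4_cyclicContraction {t : Fin 6 → Fin 6 → Fin 6 → ℝ} (h : IsAlt3 t) :
    IsAlt4 (cyclicContraction t t) where
  swap₁₂ i j k l := by
    rw [cyclicContraction, cyclicContraction, ← Finset.sum_neg_distrib]
    refine Finset.sum_congr rfl fun a _ => ?_
    rw [h.swap₁₂ i j, h.swap₁₂ k i, h.swap₁₂ j k]; ring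
  swap₂₃ i j k l := by
    rw [cyclicContraction, cyclicContraction, ← Finset.sum_neg_distrib]
    refine Finset.sum_congr rfl fun a _ => ?_
    rw [h.swap₁₂ k i, h.swap₁₂ j k, h.swap₁₂ i j]; ring
  swap₃₄ i j k l := by
    rw [cyclicContraction, cyclicContraction, ← Finset.sum_neg_distrib]
    refine Finset.sum_congr rfl fun a _ => ?_
    rw [h.swap₁₂ k l, h.swap₁₂ i l, h.swap₁₂ k i]; ring

/-- The indices of `e₁, e₃, e₅`, in the basis `(e₁, Je₁, e₃, Je₃, e₅, Je₅)`. -/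
def pIdx : Fin 3 → Fin 6 := ![0, 2, 4]

/-- The indices of `Je₁, Je₃, Je₅`. -/
def qIdx : Fin 3 → Fin 6 := ![1, 3, 5]

theorem exists_eq_pIdx_or_qIdx (i : Fin 6) : (∃ l, i = pIdx l) ∨ ∃ l, i = qIdx l := by
  revert i
  unfold pIdx qIdx
  decide

/-- The `(3,0)` component `ζ = t(Z₁, Z₂, Z₃)` of a `3`-form, where `Z_k = e - iJe` is the vector of
type `(1,0)` defined by `e = e_{pIdx k}`. -/
def torsionZeta (t : Fin 6 → Fin 6 → Fin 6 → ℝ) : ℂ :=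
  ⟨t 0 2 4 - t 1 3 4 - t 1 2 5 - t 0 3 5, t 1 3 5 - t 1 2 4 - t 0 3 4 - t 0 2 5⟩

/-- The `(2,1)` components `B_{kl} = t(Z_{k+1}, Z_{k+2}, Z̄_l)` of a `3`-form, with indices
modulo `3`. -/
def torsionMatrix (t : Fin 6 → Fin 6 → Fin 6 → ℝ) : Matrix (Fin 3) (Fin 3) ℂ :=
  Matrix.of fun k l =>
    ⟨t (pIdx (k + 1)) (pIdx (k + 2)) (pIdx l) - t (qIdx (k + 1)) (qIdx (k + 2)) (pIdx l)
        + t (qIdx (k + 1)) (pIdx (k + 2)) (qIdx l) + t (pIdx (k + 1)) (qIdx (k + 2)) (qIdx l),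
      t (pIdx (k + 1)) (pIdx (k + 2)) (qIdx l) - t (qIdx (k + 1)) (qIdx (k + 2)) (qIdx l)
        - t (qIdx (k + 1)) (pIdx (k + 2)) (pIdx l) - t (pIdx (k + 1)) (qIdx (k + 2)) (pIdx l)⟩

/-- The skew part of the matrix `B` as a vector, `B - Bᵀ = crossMatrix v`; it is the trace of the
`(2,1)` part of the `3`-form. -/
def torsionVector (t : Fin 6 → Fin 6 → Fin 6 → ℝ) : Fin 3 → ℂ := fun l =>
  torsionMatrix t (l + 1) (l + 2) - torsionMatrix t (l + 2) (l + 1)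

/-- A `4`-form in six dimensions is of type `(2,2)`, that is `J`-invariant. By skew-symmetry it is
enough to compare the components containing a pair `e, Je` of basis vectors and one vector from each
of the two other pairs. -/
def IsType22 (s : Fin 6 → Fin 6 → Fin 6 → Fin 6 → ℝ) : Prop :=
  ∀ l : Fin 3,
    s (pIdx l) (qIdx l) (pIdx (l + 1)) (pIdx (l + 2))
        = s (pIdx l) (qIdx l) (qIdx (l + 1)) (qIdx (l + 2)) ∧
      s (pIdx l) (qIdx l) (pIdx (l + 1)) (qIdx (l + 2))
        = -s (pIdx l) (qIdx l) (qIdx (l + 1)) (pIdx (l + 2))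

/-- The Hermitian matrix `H_{kl} = 2 s(Z_{k+1}, Z_{k+2}, Z̄_{l+1}, Z̄_{l+2})` of a `4`-form `s` of
type `(2,2)`. Off the diagonal, each entry is written with one of the two components of `s` which
agree up to sign by the type condition. -/
def hermitianPart (s : Fin 6 → Fin 6 → Fin 6 → Fin 6 → ℝ) : Matrix (Fin 3) (Fin 3) ℂ :=
  !![⟨8 * s 2 3 4 5, 0⟩, ⟨8 * s 1 2 4 5, -8 * s 0 2 4 5⟩, ⟨-8 * s 0 2 3 5, -8 * s 0 2 3 4⟩;
     ⟨8 * s 1 2 4 5, 8 * s 0 2 4 5⟩, ⟨8 * s 0 1 4 5, 0⟩, ⟨8 * s 0 1 3 4, -8 * s 0 1 2 4⟩;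
     ⟨-8 * s 0 2 3 5, 8 * s 0 2 3 4⟩, ⟨8 * s 0 1 3 4, 8 * s 0 1 2 4⟩, ⟨8 * s 0 1 2 3, 0⟩]

open Matrix

set_option linter.unusedSimpArgs false

variable {t : Fin 6 → Fin 6 → Fin 6 → ℝ}

set_option maxHeartbeats 2000000 in
/-- The type condition on the quadratic `4`-form `cyclicContraction t t`, in terms of `ζ`, `B`
and `v`. -/
theorem IsAlt3.vecMul_torsionMatrix (ht : IsAlt3 t) (h22 : IsType22 (cyclicContraction t t)) :
    torsionVector t ᵥ* torsionMatrix t = -(torsionZeta t • star (torsionVector t)) := by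
  ext l
  have h := h22 l
  fin_cases l
  all_goals
    simp only [pIdx, qIdx, Fin.zero_eta, Fin.mk_one, Fin.reduceFinMk, Fin.isValue, Fin.reduceAdd,
      zero_add, cons_val] at h
    simp only [cyclicContraction, Fin.sum_univ_six, ht.self₁₂, ht.self₂₃, ht.sort₁₂, ht.sort₂₃,
      Fin.reduceLT, neg_neg, neg_zero, zero_mul, mul_zero, add_zero, zero_add] at h
    obtain ⟨h1, h2⟩ := h
    apply Complex.ext
    all_goals
      simp [torsionZeta, torsionVector, torsionMatrix, pIdx, qIdx, vecMul, dotProduct,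
        Fin.sum_univ_three]
      simp only [ht.self₁₂, ht.self₂₃, ht.sort₁₂, ht.sort₂₃, Fin.reduceLT]
      first
      | linear_combination 4 * h1
      | linear_combination 4 * h2
      | linear_combination -4 * h1
      | linear_combination -4 * h2

set_option maxHeartbeats 4000000 in
/-- The quadratic form `cyclicContraction t t` of type `(2,2)` in terms of `ζ`, `B` and `v`. -/
theorem IsAlt3.hermitianPart_eq (ht : IsAlt3 t) (h22 : IsType22 (cyclicContraction t t)) :
    hermitianPart (cyclicContraction t t) =
      (torsionZeta t * star (torsionZeta t)) • (1 : Matrix (Fin 3) (Fin 3) ℂ)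
        + torsionMatrix t * (torsionMatrix t)ᴴ + (torsionMatrix t)ᵀ * (torsionMatrix t)ᴴᵀ
        + vecMulVec (star (torsionVector t)) (torsionVector t)
        - (torsionMatrix t * (torsionMatrix t)ᴴ).trace • (1 : Matrix (Fin 3) (Fin 3) ℂ) := by
  have h0 := h22 0
  have h1 := h22 1
  have h2 := h22 2
  simp only [pIdx, qIdx, Fin.isValue, Fin.reduceAdd, zero_add, cons_val] at h0 h1 h2
  simp only [cyclicContraction, Fin.sum_univ_six, ht.self₁₂, ht.self₂₃, ht.sort₁₂, ht.sort₂₃,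
      Fin.reduceLT, neg_neg, neg_zero, zero_mul, mul_zero, add_zero, zero_add] at h0 h1 h2
  obtain ⟨h01, h02⟩ := h0
  obtain ⟨h11, h12⟩ := h1
  obtain ⟨h21, h22⟩ := h2
  ext p q
  fin_cases p <;> fin_cases q <;> apply Complex.ext
  all_goals
    simp [hermitianPart, torsionZeta, torsionVector, torsionMatrix, pIdx, qIdx, Matrix.mul_apply,
      Fin.sum_univ_three, Matrix.trace, vecMulVec_apply]
    try simp only [cyclicContraction, Fin.sum_univ_six, ht.self₁₂, ht.self₂₃, ht.sort₁₂, ht.sort₂₃,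
      Fin.reduceLT, neg_neg, neg_zero, zero_mul, mul_zero, add_zero, zero_add]
    first
      | ring1
      | linear_combination 4 * h21
      | linear_combination 4 * h22
      | linear_combination -4 * h21
      | linear_combination -4 * h22
      | linear_combination 4 * h01
      | linear_combination 4 * h02
      | linear_combination -4 * h01
      | linear_combination -4 * h02
      | linear_combination 4 * h11
      | linear_combination 4 * h12
      | linear_combination -4 * h11

/-- The components of the derivative of `cyclicContraction t t` in the direction `e_m`, if those of
the derivative of `t` are `s m`. -/
def derivContraction (t : Fin 6 → Fin 6 → Fin 6 → ℝ) (s : Fin 6 → Fin 6 → Fin 6 → Fin 6 → ℝ)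
    (m i j k l : Fin 6) : ℝ :=
  cyclicContraction t (s m) i j k l + cyclicContraction (s m) t i j k l

end

/-! ### Algebraic vanishing of the quadratic four-form -/

section

open Matrix

set_option linter.unusedSimpArgs false

variable {t : Fin 6 → Fin 6 → Fin 6 → ℝ} {s : Fin 6 → Fin 6 → Fin 6 → Fin 6 → ℝ}

theorem IsAlt4.type22_relations (hs : IsAlt4 s) (h22 : IsType22 s) :
    s 0 1 3 5 = s 0 1 2 4 ∧ s 0 1 2 5 = -s 0 1 3 4 ∧ s 1 2 3 5 = s 0 2 3 4 ∧
      s 1 2 3 4 = -s 0 2 3 5 ∧ s 1 3 4 5 = s 0 2 4 5 ∧ s 0 3 4 5 = -s 1 2 4 5 := by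
  have h0 := h22 0
  have h1 := h22 1
  have h2 := h22 2
  simp only [pIdx, qIdx, Fin.isValue, Fin.reduceAdd, zero_add, cons_val, hs.sort₁₂, hs.sort₂₃,
    hs.sort₃₄, Fin.reduceLT, neg_neg] at h0 h1 h2
  refine ⟨h0.1.symm, h0.2, ?_, ?_, h2.1.symm, h2.2⟩ <;> linarith [h1.1, h1.2]

set_option maxHeartbeats 4000000 in
/-- One half of the type condition on the forms `derivContraction t s m`, in matrix form:
`H B - tr(H) B` is minus the skew matrix of `vᵀ H`. -/
theorem IsAlt3.hermitianPart_mul (ht : IsAlt3 t) (hs : IsAlt4 s)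
    (h22 : IsType22 s) (hD : ∀ m, IsType22 (derivContraction t s m)) (m l : Fin 3) :
    (hermitianPart s * torsionMatrix t) m l - (hermitianPart s).trace * torsionMatrix t m l +
      crossMatrix (torsionVector t ᵥ* hermitianPart s) m l = 0 := by
  obtain ⟨r1, r2, r3, r4, r5, r6⟩ := hs.type22_relations h22
  obtain ⟨hX1, hX2⟩ := hD (pIdx m) l
  obtain ⟨hY1, hY2⟩ := hD (qIdx m) l
  clear hD h22
  fin_cases m <;> fin_cases l
  all_goals
    simp only [pIdx, qIdx, Fin.isValue, Fin.reduceAdd, zero_add, cons_val, Fin.zero_eta, Fin.mk_one,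
      Fin.reduceFinMk] at hX1 hX2 hY1 hY2
    simp only [derivContraction, cyclicContraction, Fin.sum_univ_six,
      ht.self₁₂, ht.self₂₃, ht.sort₁₂, ht.sort₂₃, hs.self₁₂, hs.self₂₃, hs.self₃₄, hs.sort₁₂,
      hs.sort₂₃, hs.sort₃₄, Fin.reduceLT, neg_neg, neg_zero, mul_zero, zero_mul, add_zero, zero_add,
      r1, r2, r3, r4, r5, r6] at hX1 hX2 hY1 hY2
    apply Complex.ext
    · simp [hermitianPart, torsionVector, torsionMatrix, pIdx, qIdx, mul_apply, vecMul, dotProduct,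
        Fin.sum_univ_three, trace, crossMatrix]
      simp only [ht.self₁₂, ht.self₂₃, ht.sort₁₂, ht.sort₂₃, hs.self₁₂, hs.self₂₃, hs.self₃₄,
        hs.sort₁₂,
      hs.sort₂₃, hs.sort₃₄, Fin.reduceLT, neg_neg, neg_zero, mul_zero, zero_mul, add_zero, zero_add]
      linear_combination 8 * hY1 - 8 * hX2
    · simp [hermitianPart, torsionVector, torsionMatrix, pIdx, qIdx, mul_apply, vecMul, dotProduct,
        Fin.sum_univ_three, trace, crossMatrix]
      simp only [ht.self₁₂, ht.self₂₃, ht.sort₁₂, ht.sort₂₃, hs.self₁₂, hs.self₂₃, hs.self₃₄,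
        hs.sort₁₂,
      hs.sort₂₃, hs.sort₃₄, Fin.reduceLT, neg_neg, neg_zero, mul_zero, zero_mul, add_zero, zero_add]
      linear_combination -8 * hX1 - 8 * hY2

set_option maxHeartbeats 4000000 in
/-- The other half of the type condition on the forms `derivContraction t s m`:
`ζ (H̄ - tr(H)) = 0`. -/
theorem IsAlt3.torsionZeta_mul (ht : IsAlt3 t) (hs : IsAlt4 s)
    (h22 : IsType22 s) (hD : ∀ m, IsType22 (derivContraction t s m)) (m l : Fin 3) :
    torsionZeta t * (star (hermitianPart s m l) -
      if m = l then (hermitianPart s).trace else 0) = 0 := by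
  obtain ⟨r1, r2, r3, r4, r5, r6⟩ := hs.type22_relations h22
  obtain ⟨hX1, hX2⟩ := hD (pIdx m) l
  obtain ⟨hY1, hY2⟩ := hD (qIdx m) l
  clear hD h22
  fin_cases m <;> fin_cases l
  all_goals
    simp only [pIdx, qIdx, Fin.isValue, Fin.reduceAdd, zero_add, cons_val, Fin.zero_eta, Fin.mk_one,
      Fin.reduceFinMk] at hX1 hX2 hY1 hY2
    simp only [derivContraction, cyclicContraction, Fin.sum_univ_six,
      ht.self₁₂, ht.self₂₃, ht.sort₁₂, ht.sort₂₃, hs.self₁₂, hs.self₂₃, hs.self₃₄, hs.sort₁₂,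
      hs.sort₂₃, hs.sort₃₄, Fin.reduceLT, neg_neg, neg_zero, mul_zero, zero_mul, add_zero, zero_add,
      r1, r2, r3, r4, r5, r6] at hX1 hX2 hY1 hY2
    apply Complex.ext
    · simp [hermitianPart, torsionZeta, Fin.sum_univ_three, trace, -mul_eq_zero]
      linear_combination -8 * hX2 - 8 * hY1
    · simp [hermitianPart, torsionZeta, Fin.sum_univ_three, trace, -mul_eq_zero]
      linear_combination -8 * hX1 + 8 * hY2

/-- If the quadratic `4`-form `s` of a `3`-form `t` is of type `(2,2)`, as well as the forms
`derivContraction t s m`, then `s = 0`. If `ζ ≠ 0` then `H̄ = tr(H) 1`, whence `H = 0`; if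
`ζ = 0` the conclusion is `hermitian_eq_zero_of_mul_eq_trace_smul` for the symmetric and skew parts
of `B`. -/
theorem IsAlt3.cyclicContraction_eq_zero (ht : IsAlt3 t)
    (h22 : IsType22 (cyclicContraction t t))
    (hD : ∀ m, IsType22 (derivContraction t (cyclicContraction t t) m)) (i j k l : Fin 6) :
    cyclicContraction t t i j k l = 0 := by
  have hs := ht.isAlt4_cyclicContraction
  set s := cyclicContraction t t with hst
  have hH : hermitianPart s = 0 := by
    by_cases hz : torsionZeta t = 0
    · set B := torsionMatrix t with hB
      set v := torsionVector t with hv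
      have hvA : v ᵥ* crossMatrix v = 0 := by
        ext j
        fin_cases j <;> simp [crossMatrix, vecMul, dotProduct, Fin.sum_univ_three] <;> ring
      have hAB : (1 / 2 : ℂ) • (B - Bᵀ) = (1 / 2 : ℂ) • crossMatrix v := by
        congr 1
        ext p q
        fin_cases p <;> fin_cases q <;> simp [crossMatrix, hv, torsionVector, ← hB]
      have hvB : v ᵥ* B = 0 := by
        rw [ht.vecMul_torsionMatrix h22, hz]; simp
      have hBS : (1 / 2 : ℂ) • (B + Bᵀ) + (1 / 2 : ℂ) • (B - Bᵀ) = B := by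
        ext p q; simp; ring
      have hvS : v ᵥ* ((1 / 2 : ℂ) • (B + Bᵀ)) = 0 := by
        have : (1 / 2 : ℂ) • (B + Bᵀ) = B - (1 / 2 : ℂ) • crossMatrix v := by
          rw [← hAB]; ext p q; simp; ring
        rw [this, vecMul_sub, hvB, vecMul_smul, hvA]; simp
      have hh : hermitianPart s = (2 : ℂ) • (((1 / 2 : ℂ) • (B + Bᵀ)) * ((1 / 2 : ℂ) • (B + Bᵀ))ᴴ)
          - (((1 / 2 : ℂ) • (B + Bᵀ)) * ((1 / 2 : ℂ) • (B + Bᵀ))ᴴ).trace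
            • (1 : Matrix (Fin 3) (Fin 3) ℂ)
          + (1 / 2 : ℂ) • vecMulVec (star v) v := by
        rw [ht.hermitianPart_eq h22, hz, ← hB, ← hv]
        ext p q
        fin_cases p <;> fin_cases q <;>
          simp [hv, torsionVector, ← hB, Matrix.mul_apply, Fin.sum_univ_three, Matrix.trace,
            vecMulVec_apply, map_ofNat] <;> ring
      have hvh : v ᵥ* hermitianPart s = (hermitianPart s).trace • v := by
        have h1 : v ᵥ* hermitianPart s
            = (-(((1 / 2 : ℂ) • (B + Bᵀ)) * ((1 / 2 : ℂ) • (B + Bᵀ))ᴴ).trace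
              + (1 / 2) * (v ⬝ᵥ star v)) • v := by
          conv_lhs => rw [hh]
          rw [vecMul_add, vecMul_sub, vecMul_smul, ← vecMul_vecMul, hvS, zero_vecMul, vecMul_smul,
            vecMul_one, vecMul_smul, vecMul_vecMulVec]
          ext j; simp; ring
        have h2 : (hermitianPart s).trace
            = -(((1 / 2 : ℂ) • (B + Bᵀ)) * ((1 / 2 : ℂ) • (B + Bᵀ))ᴴ).trace
              + (1 / 2) * (v ⬝ᵥ star v) := by
          rw [hh]
          simp only [trace_add, trace_sub, trace_smul, trace_one, smul_eq_mul,
            Fintype.card_fin, trace_vecMulVec, dotProduct_comm (star v) v]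
          push_cast; ring
        rw [h1, h2]
      refine hermitian_eq_zero_of_mul_eq_trace_smul ((1 / 2 : ℂ) • (B + Bᵀ))
        ((1 / 2 : ℂ) • (B - Bᵀ)) _ v
        ?_ hAB hh hvS hvh ?_
      · simp [add_comm]
      · have hE := ht.hermitianPart_mul hs h22 hD
        rw [← hB, ← hv, hvh] at hE
        have hc : crossMatrix ((hermitianPart s).trace • v)
            = (hermitianPart s).trace • (B - Bᵀ) := by
          have : B - Bᵀ = crossMatrix v := by
            have := congrArg (fun X => (2 : ℂ) • X) hAB
            simpa [smul_smul] using this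
          rw [this]
          ext p q
          fin_cases p <;> fin_cases q <;> simp [crossMatrix]
        rw [hBS]
        ext p q
        have := hE p q
        rw [hc] at this
        simp only [Matrix.smul_apply, Matrix.sub_apply, Matrix.add_apply, Matrix.transpose_apply,
          smul_eq_mul] at this ⊢
        linear_combination this
    · have h1 : ∀ m l, star (hermitianPart s m l)
          = if m = l then (hermitianPart s).trace else 0 := fun m l =>
        sub_eq_zero.1 ((mul_eq_zero.1 (ht.torsionZeta_mul hs h22 hD m l)).resolve_left hz)
      have h2 : star (hermitianPart s).trace = 3 * (hermitianPart s).trace := by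
        have e : star (hermitianPart s).trace = star (hermitianPart s 0 0)
          + star (hermitianPart s 1 1) + star (hermitianPart s 2 2) := by
          simp [Matrix.trace, Fin.sum_univ_three]
        rw [e, h1, h1, h1]; simp; ring
      have h3 : (hermitianPart s).trace = 0 := by
        have hr := congrArg Complex.re h2
        have hi := congrArg Complex.im h2
        simp at hr hi
        apply Complex.ext <;> simp <;> linarith
      ext m l
      have := h1 m l
      rw [h3, ite_self] at this
      simpa using this
  obtain ⟨r1, r2, r3, r4, r5, r6⟩ := hs.type22_relations h22
  have key : ∀ p q, (hermitianPart s p q).re = 0 ∧ (hermitianPart s p q).im = 0 := by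
    intro p q; rw [hH]; simp
  have k1 := key 0 0
  have k2 := key 1 1
  have k3 := key 2 2
  have k4 := key 0 1
  have k5 := key 1 2
  have k6 := key 2 0
  simp [hermitianPart] at k1 k2 k3 k4 k5 k6
  refine hs.eq_zero (fun i j k l hij hjk hkl => ?_) i j k l
  have := IsAlt4.mem_of_strictMono i j k l hij hjk hkl
  simp only [List.mem_cons, Prod.mk.injEq, List.not_mem_nil, or_false] at this
  rcases this with h | h | h | h | h | h | h | h | h | h | h | h | h | h | h <;>
    obtain ⟨rfl, rfl, rfl, rfl⟩ := h <;> simp_all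

end

/-! ### The standard form of type `(3,0)` -/

section

/-- The components `e_{2a+1} + i e_{2a+2}` of the standard unitary coframe. -/
def unitaryCoframe (a : Fin 3) (i : Fin 6) : ℂ :=
  if i = pIdx a then 1 else if i = qIdx a then Complex.I else 0

/-- The components of the standard complex volume form
`-(e₁ + ie₂) ∧ (e₃ + ie₄) ∧ (e₅ + ie₆)`. -/
def stdPsi (i j k : Fin 6) : ℂ :=
  -(Matrix.of fun a c : Fin 3 => unitaryCoframe a (![i, j, k] c)).det

theorem sum_unitaryCoframe (a : Fin 3) (f : Fin 6 → ℂ) :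
    ∑ i, f i * unitaryCoframe a i = f (pIdx a) + Complex.I * f (qIdx a) := by
  fin_cases a <;> simp [Fin.sum_univ_six, unitaryCoframe, pIdx, qIdx] <;> ring

theorem IsAlt3.sum_mul_stdPsi {t : Fin 6 → Fin 6 → Fin 6 → ℝ} (ht : IsAlt3 t) :
    ∑ i, ∑ j, ∑ k, (t i j k : ℂ) * stdPsi i j k = -6 * star (torsionZeta t) := by
  have h : ∀ a b c : Fin 3, ∑ i, ∑ j, ∑ k, (t i j k : ℂ) *
      (unitaryCoframe a i * unitaryCoframe b j * unitaryCoframe c k) =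
      (t (pIdx a) (pIdx b) (pIdx c) + Complex.I * t (pIdx a) (pIdx b) (qIdx c)
        + Complex.I * (t (pIdx a) (qIdx b) (pIdx c) + Complex.I * t (pIdx a) (qIdx b) (qIdx c)))
      + Complex.I * (t (qIdx a) (pIdx b) (pIdx c) + Complex.I * t (qIdx a) (pIdx b) (qIdx c)
        + Complex.I * (t (qIdx a) (qIdx b) (pIdx c)
          + Complex.I * t (qIdx a) (qIdx b) (qIdx c))) := by
    intro a b c
    have : ∀ i j k, (t i j k : ℂ) * (unitaryCoframe a i * unitaryCoframe b j * unitaryCoframe c k) =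
        t i j k * unitaryCoframe c k * unitaryCoframe b j * unitaryCoframe a i :=
      fun i j k => by ring
    simp only [this, ← Finset.sum_mul]
    rw [sum_unitaryCoframe, sum_unitaryCoframe, sum_unitaryCoframe, sum_unitaryCoframe,
      sum_unitaryCoframe, sum_unitaryCoframe, sum_unitaryCoframe]
  have hdet : ∀ i j k, (t i j k : ℂ) * stdPsi i j k =
      -(t i j k * (unitaryCoframe 0 i * unitaryCoframe 1 j * unitaryCoframe 2 k))
      + t i j k * (unitaryCoframe 0 i * unitaryCoframe 2 j * unitaryCoframe 1 k)
      + t i j k * (unitaryCoframe 1 i * unitaryCoframe 0 j * unitaryCoframe 2 k)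
      - t i j k * (unitaryCoframe 2 i * unitaryCoframe 0 j * unitaryCoframe 1 k)
      - t i j k * (unitaryCoframe 1 i * unitaryCoframe 2 j * unitaryCoframe 0 k)
      + t i j k * (unitaryCoframe 2 i * unitaryCoframe 1 j * unitaryCoframe 0 k) := by
    intro i j k
    simp only [stdPsi, Matrix.det_fin_three, Matrix.of_apply, Matrix.cons_val]
    ring
  simp only [hdet, Finset.sum_add_distrib, Finset.sum_sub_distrib, Finset.sum_neg_distrib, h]
  simp only [pIdx, qIdx, Matrix.cons_val]
  simp only [ht.sort₁₂, ht.sort₂₃, Fin.reduceLT, torsionZeta]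
  apply Complex.ext
  · simp; ring
  · simp; ring

theorem IsAlt3.sum_mul_stdPsi_re {t : Fin 6 → Fin 6 → Fin 6 → ℝ} (ht : IsAlt3 t) :
    ∑ i, ∑ j, ∑ k, t i j k * (stdPsi i j k).re = -6 * (torsionZeta t).re := by
  have := congrArg Complex.re ht.sum_mul_stdPsi
  simpa using this

theorem IsAlt3.sum_mul_stdPsi_im {t : Fin 6 → Fin 6 → Fin 6 → ℝ} (ht : IsAlt3 t) :
    ∑ i, ∑ j, ∑ k, t i j k * (stdPsi i j k).im = 6 * (torsionZeta t).im := by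
  have := congrArg Complex.im ht.sum_mul_stdPsi
  simpa using this

/-- A `4`-form whose contractions with the standard `(3,0)`-form vanish has type `(2,2)`. -/
theorem IsAlt4.isType22 {s : Fin 6 → Fin 6 → Fin 6 → Fin 6 → ℝ} (hs : IsAlt4 s)
    (h : ∀ i, torsionZeta (s i) = 0) : IsType22 s := by
  have hre : ∀ i, (torsionZeta (s i)).re = 0 := fun i => by rw [h]; rfl
  have him : ∀ i, (torsionZeta (s i)).im = 0 := fun i => by rw [h]; rfl
  intro l
  have r0 := hre 0; have r1 := hre 1; have r2 := hre 2; have r3 := hre 3; have r4 := hre 4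
  have r5 := hre 5
  have m0 := him 0; have m1 := him 1; have m2 := him 2; have m3 := him 3; have m4 := him 4
  have m5 := him 5
  simp only [torsionZeta, hs.self₁₂, hs.self₂₃, hs.self₃₄, hs.sort₁₂, hs.sort₂₃, hs.sort₃₄,
    Fin.reduceLT, neg_neg] at r0 r1 r2 r3 r4 r5 m0 m1 m2 m3 m4 m5
  fin_cases l <;>
    simp only [pIdx, qIdx, Fin.isValue, Fin.reduceAdd, zero_add, Matrix.cons_val, hs.sort₁₂,
      hs.sort₂₃, hs.sort₃₄, Fin.reduceLT, neg_neg, Fin.zero_eta, Fin.mk_one, Fin.reduceFinMk] <;>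
    constructor <;> linarith

/-- As there are no `4`-forms of type `(4,0)`, the contraction `u ↦ ζ(u ⌟ s)` of a `4`-form with the
standard `(3,0)`-form is of type `(0,1)`. -/
theorem IsAlt4.torsionZeta_J {s : Fin 6 → Fin 6 → Fin 6 → Fin 6 → ℝ} (hs : IsAlt4 s) (l : Fin 3) :
    torsionZeta (s (qIdx l)) = -Complex.I * torsionZeta (s (pIdx l)) := by
  fin_cases l <;> apply Complex.ext <;>
    simp [pIdx, qIdx, torsionZeta] <;>
    simp only [hs.self₁₂, hs.self₂₃, hs.self₃₄, hs.sort₁₂, hs.sort₂₃, hs.sort₃₄,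
    Fin.reduceLT, neg_neg] <;> ring

theorem IsAlt4.sub {s s' : Fin 6 → Fin 6 → Fin 6 → Fin 6 → ℝ} (h : IsAlt4 s) (h' : IsAlt4 s') :
    IsAlt4 (fun i j k l => s i j k l - s' i j k l) where
  swap₁₂ i j k l := by rw [h.swap₁₂, h'.swap₁₂]; ring
  swap₂₃ i j k l := by rw [h.swap₂₃, h'.swap₂₃]; ring
  swap₃₄ i j k l := by rw [h.swap₃₄, h'.swap₃₄]; ring

theorem IsAlt3.isAlt4_derivContraction {t : Fin 6 → Fin 6 → Fin 6 → ℝ}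
    {s : Fin 6 → Fin 6 → Fin 6 → Fin 6 → ℝ} (ht : IsAlt3 t) (hs : IsAlt4 s) (m : Fin 6) :
    IsAlt4 (derivContraction t s m) := by
  have h1 : IsAlt3 (s m) := ⟨fun i j k => hs.swap₂₃ m i j k, fun i j k => hs.swap₃₄ m i j k⟩
  have h2 : IsAlt3 (fun i j k => t i j k + s m i j k) :=
    ⟨fun i j k => by rw [ht.swap₁₂, h1.swap₁₂]; ring, fun i j k => by
      rw [ht.swap₂₃, h1.swap₂₃]; ring⟩
  -- polarisation of the quadratic form
  have h3 := IsAlt4.sub (IsAlt4.sub h2.isAlt4_cyclicContraction ht.isAlt4_cyclicContraction)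
    h1.isAlt4_cyclicContraction
  convert h3 using 5 with i j k l
  simp only [derivContraction, cyclicContraction, ← Finset.sum_add_distrib,
    ← Finset.sum_sub_distrib]
  exact Finset.sum_congr rfl fun a _ => by ring

/-- A `4`-form on a six-dimensional space whose contraction with the Kähler form vanishes is
zero. -/
theorem IsAlt4.eq_zero_of_contraction {s : Fin 6 → Fin 6 → Fin 6 → Fin 6 → ℝ} (hs : IsAlt4 s)
    (h : ∀ i j, s i j 0 1 + s i j 2 3 + s i j 4 5 = 0) (i j k l : Fin 6) : s i j k l = 0 := by
  have a01 := h 0 1; have a23 := h 2 3; have a45 := h 4 5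
  have a02 := h 0 2; have a03 := h 0 3; have a12 := h 1 2; have a13 := h 1 3
  have a04 := h 0 4; have a05 := h 0 5; have a14 := h 1 4; have a15 := h 1 5
  have a24 := h 2 4; have a25 := h 2 5; have a34 := h 3 4; have a35 := h 3 5
  simp only [hs.self₁₂, hs.self₂₃, hs.self₃₄, hs.sort₁₂, hs.sort₂₃, hs.sort₃₄, Fin.reduceLT,
    neg_neg] at a01 a23 a45 a02 a03 a12 a13 a04 a05 a14 a15 a24 a25 a34 a35
  refine hs.eq_zero (fun i j k l hij hjk hkl => ?_) i j k l
  have := IsAlt4.mem_of_strictMono i j k l hij hjk hkl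
  simp only [List.mem_cons, Prod.mk.injEq, List.not_mem_nil, or_false] at this
  rcases this with h | h | h | h | h | h | h | h | h | h | h | h | h | h | h <;>
    obtain ⟨rfl, rfl, rfl, rfl⟩ := h <;> linarith

theorem sum_fin_three_fun {β : Type*} [AddCommMonoid β] (f : (Fin 3 → Fin 6) → β) :
    ∑ i, f i = ∑ a, ∑ b, ∑ c, f ![a, b, c] := by
  rw [← (Fin.consEquiv (fun _ : Fin 3 => Fin 6)).sum_comp, Fintype.sum_prod_type]
  refine Finset.sum_congr rfl fun a _ => ?_
  rw [← (Fin.consEquiv (fun _ : Fin 2 => Fin 6)).sum_comp, Fintype.sum_prod_type]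
  refine Finset.sum_congr rfl fun b _ => ?_
  rw [← (Fin.consEquiv (fun _ : Fin 1 => Fin 6)).sum_comp, Fintype.sum_prod_type]
  refine Finset.sum_congr rfl fun c _ => ?_
  rw [Fintype.sum_unique]
  congr 1

end

/-! ### Smooth functions and vector fields -/

section

variable {M : Type*} [TopologicalSpace M] [ChartedSpace E6 M] [IsManifold (𝓡 6) ∞ M]

/-- Smooth vector fields on `M`. -/
abbrev VF (M : Type*) [TopologicalSpace M] [ChartedSpace E6 M] [IsManifold (𝓡 6) ∞ M] : Type _ :=
  ContMDiffSection (𝓡 6) E6 ∞ (fun x : M => TangentSpace (𝓡 6) x)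

/-- Smooth real functions on `M`. -/
abbrev SF (M : Type*) [TopologicalSpace M] [ChartedSpace E6 M] : Type _ :=
  ContMDiffMap (𝓡 6) 𝓘(ℝ, ℝ) M ℝ ∞

/-- A vector field as a map into the total space of the tangent bundle. -/
abbrev sec (V : ∀ x : M, TangentSpace (𝓡 6) x) (x : M) :
    TotalSpace E6 (fun x : M => TangentSpace (𝓡 6) x) := ⟨x, V x⟩

theorem VF.mdiffAt (V : VF M) (x : M) :
    MDifferentiableAt (𝓡 6) ((𝓡 6).prod 𝓘(ℝ, E6)) (sec V) x :=
  (V.contMDiff x).mdifferentiableAt (by simp)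

theorem SF.mdiffAt (f : SF M) (x : M) : MDifferentiableAt (𝓡 6) 𝓘(ℝ, ℝ) f x :=
  (f.contMDiff x).mdifferentiableAt (by simp)

/-- The product `fV` of a smooth function and a smooth vector field. -/
def VF.fmul (f : SF M) (V : VF M) : VF M :=
  ⟨fun x => f x • V x, f.contMDiff.smul_section V.contMDiff⟩

@[simp] theorem VF.fmul_apply (f : SF M) (V : VF M) (x : M) : VF.fmul f V x = f x • V x := rfl

variable [T2Space M]

/-- A smooth cut-off function supported in a given neighbourhood of `x`, equal to `1` near `x`. -/
theorem exists_bump (x : M) {s : Set M} (hs : s ∈ 𝓝 x) :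
    ∃ φ : SF M, (∀ᶠ y in 𝓝 x, φ y = 1) ∧ tsupport φ ⊆ s := by
  obtain ⟨f, -, hf⟩ := (SmoothBumpFunction.nhds_basis_tsupport (I := 𝓡 6) x).mem_iff.1 hs
  exact ⟨⟨f, f.contMDiff⟩, f.eventuallyEq_one, hf⟩

theorem exists_VF_eventuallyEq {x : M} {V : ∀ y : M, TangentSpace (𝓡 6) y}
    {s : Set M} (hs : s ∈ 𝓝 x) (hs' : IsOpen s)
      (hV : ContMDiffOn (𝓡 6) ((𝓡 6).prod 𝓘(ℝ, E6)) ∞ (sec V) s) :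
    ∃ W : VF M, ∀ᶠ y in 𝓝 x, W y = V y := by
  obtain ⟨φ, h1, h2⟩ := exists_bump x hs
  refine ⟨⟨fun y => φ y • V y, ?_⟩, ?_⟩
  · exact ContMDiffOn.smul_section_of_tsupport φ.contMDiff.contMDiffOn hs' h2 hV
  · filter_upwards [h1] with y hy
    change φ y • V y = V y
    rw [hy, one_smul]

theorem exists_SF_eventuallyEq {x : M} {f : M → ℝ}
    {s : Set M} (hs : s ∈ 𝓝 x) (hs' : IsOpen s) (hf : ContMDiffOn (𝓡 6) 𝓘(ℝ, ℝ) ∞ f s) :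
    ∃ g : SF M, ∀ᶠ y in 𝓝 x, g y = f y := by
  obtain ⟨φ, h1, h2⟩ := exists_bump x hs
  refine ⟨⟨fun y => φ y * f y, ?_⟩, ?_⟩
  · refine contMDiff_of_tsupport fun y hy => ?_
    have hy' := h2 (closure_mono (by intro z hz; simp at hz ⊢; exact hz.1) hy)
    exact (φ.contMDiff y).mul ((hf y hy').contMDiffAt (hs'.mem_nhds hy'))
  · filter_upwards [h1] with y hy
    change φ y * f y = f y
    rw [hy, one_mul]

theorem exists_VF_eventuallyEq_field {x : M} (v : TangentSpace (𝓡 6) x) :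
    ∃ W : VF M, ∀ᶠ y in 𝓝 x, W y = field v y := by
  obtain ⟨s, hs, h⟩ := FiberBundle.exists_contMDiffOn_extend (k := ∞) (𝓡 6) E6 v
  obtain ⟨t, hts, ht, hxt⟩ := mem_nhds_iff.1 hs
  exact exists_VF_eventuallyEq (ht.mem_nhds hxt) ht (h.mono hts)

/-- A smooth vector field on `M` with the germ of `field v` at `x`. -/
def VF.ext {x : M} (v : TangentSpace (𝓡 6) x) : VF M := (exists_VF_eventuallyEq_field v).choose

theorem VF.ext_eventuallyEq {x : M} (v : TangentSpace (𝓡 6) x) :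
    ∀ᶠ y in 𝓝 x, VF.ext v y = field v y := (exists_VF_eventuallyEq_field v).choose_spec

theorem field_self {x : M} (v : TangentSpace (𝓡 6) x) : field v x = v := by
  simp [field]

@[simp] theorem VF.ext_self {x : M} (v : TangentSpace (𝓡 6) x) : VF.ext v x = v :=
  (VF.ext_eventuallyEq v).self_of_nhds.trans (field_self v)

theorem field_mdiffAt {x : M} (v : TangentSpace (𝓡 6) x) :
    MDifferentiableAt (𝓡 6) ((𝓡 6).prod 𝓘(ℝ, E6)) (sec (field v)) x :=
  FiberBundle.mdifferentiableAt_extend (𝓡 6) E6 v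

/-- The values of a `C^∞(M)`-linear operation on vector fields depend only on the values of the
fields. -/
theorem VF.tensorial {A : Type*} [AddCommGroup A] [Module ℝ A] (x : M) (Φ : VF M → A)
    (hadd : ∀ V W, Φ (V + W) = Φ V + Φ W) (hmul : ∀ f V, Φ (VF.fmul f V) = f x • Φ V)
    {V W : VF M} (h : V x = W x) : Φ V = Φ W := by
  have hsum : ∀ (s : Finset (Fin 6)) (X : Fin 6 → VF M), Φ (∑ i ∈ s, X i) = ∑ i ∈ s, Φ (X i) := by
    intro s X
    have h0 : Φ 0 = 0 := by simpa using hadd 0 0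
    exact map_sum (⟨⟨Φ, h0⟩, hadd⟩ : VF M →+ A) X s
  let t := trivializationAt E6 (fun x : M => TangentSpace (𝓡 6) x) x
  have hx : x ∈ t.baseSet := FiberBundle.mem_baseSet_trivializationAt E6 _ x
  let b := (EuclideanSpace.basisFun (Fin 6) ℝ).toBasis
  choose E hE using fun i => exists_VF_eventuallyEq (t.open_baseSet.mem_nhds hx) t.open_baseSet
    (t.contMDiffOn_localFrame_baseSet (I := 𝓡 6) ∞ b i)
  have hc : ∀ (X : VF M) i, ∃ g : SF M, ∀ᶠ y in 𝓝 x, g y = t.localFrameCoeff (𝓡 6) b i y (X y) :=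
    fun X i => exists_SF_eventuallyEq (t.open_baseSet.mem_nhds hx) t.open_baseSet
      (contMDiffOn_baseSet_localFrameCoeff b X.contMDiff.contMDiffOn i)
  choose c hc using hc
  have key : ∀ X : VF M, Φ X = ∑ i, t.localFrameCoeff (𝓡 6) b i x (X x) • Φ (E i) := by
    intro X
    have h1 : ∀ᶠ y in 𝓝 x, X y = (∑ i, VF.fmul (c X i) (E i)) y := by
      filter_upwards [eventually_all.2 hE, eventually_all.2 (hc X), t.open_baseSet.mem_nhds hx]
        with y h1 h2 h3
      rw [Trivialization.eq_sum_localFrameCoeff_smul (I := 𝓡 6) (b := b) (e := t) (s := X) h3]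
      have : (∑ i, VF.fmul (c X i) (E i)) y = ∑ i, (VF.fmul (c X i) (E i)) y := by
        have h := congrFun (map_sum (ContMDiffSection.coeAddHom (𝓡 6) E6 ∞
          (fun x : M => TangentSpace (𝓡 6) x)) (fun i => VF.fmul (c X i) (E i)) Finset.univ) y
        rw [Finset.sum_apply] at h
        exact h
      rw [this]
      exact Finset.sum_congr rfl fun i _ => by rw [VF.fmul_apply, h1 i, h2 i]
    obtain ⟨φ, h2, h3⟩ := exists_bump x h1
    have h4 : VF.fmul φ X = VF.fmul φ (∑ i, VF.fmul (c X i) (E i)) := by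
      ext y
      by_cases hy : y ∈ tsupport φ
      · rw [VF.fmul_apply, VF.fmul_apply]; congr 1; exact h3 hy
      · rw [VF.fmul_apply, VF.fmul_apply, image_eq_zero_of_notMem_tsupport hy, zero_smul, zero_smul]
    have h5 := congrArg Φ h4
    rw [hmul, hmul, h2.self_of_nhds, one_smul, one_smul, hsum] at h5
    rw [h5]
    exact Finset.sum_congr rfl fun i _ => by rw [hmul, (hc X i).self_of_nhds]
  rw [key, key, h]

end

/-! ### Derivatives, brackets, connections and inner products of smooth fields -/

section

variable {M : Type*} [TopologicalSpace M] [ChartedSpace E6 M] [IsManifold (𝓡 6) ∞ M]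

/-- The derivative `U f` of a smooth function along a smooth vector field. -/
def dir (U : VF M) (f : SF M) : SF M :=
  ⟨fun x => mvfderiv (𝓡 6) f x (U x),
    (contMDiff_snd_tangentBundle_modelSpace ℝ 𝓘(ℝ, ℝ)).comp
      ((f.contMDiff.contMDiff_tangentMap (m := ∞) (by simp)).comp U.contMDiff)⟩

theorem dir_apply (U : VF M) (f : SF M) (x : M) : dir U f x = mvfderiv (𝓡 6) f x (U x) := rfl

theorem dir_add (U : VF M) (f g : SF M) : dir U (f + g) = dir U f + dir U g := by
  ext x
  have := mvfderiv_add (f.mdiffAt x) (g.mdiffAt x)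
  exact congrArg (fun L => L (U x)) this

theorem dir_mul (U : VF M) (f g : SF M) : dir U (f * g) = dir U f * g + f * dir U g := by
  ext x
  have := congrArg (fun L => L (U x)) (mvfderiv_mul (f.mdiffAt x) (g.mdiffAt x))
  refine this.trans ?_
  simp [dir_apply]
  ring

theorem dir_const (U : VF M) (c : ℝ) : dir U (ContMDiffMap.const c) = 0 := by
  ext x
  exact congrArg (fun L => L (U x)) (mvfderiv_const c (x := x))

theorem dir_sub_left (U V : VF M) (f : SF M) : dir (U - V) f = dir U f - dir V f := by
  ext x; simp [dir_apply]

theorem dir_sum {ι : Type*} (s : Finset ι) (U : VF M) (f : ι → SF M) :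
    dir U (∑ i ∈ s, f i) = ∑ i ∈ s, dir U (f i) := by
  have h0 : dir U (0 : SF M) = 0 := by simpa using dir_add U 0 0
  exact map_sum (⟨⟨dir U, h0⟩, dir_add U⟩ : SF M →+ SF M) f s

theorem SF.sum_apply' {ι : Type*} (s : Finset ι) (f : ι → SF M) (x : M) :
    (∑ i ∈ s, f i) x = ∑ i ∈ s, f i x := by
  have h := congrFun (map_sum (ContMDiffMap.coeFnAddMonoidHom : SF M →+ (M → ℝ)) f s) x
  rw [Finset.sum_apply] at h
  exact h

theorem isManifold_minSmoothness : IsManifold (𝓡 6) (minSmoothness ℝ 3) M :=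
  IsManifold.of_le (n := ∞) (by rw [minSmoothness_of_isRCLikeNormedField]; norm_cast)

/-- The Lie bracket of smooth vector fields. -/
def lie (U V : VF M) : VF M :=
  ⟨VectorField.mlieBracket (𝓡 6) U V, by
    have := isManifold_minSmoothness (M := M)
    have : IsManifold (𝓡 6) (((⊤ : ℕ∞) : WithTop ℕ∞) + 1) M :=
      inferInstanceAs (IsManifold (𝓡 6) ∞ M)
    exact ContDiff.mlieBracket_vectorField (n := (⊤ : ℕ∞)) U.contMDiff V.contMDiff (by simp)⟩

theorem lie_apply (U V : VF M) (x : M) : lie U V x = VectorField.mlieBracket (𝓡 6) U V x := rfl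

theorem lie_add_right (U V W : VF M) : lie U (V + W) = lie U V + lie U W := by
  have := isManifold_minSmoothness (M := M)
  ext x
  exact VectorField.mlieBracket_add_right (V.mdiffAt x) (W.mdiffAt x)

theorem lie_neg_swap (U V : VF M) : lie U V = - lie V U := by
  ext x
  exact VectorField.mlieBracket_swap_apply

theorem lie_fmul_right (U V : VF M) (f : SF M) :
    lie U (VF.fmul f V) = VF.fmul (dir U f) V + VF.fmul f (lie U V) := by
  have := isManifold_minSmoothness (M := M)
  ext x
  exact VectorField.mlieBracket_smul_right (f.mdiffAt x) (V.mdiffAt x)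

theorem lie_jacobi (U V W : VF M) :
    lie U (lie V W) = lie (lie U V) W + lie V (lie U W) := by
  have := isManifold_minSmoothness (M := M)
  ext x
  have h : minSmoothness ℝ 2 ≤ (∞ : WithTop ℕ∞) := by
    rw [minSmoothness_of_isRCLikeNormedField]; norm_cast
  exact VectorField.leibniz_identity_mlieBracket_apply ((U.contMDiff x).of_le h)
    ((V.contMDiff x).of_le h) ((W.contMDiff x).of_le h)

/-- The commutator of two vector fields, as derivations, is their Lie bracket; it follows from the
Jacobi identity for `U`, `V`, `fW` with `W` nonzero at a given point. -/
theorem dir_lie [T2Space M] (U V : VF M) (f : SF M) :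
    dir (lie U V) f = dir U (dir V f) - dir V (dir U f) := by
  ext x
  have h1 : ∃ v : TangentSpace (𝓡 6) x, v ≠ 0 := exists_ne (0 : E6)
  obtain ⟨v, hv⟩ := h1
  have h := congrArg (fun X : VF M => X x) (lie_jacobi U V (VF.fmul f (VF.ext v)))
  rw [lie_fmul_right, lie_add_right, lie_fmul_right, lie_fmul_right, lie_fmul_right,
    lie_fmul_right, lie_add_right, lie_fmul_right, lie_fmul_right, lie_jacobi] at h
  simp only [ContMDiffSection.coe_add, Pi.add_apply, VF.fmul_apply, VF.ext_self, smul_add] at h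
  have h2 : (dir (lie U V) f x - (dir U (dir V f) x - dir V (dir U f) x)) • v = 0 := by
    rw [sub_smul, sub_smul, ← neg_eq_zero]
    have := sub_eq_zero.2 h
    rw [← this]
    abel
  rcases smul_eq_zero.1 h2 with h3 | h3
  · have := sub_eq_zero.1 h3
    simpa using this
  · exact absurd h3 hv

theorem nabla_congr (nabla : Connection M) [T2Space M] {x : M} {V W : ∀ y : M, TangentSpace (𝓡 6) y}
    (hV : MDifferentiableAt (𝓡 6) ((𝓡 6).prod 𝓘(ℝ, E6)) (sec V) x)
    (hW : MDifferentiableAt (𝓡 6) ((𝓡 6).prod 𝓘(ℝ, E6)) (sec W) x)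
    (h : ∀ᶠ y in 𝓝 x, V y = W y) : nabla V x = nabla W x :=
  nabla.isCovariantDerivativeOn.congr_of_eventuallyEq (s := Set.univ) hV hW univ_mem h

section connection

variable (nabla : Connection M) [hsm : CovariantDerivative.ContMDiffCovariantDerivative nabla ∞]

/-- The covariant derivative `∇_U V` of smooth vector fields. -/
def nab (U V : VF M) : VF M :=
  ⟨fun x => nabla V x (U x), by
    have := hsm.contMDiff.contMDiff (σ := V) V.contMDiff.contMDiffOn
    rw [contMDiffOn_univ] at this
    exact fun x => (this x).clm_bundle_apply (U.contMDiff x)⟩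

theorem nab_apply (U V : VF M) (x : M) : nab nabla U V x = nabla V x (U x) := rfl

theorem nab_add_right (U V W : VF M) : nab nabla U (V + W) = nab nabla U V + nab nabla U W := by
  ext x
  exact congrArg (fun L => L (U x))
    (nabla.isCovariantDerivativeOn.add (s := Set.univ) (V.mdiffAt x) (W.mdiffAt x))

theorem nab_fmul_right (U V : VF M) (f : SF M) :
    nab nabla U (VF.fmul f V) = VF.fmul f (nab nabla U V) + VF.fmul (dir U f) V := by
  ext x
  exact congrArg (fun L => L (U x))
    (nabla.isCovariantDerivativeOn.leibniz (s := Set.univ) (V.mdiffAt x) (f.mdiffAt x))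

theorem nab_add_left (U V W : VF M) : nab nabla (U + V) W = nab nabla U W + nab nabla V W := by
  ext x; simp [nab_apply]

theorem nab_fmul_left (U V : VF M) (f : SF M) :
    nab nabla (VF.fmul f U) V = VF.fmul f (nab nabla U V) := by
  ext x; simp [nab_apply]

theorem nab_neg_left (U V : VF M) : nab nabla (-U) V = -nab nabla U V := by
  ext x; simp [nab_apply]

/-- The torsion of two smooth vector fields. -/
def tor (U V : VF M) : VF M := nab nabla U V - nab nabla V U - lie U V

theorem tor_apply (U V : VF M) (x : M) : tor nabla U V x = nabla.torsion x (U x) (V x) :=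
  (nabla.torsion_apply (U.mdiffAt x) (V.mdiffAt x)).symm

variable {nabla} in
theorem tor_swap (X Y : VF M) : tor nabla X Y = -tor nabla Y X := by
  unfold tor; rw [lie_neg_swap X Y]; abel

variable {nabla} in
theorem lie_eq (X Y : VF M) : lie X Y = nab nabla X Y - nab nabla Y X - tor nabla X Y := by
  unfold tor; abel

/-- The curvature of three smooth vector fields. -/
def curv (U V W : VF M) : VF M :=
  nab nabla U (nab nabla V W) - nab nabla V (nab nabla U W) - nab nabla (lie U V) W

end connection

section metric

variable [Bundle.RiemannianBundle (fun x : M => TangentSpace (𝓡 6) x)]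
  [IsContMDiffRiemannianBundle (𝓡 6) ∞ E6 (fun x : M => TangentSpace (𝓡 6) x)]

/-- The inner product of smooth vector fields. -/
def ip (U V : VF M) : SF M :=
  ⟨fun x => inner ℝ (U x) (V x), fun x => (U.contMDiff x).inner_bundle (V.contMDiff x)⟩

theorem ip_apply (U V : VF M) (x : M) : ip U V x = inner ℝ (U x) (V x) := rfl

theorem ip_add_left (U V W : VF M) : ip (U + V) W = ip U W + ip V W := by
  ext x; exact inner_add_left (U x) (V x) (W x)

theorem ip_sub_left (U V W : VF M) : ip (U - V) W = ip U W - ip V W := by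
  ext x; exact inner_sub_left (U x) (V x) (W x)

theorem ip_add_right (U V W : VF M) : ip U (V + W) = ip U V + ip U W := by
  ext x; exact inner_add_right (U x) (V x) (W x)

theorem ip_sub_right (U V W : VF M) : ip U (V - W) = ip U V - ip U W := by
  ext x; exact inner_sub_right (U x) (V x) (W x)

theorem dir_ip {nabla : Connection M}
    [hsm : CovariantDerivative.ContMDiffCovariantDerivative nabla ∞] (hm : nabla.IsMetricCompatible)
    (U V W : VF M) :
    dir U (ip V W) = ip (nab nabla U V) W + ip V (nab nabla U W) := by
  ext x
  exact hm.mvfderiv_inner_eq U (V.mdiffAt x) (W.mdiffAt x)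

end metric

section endomorphism

/-- A smooth field of endomorphisms of the tangent bundle. -/
def IsSmoothEnd (K : ∀ x : M, TangentSpace (𝓡 6) x →L[ℝ] TangentSpace (𝓡 6) x) : Prop :=
  ContMDiff (𝓡 6) ((𝓡 6).prod 𝓘(ℝ, E6 →L[ℝ] E6)) ∞
    (fun x => Bundle.TotalSpace.mk' (E6 →L[ℝ] E6)
      (E := fun x : M => TangentSpace (𝓡 6) x →L[ℝ] TangentSpace (𝓡 6) x) x (K x))

variable {K : ∀ x : M, TangentSpace (𝓡 6) x →L[ℝ] TangentSpace (𝓡 6) x} (hK : IsSmoothEnd K)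

include hK in
/-- The image of a smooth vector field under a smooth field of endomorphisms. -/
def app (V : VF M) : VF M :=
  ⟨fun x => K x (V x), fun x => (hK x).clm_bundle_apply (V.contMDiff x)⟩

theorem app_apply (V : VF M) (x : M) : app hK V x = K x (V x) := rfl

theorem app_add (U V : VF M) : app hK (U + V) = app hK U + app hK V := by
  ext x; exact map_add (K x) (U x) (V x)

theorem app_fmul (f : SF M) (V : VF M) : app hK (VF.fmul f V) = VF.fmul f (app hK V) := by
  ext x; exact map_smul (K x) (f x) (V x)

end endomorphism

end

/-! ### Smooth tensor fields and their covariant derivatives -/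

section

variable {M : Type*} [TopologicalSpace M] [ChartedSpace E6 M] [IsManifold (𝓡 6) ∞ M]

/-- A tensor field is smooth if it is multilinear at each point and takes smooth vector fields to
smooth functions. -/
structure IsSmoothTensor {k : ℕ} (A : Tensor M k) : Prop where
  multilinear : ∀ x, ∃ m : MultilinearMap ℝ (fun _ : Fin k => TangentSpace (𝓡 6) x) ℝ,
    ∀ v, A x v = m v
  smooth : ∀ V : Fin k → VF M, ContMDiff (𝓡 6) 𝓘(ℝ, ℝ) ∞ (fun x => A x (fun i => V i x))

variable {k : ℕ} {A : Tensor M k}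

/-- The smooth function `A(V₁, …, V_k)`. -/
def ev (hA : IsSmoothTensor A) (V : Fin k → VF M) : SF M := ⟨_, hA.smooth V⟩

theorem ev_apply (hA : IsSmoothTensor A) (V : Fin k → VF M) (x : M) :
    ev hA V x = A x (fun i => V i x) := rfl

theorem IsSmoothTensor.map_update_add (hA : IsSmoothTensor A) {x : M}
    (v : Fin k → TangentSpace (𝓡 6) x) (i : Fin k) (a b : TangentSpace (𝓡 6) x) :
    A x (Function.update v i (a + b)) = A x (Function.update v i a) +
      A x (Function.update v i b) := by
  obtain ⟨m, hm⟩ := hA.multilinear x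
  simp only [hm, MultilinearMap.map_update_add]

theorem IsSmoothTensor.map_update_smul (hA : IsSmoothTensor A) {x : M}
    (v : Fin k → TangentSpace (𝓡 6) x) (i : Fin k) (c : ℝ) (a : TangentSpace (𝓡 6) x) :
    A x (Function.update v i (c • a)) = c * A x (Function.update v i a) := by
  obtain ⟨m, hm⟩ := hA.multilinear x
  simp only [hm, MultilinearMap.map_update_smul, smul_eq_mul]

theorem update_VF_apply (V : Fin k → VF M) (i : Fin k) (W : VF M) (y : M) :
    (fun j => Function.update V i W j y) = Function.update (fun j => V j y) i (W y) := by
  ext1 j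
  by_cases h : j = i
  · subst h; simp
  · simp [h]

/-- The covariant derivative of `A` in the direction `u`, computed with given vector fields. -/
def covDerivField (nabla : Connection M) (A : Tensor M k) (x : M) (u : TangentSpace (𝓡 6) x)
    (V : Fin k → VF M) : ℝ :=
  mvfderiv (𝓡 6) (fun y => A y (fun i => V i y)) x u
    - ∑ i, A x (Function.update (fun j => V j x) i (nabla (V i) x u))

theorem covDerivField_update_add (nabla : Connection M) (hA : IsSmoothTensor A) (x : M)
    (u : TangentSpace (𝓡 6) x) (V : Fin k → VF M) (j : Fin k) (X Y : VF M) :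
    covDerivField nabla A x u (Function.update V j (X + Y)) =
      covDerivField nabla A x u (Function.update V j X) +
        covDerivField nabla A x u (Function.update V j Y) := by
  have h1 : ev hA (Function.update V j (X + Y)) =
      ev hA (Function.update V j X) + ev hA (Function.update V j Y) := by
    ext y
    simp only [ContMDiffMap.coe_add, Pi.add_apply, ev_apply, update_VF_apply,
      ContMDiffSection.coe_add, hA.map_update_add]
  have h2 := congrArg (fun L => L u) (mvfderiv_add ((ev hA (Function.update V j X)).mdiffAt x)
    ((ev hA (Function.update V j Y)).mdiffAt x))
  have h3 : mvfderiv (𝓡 6) (ev hA (Function.update V j (X + Y))) x u =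
      mvfderiv (𝓡 6) (ev hA (Function.update V j X)) x u +
        mvfderiv (𝓡 6) (ev hA (Function.update V j Y)) x u := by
    rw [h1]; exact h2
  change mvfderiv (𝓡 6) (ev hA (Function.update V j (X + Y))) x u - _ =
    (mvfderiv (𝓡 6) (ev hA (Function.update V j X)) x u - _) +
        (mvfderiv (𝓡 6) (ev hA (Function.update V j Y)) x u - _)
  rw [h3]
  have h4 : ∀ i, A x (Function.update (fun l => Function.update V j (X + Y) l x) i
        (nabla (Function.update V j (X + Y) i) x u)) =
      A x (Function.update (fun l => Function.update V j X l x) i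
        (nabla (Function.update V j X i) x u)) +
      A x (Function.update (fun l => Function.update V j Y l x) i
        (nabla (Function.update V j Y i) x u)) := by
    intro i
    simp only [update_VF_apply]
    by_cases hi : i = j
    · subst hi
      simp only [Function.update_self, Function.update_idem, ContMDiffSection.coe_add]
      rw [nabla.isCovariantDerivativeOn.add (s := Set.univ) (X.mdiffAt x) (Y.mdiffAt x)]
      exact hA.map_update_add _ _ _ _
    · rw [Function.update_of_ne hi, Function.update_of_ne hi, Function.update_of_ne hi]
      have comm : ∀ a b, Function.update (Function.update (fun l => V l x) j a) i b =
          Function.update (Function.update (fun l => V l x) i b) j a := fun a b =>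
        Function.update_comm (β := fun _ => TangentSpace (𝓡 6) x) (Ne.symm hi) a b _
      rw [comm, comm, comm, ContMDiffSection.coe_add]
      exact hA.map_update_add _ _ _ _
  rw [Finset.sum_congr rfl fun i _ => h4 i, Finset.sum_add_distrib]
  ring

theorem covDerivField_update_fmul (nabla : Connection M) (hA : IsSmoothTensor A) (x : M)
    (u : TangentSpace (𝓡 6) x) (V : Fin k → VF M) (j : Fin k) (f : SF M) (X : VF M) :
    covDerivField nabla A x u (Function.update V j (VF.fmul f X)) =
      f x * covDerivField nabla A x u (Function.update V j X) := by
  have h1 : ev hA (Function.update V j (VF.fmul f X)) = f * ev hA (Function.update V j X) := by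
    ext y
    simp only [ContMDiffMap.coe_mul, Pi.mul_apply, ev_apply, update_VF_apply,
      VF.fmul_apply, hA.map_update_smul]
  have h2 := congrArg (fun L => L u) (mvfderiv_mul (f.mdiffAt x)
    ((ev hA (Function.update V j X)).mdiffAt x))
  have h3 : mvfderiv (𝓡 6) (ev hA (Function.update V j (VF.fmul f X))) x u =
      f x * mvfderiv (𝓡 6) (ev hA (Function.update V j X)) x u +
        mvfderiv (𝓡 6) f x u * ev hA (Function.update V j X) x := by
    rw [h1]; refine h2.trans ?_
    simp
    ring
  change mvfderiv (𝓡 6) (ev hA (Function.update V j (VF.fmul f X))) x u - _ =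
    f x * (mvfderiv (𝓡 6) (ev hA (Function.update V j X)) x u - _)
  rw [h3, ev_apply, update_VF_apply]
  have h4 : ∀ i, A x (Function.update (fun l => Function.update V j (VF.fmul f X) l x) i
        (nabla (Function.update V j (VF.fmul f X) i) x u)) =
      f x * A x (Function.update (fun l => Function.update V j X l x) i
        (nabla (Function.update V j X i) x u)) +
      if i = j then mvfderiv (𝓡 6) f x u *
        A x (Function.update (fun l => V l x) j (X x)) else 0 := by
    intro i
    simp only [update_VF_apply]
    by_cases hi : i = j
    · subst hi
      simp only [Function.update_self, Function.update_idem, if_true]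
      have h5 := congrArg (fun L => L u)
        (nabla.isCovariantDerivativeOn.leibniz (s := Set.univ) (X.mdiffAt x) (f.mdiffAt x))
      have h6 : nabla (VF.fmul f X) x u = f x • nabla X x u + mvfderiv (𝓡 6) f x u • X x := h5
      rw [h6, hA.map_update_add, hA.map_update_smul, hA.map_update_smul]
    · rw [Function.update_of_ne hi, Function.update_of_ne hi, if_neg hi]
      have comm : ∀ a b, Function.update (Function.update (fun l => V l x) j a) i b =
          Function.update (Function.update (fun l => V l x) i b) j a := fun a b =>
        Function.update_comm (β := fun _ => TangentSpace (𝓡 6) x) (Ne.symm hi) a b _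
      rw [comm, comm, VF.fmul_apply, add_zero, hA.map_update_smul]
  rw [Finset.sum_congr rfl fun i _ => h4 i, Finset.sum_add_distrib, Finset.sum_ite_eq',
    if_pos (Finset.mem_univ _), ← Finset.mul_sum]
  simp only [update_VF_apply]
  ring

theorem covDerivField_congr [T2Space M] (nabla : Connection M) (hA : IsSmoothTensor A) (x : M)
    (u : TangentSpace (𝓡 6) x) (V W : Fin k → VF M) (h : ∀ i, V i x = W i x) :
    covDerivField nabla A x u V = covDerivField nabla A x u W := by
  have key : ∀ s : Finset (Fin k),
      covDerivField nabla A x u (s.piecewise V W) = covDerivField nabla A x u W := by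
    intro s
    induction s using Finset.induction_on with
    | empty => simp
    | insert j s hj ih =>
      rw [← ih, Finset.piecewise_insert]
      conv_rhs => rw [← Function.update_eq_self j (s.piecewise V W)]
      refine VF.tensorial x
        (fun X => covDerivField nabla A x u (Function.update (s.piecewise V W) j X))
        (fun X Y => covDerivField_update_add nabla hA x u _ j X Y)
        (fun f X => covDerivField_update_fmul nabla hA x u _ j f X) ?_
      rw [Finset.piecewise_eq_of_notMem _ _ _ hj, h j]
  simpa using key Finset.univ

theorem covDeriv_eq_covDerivField [T2Space M] (nabla : Connection M) (hA : IsSmoothTensor A)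
    {x : M} (w : Fin (k + 1) → TangentSpace (𝓡 6) x) (V : Fin k → VF M)
    (h : ∀ i, V i x = w i.succ) :
    covDeriv nabla A x w = covDerivField nabla A x (w 0) V := by
  rw [covDerivField_congr nabla hA x (w 0) V (fun i => VF.ext (w i.succ)) (by simpa using h)]
  have h1 : (fun y => A y (fun i => field (w i.succ) y)) =ᶠ[𝓝 x]
      fun y => A y (fun i => VF.ext (w i.succ) y) := by
    filter_upwards [eventually_all.2 fun i : Fin k => VF.ext_eventuallyEq (w i.succ)] with y hy
    simp only [hy]
  have h2 : ∀ i : Fin k, nabla (field (w i.succ)) x = nabla (VF.ext (w i.succ)) x := fun i =>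
    nabla_congr nabla (field_mdiffAt _) (VF.mdiffAt _ _)
      ((VF.ext_eventuallyEq (w i.succ)).mono fun y hy => hy.symm)
  unfold covDeriv covDerivField
  simp only [h2, VF.ext_self]
  congr 1
  unfold mvfderiv
  have h3 := h1.mfderiv_eq (I := 𝓡 6) (I' := 𝓘(ℝ, ℝ))
  simp only [ContinuousLinearMap.comp_apply]
  rw [h3]
  rfl

/-- The derivative of `A(V₁, …, V_k)` by the Leibniz rule. -/
theorem dir_ev [T2Space M] (nabla : Connection M) (hA : IsSmoothTensor A) (U : VF M)
    (V : Fin k → VF M) (x : M) :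
    dir U (ev hA V) x = covDeriv nabla A x (Matrix.vecCons (U x) fun i => V i x) +
      ∑ i, A x (Function.update (fun j => V j x) i (nabla (V i) x (U x))) := by
  rw [covDeriv_eq_covDerivField nabla hA _ V (by simp)]
  unfold covDerivField
  simp only [Matrix.cons_val_zero, sub_add_cancel]
  rfl

end

/-! ### Curvature -/

section

variable {M : Type*} [TopologicalSpace M] [ChartedSpace E6 M] [IsManifold (𝓡 6) ∞ M] [T2Space M]

theorem VF.ext' {V W : VF M} (h : ∀ x, V x = W x) : V = W := ContMDiffSection.ext h

@[simp] theorem VF.add_apply (V W : VF M) (x : M) : (V + W) x = V x + W x := rfl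
@[simp] theorem VF.sub_apply (V W : VF M) (x : M) : (V - W) x = V x - W x := rfl
@[simp] theorem VF.neg_apply (V : VF M) (x : M) : (-V) x = -V x := rfl

theorem nabla_eq_of_eventuallyEq (nabla : Connection M) {x : M}
    {V : ∀ y : M, TangentSpace (𝓡 6) y} {W : VF M} (h : ∀ᶠ y in 𝓝 x, W y = V y) :
    nabla V x = nabla W x := by
  have h2 : sec W =ᶠ[𝓝 x] sec V := by
    filter_upwards [h] with y hy
    exact congrArg (TotalSpace.mk y) hy
  exact nabla_congr nabla ((W.mdiffAt x).congr_of_eventuallyEq h2.symm) (W.mdiffAt x)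
    (h.mono fun y hy => hy.symm)

section curvature

variable {nabla : Connection M} [hsm : CovariantDerivative.ContMDiffCovariantDerivative nabla ∞]

theorem nab_congr_eventually {x : M} {V W : ∀ y : M, TangentSpace (𝓡 6) y} {V' W' : VF M}
    (hV : ∀ᶠ y in 𝓝 x, V' y = V y) (hW : ∀ᶠ y in 𝓝 x, W' y = W y) :
    ∀ᶠ y in 𝓝 x, nab nabla V' W' y = nabla W y (V y) := by
  filter_upwards [hV, hW.eventually_nhds] with y h1 h2
  rw [nabla_eq_of_eventuallyEq nabla h2, ← h1]
  rfl

theorem curvature_eq_curv_ext {x : M} (u v w : TangentSpace (𝓡 6) x) :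
    curvature nabla x u v w = curv nabla (VF.ext u) (VF.ext v) (VF.ext w) x := by
  unfold curvature
  rw [nabla_eq_of_eventuallyEq nabla
      (nab_congr_eventually (VF.ext_eventuallyEq v) (VF.ext_eventuallyEq w)),
    nabla_eq_of_eventuallyEq nabla
      (nab_congr_eventually (VF.ext_eventuallyEq u) (VF.ext_eventuallyEq w)),
    nabla_eq_of_eventuallyEq nabla (VF.ext_eventuallyEq w),
    ← Filter.EventuallyEq.mlieBracket_vectorField_eq (VF.ext_eventuallyEq u)
      (VF.ext_eventuallyEq v)]
  simp [curv, nab_apply, lie_apply]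

theorem nab_sub_right (U V W : VF M) : nab nabla U (V - W) = nab nabla U V - nab nabla U W := by
  rw [eq_sub_iff_add_eq, ← nab_add_right, sub_add_cancel]

theorem nab_neg_right (U V : VF M) : nab nabla U (-V) = -nab nabla U V := by
  rw [eq_neg_iff_add_eq_zero, ← nab_add_right, neg_add_cancel]
  simpa using nab_add_right nabla U 0 0

theorem lie_add_left (U V W : VF M) : lie (U + V) W = lie U W + lie V W := by
  rw [lie_neg_swap, lie_add_right, lie_neg_swap U, lie_neg_swap V, neg_add]

theorem curv_swap (U V W : VF M) : curv nabla U V W = -curv nabla V U W := by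
  unfold curv
  rw [lie_neg_swap U V, nab_neg_left]
  abel

theorem curv_add_left (U U' V W : VF M) :
    curv nabla (U + U') V W = curv nabla U V W + curv nabla U' V W := by
  unfold curv
  rw [lie_add_left, nab_add_left, nab_add_left, nab_add_left, nab_add_right]
  abel

theorem curv_add_right (U V W W' : VF M) :
    curv nabla U V (W + W') = curv nabla U V W + curv nabla U V W' := by
  unfold curv
  simp only [nab_add_right]
  abel

theorem curv_fmul_left (f : SF M) (U V W : VF M) :
    curv nabla (VF.fmul f U) V W = VF.fmul f (curv nabla U V W) := by
  unfold curv
  rw [lie_neg_swap (VF.fmul f U), lie_fmul_right, nab_neg_left, nab_add_left, nab_fmul_left,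
    nab_fmul_left, nab_fmul_left, nab_fmul_left, nab_fmul_right, lie_neg_swap U V, nab_neg_left]
  apply VF.ext'; intro x
  simp only [VF.fmul_apply, VF.add_apply, VF.sub_apply, VF.neg_apply]
  module

theorem curv_fmul_right (f : SF M) (U V W : VF M) :
    curv nabla U V (VF.fmul f W) = VF.fmul f (curv nabla U V W) := by
  unfold curv
  simp only [nab_fmul_right, nab_add_right, dir_lie]
  apply VF.ext'; intro x
  simp only [VF.fmul_apply, VF.add_apply, VF.sub_apply, ContMDiffMap.coe_sub, Pi.sub_apply]
  module

/-- The curvature may be computed with any vector fields extending its arguments. -/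
theorem curvature_eq (U V W : VF M) (x : M) :
    curvature nabla x (U x) (V x) (W x) = curv nabla U V W x := by
  rw [curvature_eq_curv_ext]
  have h1 : ∀ {U U' : VF M} (V W : VF M), U x = U' x → curv nabla U V W x = curv nabla U' V W x :=
    fun V W h => VF.tensorial x (fun X => curv nabla X V W x)
      (fun X Y => by rw [curv_add_left]; rfl) (fun f X => by rw [curv_fmul_left]; rfl) h
  have h2 : ∀ {U U' : VF M} (V W : VF M), U x = U' x → curv nabla V U W x =
    curv nabla V U' W x := by
    intro U U' V W h
    rw [curv_swap, curv_swap V, VF.neg_apply, VF.neg_apply, h1 V W h]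
  have h3 : ∀ {U U' : VF M} (V W : VF M), U x = U' x → curv nabla V W U x = curv nabla V W U' x :=
    fun V W h => VF.tensorial x (fun X => curv nabla V W X x)
      (fun X Y => by rw [curv_add_right]; rfl) (fun f X => by rw [curv_fmul_right]; rfl) h
  rw [h1 (U' := U) _ _ (by simp), h2 (U' := V) _ _ (by simp), h3 (U' := W) _ _ (by simp)]

theorem curvature_swap {x : M} (u v w : TangentSpace (𝓡 6) x) :
    curvature nabla x u v w = -curvature nabla x v u w := by
  rw [curvature_eq_curv_ext, curvature_eq_curv_ext, curv_swap]; rfl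

theorem curvature_isLinear₁ {x : M} (v w : TangentSpace (𝓡 6) x) :
    IsLinearMap ℝ (fun u => curvature nabla x u v w) where
  map_add u u' := by
    have := curvature_eq (nabla := nabla) (VF.ext u + VF.ext u') (VF.ext v) (VF.ext w) x
    rw [curv_add_left] at this
    simpa [← curvature_eq_curv_ext] using this
  map_smul c u := by
    have := curvature_eq (nabla := nabla)
      (VF.fmul (ContMDiffMap.const c) (VF.ext u)) (VF.ext v) (VF.ext w) x
    rw [curv_fmul_left] at this
    simpa [← curvature_eq_curv_ext] using! this

theorem curvature_isLinear₂ {x : M} (u w : TangentSpace (𝓡 6) x) :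
    IsLinearMap ℝ (fun v => curvature nabla x u v w) := by
  have : (fun v => curvature nabla x u v w) = fun v => -curvature nabla x v u w := by
    ext1 v; exact curvature_swap u v w
  rw [this]
  refine ⟨fun a b => ?_, fun c a => ?_⟩
  · rw [(curvature_isLinear₁ u w).map_add, neg_add]
  · rw [(curvature_isLinear₁ u w).map_smul, smul_neg]

theorem curvature_isLinear₃ {x : M} (u v : TangentSpace (𝓡 6) x) :
    IsLinearMap ℝ (fun w => curvature nabla x u v w) where
  map_add w w' := by
    have := curvature_eq (nabla := nabla) (VF.ext u) (VF.ext v) (VF.ext w + VF.ext w') x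
    rw [curv_add_right] at this
    simpa [← curvature_eq_curv_ext] using this
  map_smul c w := by
    have := curvature_eq (nabla := nabla) (VF.ext u) (VF.ext v)
      (VF.fmul (ContMDiffMap.const c) (VF.ext w)) x
    rw [curv_fmul_right] at this
    simpa [← curvature_eq_curv_ext] using! this

end curvature

section metric

variable [Bundle.RiemannianBundle (fun x : M => TangentSpace (𝓡 6) x)]
  [IsContMDiffRiemannianBundle (𝓡 6) ∞ E6 (fun x : M => TangentSpace (𝓡 6) x)]
  {nabla : Connection M} [hsm : CovariantDerivative.ContMDiffCovariantDerivative nabla ∞]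

theorem ip_curv_self (hm : nabla.IsMetricCompatible) (U V W Z : VF M) :
    ip (curv nabla U V W) Z + ip W (curv nabla U V Z) = 0 := by
  have h := dir_lie U V (ip W Z)
  simp only [dir_ip hm, dir_add] at h
  simp only [curv, ip_sub_left, ip_sub_right]
  linear_combination -h

theorem R4_swap_right (hm : nabla.IsMetricCompatible) {x : M} (u v w z : TangentSpace (𝓡 6) x) :
    R4 nabla x u v w z = -R4 nabla x u v z w := by
  have h := congrArg (fun f : SF M => f x)
    (ip_curv_self hm (VF.ext u) (VF.ext v) (VF.ext w) (VF.ext z))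
  simp only [ContMDiffMap.coe_add, Pi.add_apply, ip_apply, ← curvature_eq, VF.ext_self] at h
  unfold R4
  rw [real_inner_comm] at h
  have h' : inner ℝ w (curvature nabla x u v z) = inner ℝ (curvature nabla x u v z) w :=
    real_inner_comm _ _
  have h'' : inner ℝ z (curvature nabla x u v w) = inner ℝ (curvature nabla x u v w) z :=
    real_inner_comm _ _
  rw [h', h''] at h
  exact eq_neg_of_add_eq_zero_left h

theorem R4_swap_left {x : M} (u v w z : TangentSpace (𝓡 6) x) :
    R4 nabla x u v w z = -R4 nabla x v u w z := by
  unfold R4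
  rw [curvature_swap, inner_neg_left]

theorem R4_isLinear₁ {x : M} (v w z : TangentSpace (𝓡 6) x) :
    IsLinearMap ℝ (fun u => R4 nabla x u v w z) where
  map_add a b := by simp only [R4, (curvature_isLinear₁ v w).map_add, inner_add_left]
  map_smul c a := by simp only [R4, (curvature_isLinear₁ v w).map_smul, inner_smul_left]; rfl

theorem R4_isLinear₂ {x : M} (u w z : TangentSpace (𝓡 6) x) :
    IsLinearMap ℝ (fun v => R4 nabla x u v w z) where
  map_add a b := by simp only [R4, (curvature_isLinear₂ u w).map_add, inner_add_left]
  map_smul c a := by simp only [R4, (curvature_isLinear₂ u w).map_smul, inner_smul_left]; rfl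

theorem R4_isLinear₃ {x : M} (u v z : TangentSpace (𝓡 6) x) :
    IsLinearMap ℝ (fun w => R4 nabla x u v w z) where
  map_add a b := by simp only [R4, (curvature_isLinear₃ u v).map_add, inner_add_left]
  map_smul c a := by simp only [R4, (curvature_isLinear₃ u v).map_smul, inner_smul_left]; rfl

theorem R4_isLinear₄ {x : M} (u v w : TangentSpace (𝓡 6) x) :
    IsLinearMap ℝ (fun z => R4 nabla x u v w z) where
  map_add a b := by simp only [R4, inner_add_right]
  map_smul c a := by simp only [R4, inner_smul_right]; rfl

end metric

section parallelEnd

variable {nabla : Connection M} [hsm : CovariantDerivative.ContMDiffCovariantDerivative nabla ∞]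
  {K : ∀ x : M, TangentSpace (𝓡 6) x →L[ℝ] TangentSpace (𝓡 6) x} (hK : IsSmoothEnd K)

theorem nab_app (hp : ∀ (x : M) (u v : TangentSpace (𝓡 6) x),
      nabla (fun y => K y (field v y)) x u = K x (nabla (field v) x u)) (U V : VF M) :
    nab nabla U (app hK V) = app hK (nab nabla U V) := by
  apply VF.ext'; intro x
  rw [← sub_eq_zero]
  have h1 : (nab nabla U (app hK V) - app hK (nab nabla U V)) x =
      (nab nabla U (app hK (VF.ext (V x))) - app hK (nab nabla U (VF.ext (V x)))) x := by
    refine VF.tensorial x (fun X => (nab nabla U (app hK X) - app hK (nab nabla U X)) x)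
      (fun X Y => ?_) (fun f X => ?_) (by simp)
    · simp only [nab_add_right, app_add, VF.add_apply, VF.sub_apply]; abel
    · simp only [nab_fmul_right, app_fmul, app_add, VF.add_apply, VF.sub_apply, VF.fmul_apply]
      module
  rw [VF.sub_apply] at h1
  rw [h1, VF.sub_apply, sub_eq_zero, nab_apply, app_apply, nab_apply,
    ← nabla_eq_of_eventuallyEq nabla (VF.ext_eventuallyEq (V x)), ← hp x (U x) (V x)]
  have h2 : ∀ᶠ y in 𝓝 x, app hK (VF.ext (V x)) y = K y (field (V x) y) := by
    filter_upwards [VF.ext_eventuallyEq (V x)] with y hy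
    rw [app_apply, hy]
  rw [nabla_eq_of_eventuallyEq nabla h2]

include hK in
theorem curvature_app (hp : ∀ (x : M) (u v : TangentSpace (𝓡 6) x),
      nabla (fun y => K y (field v y)) x u = K x (nabla (field v) x u)) {x : M}
    (u v w : TangentSpace (𝓡 6) x) :
    curvature nabla x u v (K x w) = K x (curvature nabla x u v w) := by
  have h1 := curvature_eq (nabla := nabla) (VF.ext u) (VF.ext v) (app hK (VF.ext w)) x
  have h2 : curv nabla (VF.ext u) (VF.ext v) (app hK (VF.ext w)) x =
      K x (curv nabla (VF.ext u) (VF.ext v) (VF.ext w) x) := by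
    unfold curv
    simp only [nab_app hK hp, VF.sub_apply, app_apply, map_sub]
  rw [h2, ← curvature_eq_curv_ext] at h1
  simpa [app_apply] using h1

end parallelEnd

end

/-! ### Torsion and the first Bianchi identity -/

section

variable {M : Type*} [TopologicalSpace M] [ChartedSpace E6 M] [IsManifold (𝓡 6) ∞ M] [T2Space M]
  [Bundle.RiemannianBundle (fun x : M => TangentSpace (𝓡 6) x)]

theorem exists_multilinear_three {E : Type*} [AddCommGroup E] [Module ℝ E] (f : E → E → E → ℝ)
    (h₁ : ∀ v w, IsLinearMap ℝ (fun u => f u v w)) (h₂ : ∀ u w, IsLinearMap ℝ (fun v => f u v w))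
    (h₃ : ∀ u v, IsLinearMap ℝ (fun w => f u v w)) :
    ∃ m : MultilinearMap ℝ (fun _ : Fin 3 => E) ℝ, ∀ v, f (v 0) (v 1) (v 2) = m v := by
  refine ⟨⟨fun v => f (v 0) (v 1) (v 2), ?_, ?_⟩, fun v => rfl⟩
  · intro inst v i a b
    obtain rfl : inst = fun a b => instDecidableEqFin 3 a b := Subsingleton.elim _ _
    fin_cases i
    · exact (h₁ _ _).map_add a b
    · exact (h₂ _ _).map_add a b
    · exact (h₃ _ _).map_add a b
  · intro inst v i c a
    obtain rfl : inst = fun a b => instDecidableEqFin 3 a b := Subsingleton.elim _ _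
    fin_cases i
    · exact (h₁ _ _).map_smul c a
    · exact (h₂ _ _).map_smul c a
    · exact (h₃ _ _).map_smul c a

variable [IsContMDiffRiemannianBundle (𝓡 6) ∞ E6 (fun x : M => TangentSpace (𝓡 6) x)]

section torsion

variable {nabla : Connection M}

theorem torsion_smul_left (x : M) (c : ℝ) (u v : TangentSpace (𝓡 6) x) :
    nabla.torsion x (c • u) v = c • nabla.torsion x u v := by
  rw [map_smul]; rfl

theorem torsion_add_left (x : M) (u u' v : TangentSpace (𝓡 6) x) :
    nabla.torsion x (u + u') v = nabla.torsion x u v + nabla.torsion x u' v := by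
  rw [map_add]; rfl

variable [hsm : CovariantDerivative.ContMDiffCovariantDerivative nabla ∞]

theorem isSmoothTensor_torsionForm : IsSmoothTensor (torsionForm nabla) where
  multilinear x := by
    refine exists_multilinear_three (fun u v w => inner ℝ (nabla.torsion x u v) w)
      (fun v w => ⟨fun a b => ?_, fun c a => ?_⟩) (fun u w => ⟨fun a b => ?_, fun c a => ?_⟩)
      (fun u v => ⟨fun a b => ?_, fun c a => ?_⟩)
    · rw [torsion_add_left, inner_add_left]
    · rw [torsion_smul_left, inner_smul_left]; rfl
    · rw [map_add, inner_add_left]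
    · rw [map_smul, inner_smul_left]; rfl
    · rw [inner_add_right]
    · rw [inner_smul_right]; rfl
  smooth V := by
    have : (fun x => torsionForm nabla x (fun i => V i x)) = ip (tor nabla (V 0) (V 1)) (V 2) := by
      ext1 x
      simp only [ip_apply, tor_apply, torsionForm]
    rw [this]
    exact (ip (tor nabla (V 0) (V 1)) (V 2)).contMDiff

/-- The covariant derivative `(∇_U T)(V, W)` of the torsion as a vector field. -/
def dtor (nabla : Connection M) [hsm : CovariantDerivative.ContMDiffCovariantDerivative nabla ∞]
    (U V W : VF M) : VF M :=
  nab nabla U (tor nabla V W) - tor nabla (nab nabla U V) W - tor nabla V (nab nabla U W)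

theorem covDeriv_torsionForm (hm : nabla.IsMetricCompatible) (U V W Z : VF M) (x : M) :
    covDeriv nabla (torsionForm nabla) x ![U x, V x, W x, Z x] =
      inner ℝ (dtor nabla U V W x) (Z x) := by
  rw [covDeriv_eq_covDerivField nabla isSmoothTensor_torsionForm _ ![V, W, Z]
    (by intro i; fin_cases i <;> rfl)]
  unfold covDerivField
  have h1 : (fun y => torsionForm nabla y (fun i => ![V, W, Z] i y)) = ip (tor nabla V W) Z := by
    ext1 y
    simp [ip_apply, tor_apply, torsionForm]
  rw [h1, Fin.sum_univ_three]
  have h2 := congrArg (fun f : SF M => f x) (dir_ip hm U (tor nabla V W) Z)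
  simp only [dir_apply, ContMDiffMap.coe_add, Pi.add_apply, ip_apply] at h2
  simp only [Matrix.cons_val_zero, h2]
  simp only [torsionForm, Function.update_apply, dtor, VF.sub_apply, inner_sub_left, tor_apply]
  simp [nab_apply]
  ring

theorem dtor_swap (U V W : VF M) : dtor nabla U V W = -dtor nabla U W V := by
  unfold dtor
  rw [tor_swap V W, tor_swap _ W, tor_swap V, nab_neg_right]
  abel

end torsion

/-- The `4`-form `σ(u, v, w, z) = g(T(u, v), T(w, z)) + g(T(v, w), T(u, z)) + g(T(w, u), T(v, z))`
quadratic in the torsion. -/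
def sigma (nabla : Connection M) (x : M) (u v w z : TangentSpace (𝓡 6) x) : ℝ :=
  inner ℝ (nabla.torsion x u v) (nabla.torsion x w z) +
    inner ℝ (nabla.torsion x v w) (nabla.torsion x u z) +
    inner ℝ (nabla.torsion x w u) (nabla.torsion x v z)

section skew

variable {nabla : Connection M}
  (hs : ∀ (x : M) (u v w : TangentSpace (𝓡 6) x),
    torsionForm nabla x ![u, v, w] = -torsionForm nabla x ![u, w, v])

include hs

theorem inner_torsion_swap {x : M} (u v w : TangentSpace (𝓡 6) x) :
    inner ℝ (nabla.torsion x u v) w = -inner ℝ (nabla.torsion x u w) v := hs x u v w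

theorem inner_torsion_rotate {x : M} (u v w : TangentSpace (𝓡 6) x) :
    inner ℝ (nabla.torsion x u v) w = inner ℝ (nabla.torsion x v w) u := by
  rw [nabla.torsion_antisymm u v, inner_neg_left, inner_torsion_swap hs v u w, neg_neg]

omit hs in
theorem sigma_swap₁₂ {x : M} (u v w z : TangentSpace (𝓡 6) x) :
    sigma nabla x u v w z = -sigma nabla x v u w z := by
  unfold sigma
  rw [nabla.torsion_antisymm u v, nabla.torsion_antisymm v w, nabla.torsion_antisymm w u]
  simp only [inner_neg_left]
  ring

omit hs in
theorem sigma_swap₂₃ {x : M} (u v w z : TangentSpace (𝓡 6) x) :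
    sigma nabla x u v w z = -sigma nabla x u w v z := by
  unfold sigma
  rw [nabla.torsion_antisymm u v, nabla.torsion_antisymm v w, nabla.torsion_antisymm w u]
  simp only [inner_neg_left]
  ring

omit hs in
theorem sigma_swap₃₄ {x : M} (u v w z : TangentSpace (𝓡 6) x) :
    sigma nabla x u v w z = -sigma nabla x u v z w := by
  unfold sigma
  rw [nabla.torsion_antisymm w z, nabla.torsion_antisymm w u, nabla.torsion_antisymm v z,
    nabla.torsion_antisymm z u]
  simp only [inner_neg_left, inner_neg_right]
  rw [real_inner_comm (nabla.torsion x v w), real_inner_comm (nabla.torsion x u w)]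
  ring

end skew

section bianchi

variable {nabla : Connection M} [hsm : CovariantDerivative.ContMDiffCovariantDerivative nabla ∞]

theorem tor_sub_right (X Y Z : VF M) : tor nabla X (Y - Z) = tor nabla X Y - tor nabla X Z := by
  apply VF.ext'; intro x
  simp only [tor_apply, VF.sub_apply, map_sub]

/-- The first Bianchi identity of a connection with torsion. -/
theorem curv_cyclic (X Y Z : VF M) :
    curv nabla X Y Z + curv nabla Y Z X + curv nabla Z X Y =
      dtor nabla X Y Z + dtor nabla Y Z X + dtor nabla Z X Y +
        (tor nabla (tor nabla X Y) Z + tor nabla (tor nabla Y Z) X +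
          tor nabla (tor nabla Z X) Y) := by
  have key : ∀ X Y Z : VF M, nab nabla X (nab nabla Y Z) - nab nabla X (nab nabla Z Y)
      - nab nabla (lie Y Z) X = nab nabla X (tor nabla Y Z) + tor nabla X (nab nabla Y Z)
        - tor nabla X (nab nabla Z Y) - tor nabla X (tor nabla Y Z) + lie X (lie Y Z) := by
    intro X Y Z
    have h1 := lie_eq (nabla := nabla) X (lie Y Z)
    have h2 := congrArg (tor nabla X) (lie_eq (nabla := nabla) Y Z)
    have h3 := congrArg (nab nabla X) (lie_eq (nabla := nabla) Y Z)
    simp only [tor_sub_right] at h2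
    simp only [nab_sub_right] at h3
    rw [h1, h2, h3]
    abel
  have hj : lie X (lie Y Z) + lie Y (lie Z X) + lie Z (lie X Y) = 0 := by
    rw [lie_jacobi X Y Z, lie_neg_swap Z (lie X Y), lie_neg_swap Z X]
    have : lie Y (-lie X Z) = -lie Y (lie X Z) := by
      have := lie_add_right Y (lie X Z) (-lie X Z)
      rw [add_neg_cancel] at this
      have h0 : lie Y (0 : VF M) = 0 := by simpa using lie_add_right Y 0 0
      rw [h0] at this
      exact (neg_eq_of_add_eq_zero_right this.symm).symm
    rw [this]
    abel
  have e : curv nabla X Y Z + curv nabla Y Z X + curv nabla Z X Y =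
      (nab nabla X (nab nabla Y Z) - nab nabla X (nab nabla Z Y) - nab nabla (lie Y Z) X)
      + (nab nabla Y (nab nabla Z X) - nab nabla Y (nab nabla X Z) - nab nabla (lie Z X) Y)
      + (nab nabla Z (nab nabla X Y) - nab nabla Z (nab nabla Y X) - nab nabla (lie X Y) Z) := by
    unfold curv; abel
  rw [e, key, key, key]
  have e2 : lie X (lie Y Z) = - lie Y (lie Z X) - lie Z (lie X Y) := by
    rw [← sub_eq_zero, ← hj]; abel
  rw [e2]
  unfold dtor
  rw [tor_swap (nab nabla X Y) Z, tor_swap (nab nabla Y Z) X, tor_swap (nab nabla Z X) Y,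
    tor_swap (tor nabla X Y) Z, tor_swap (tor nabla Y Z) X, tor_swap (tor nabla Z X) Y]
  abel

/-- The first Bianchi identity of a metric connection with skew-symmetric torsion. -/
theorem R4_cyclic (hm : nabla.IsMetricCompatible)
    (hs : ∀ (x : M) (u v w : TangentSpace (𝓡 6) x),
      torsionForm nabla x ![u, v, w] = -torsionForm nabla x ![u, w, v])
    {x : M} (u v w z : TangentSpace (𝓡 6) x) :
    R4 nabla x u v w z + R4 nabla x v w u z + R4 nabla x w u v z =
      covDeriv nabla (torsionForm nabla) x ![u, v, w, z] +
      covDeriv nabla (torsionForm nabla) x ![v, w, u, z] +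
      covDeriv nabla (torsionForm nabla) x ![w, u, v, z] + sigma nabla x u v w z := by
  have hD : ∀ a b c d : TangentSpace (𝓡 6) x, covDeriv nabla (torsionForm nabla) x ![a, b, c, d] =
      inner ℝ (dtor nabla (VF.ext a) (VF.ext b) (VF.ext c) x) d := by
    intro a b c d
    simpa using covDeriv_torsionForm hm (VF.ext a) (VF.ext b) (VF.ext c) (VF.ext d) x
  have h := congrArg (fun V : VF M => (inner ℝ (V x) z : ℝ))
    (curv_cyclic (nabla := nabla) (VF.ext u) (VF.ext v) (VF.ext w))
  simp only [VF.add_apply, inner_add_left, ← curvature_eq_curv_ext, ← hD, tor_apply,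
    VF.ext_self] at h
  rw [inner_torsion_rotate hs _ w z, inner_torsion_rotate hs _ u z,
    inner_torsion_rotate hs _ v z] at h
  rw [real_inner_comm (nabla.torsion x u v), real_inner_comm (nabla.torsion x v w),
    real_inner_comm (nabla.torsion x w u)] at h
  unfold R4 sigma
  linarith

end bianchi

section derivSkew

variable {nabla : Connection M} [hsm : CovariantDerivative.ContMDiffCovariantDerivative nabla ∞]
  (hm : nabla.IsMetricCompatible)
  (hs : ∀ (x : M) (u v w : TangentSpace (𝓡 6) x),
      torsionForm nabla x ![u, v, w] = -torsionForm nabla x ![u, w, v])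
include hm

theorem covDeriv_torsionForm_swap₂₃ {x : M} (u v w z : TangentSpace (𝓡 6) x) :
    covDeriv nabla (torsionForm nabla) x ![u, v, w, z] =
      -covDeriv nabla (torsionForm nabla) x ![u, w, v, z] := by
  have h1 := covDeriv_torsionForm hm (VF.ext u) (VF.ext v) (VF.ext w) (VF.ext z) x
  have h2 := covDeriv_torsionForm hm (VF.ext u) (VF.ext w) (VF.ext v) (VF.ext z) x
  rw [dtor_swap] at h1
  simp only [VF.ext_self, VF.neg_apply, inner_neg_left] at h1 h2
  rw [h1, h2]

include hs

theorem covDeriv_torsionForm_swap₃₄ {x : M} (u v w z : TangentSpace (𝓡 6) x) :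
    covDeriv nabla (torsionForm nabla) x ![u, v, w, z] =
      -covDeriv nabla (torsionForm nabla) x ![u, v, z, w] := by
  have h1 := covDeriv_torsionForm hm (VF.ext u) (VF.ext v) (VF.ext w) (VF.ext z) x
  have h2 := covDeriv_torsionForm hm (VF.ext u) (VF.ext v) (VF.ext z) (VF.ext w) x
  have hs' : ∀ X Y Z : VF M, ip (tor nabla X Y) Z = -ip (tor nabla X Z) Y := by
    intro X Y Z; ext y
    simp only [ContMDiffMap.coe_neg, Pi.neg_apply, ip_apply, tor_apply]
    exact inner_torsion_swap hs _ _ _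
  have h3 : ip (dtor nabla (VF.ext u) (VF.ext v) (VF.ext w)) (VF.ext z) =
      -ip (dtor nabla (VF.ext u) (VF.ext v) (VF.ext z)) (VF.ext w) := by
    have hn : ∀ f : SF M, dir (VF.ext u) (-f) = - dir (VF.ext u) f := fun f => by
      rw [eq_neg_iff_add_eq_zero, ← dir_add, neg_add_cancel]; exact dir_const _ 0
    have a := dir_ip hm (VF.ext u) (tor nabla (VF.ext v) (VF.ext w)) (VF.ext z)
    have b := dir_ip hm (VF.ext u) (tor nabla (VF.ext v) (VF.ext z)) (VF.ext w)
    rw [hs' (VF.ext v) (VF.ext w) (VF.ext z), hn] at a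
    have c := hs' (nab nabla (VF.ext u) (VF.ext v)) (VF.ext w) (VF.ext z)
    have d := hs' (VF.ext v) (nab nabla (VF.ext u) (VF.ext w)) (VF.ext z)
    have e := hs' (VF.ext v) (VF.ext w) (nab nabla (VF.ext u) (VF.ext z))
    simp only [dtor, ip_sub_left]
    linear_combination -a - b - c - d - e
  have h4 := congrArg (fun f : SF M => f x) h3
  simp only [ContMDiffMap.coe_neg, Pi.neg_apply, ip_apply] at h4
  rw [← h1, ← h2] at h4
  simpa using h4

/-- Under the Riemannian first Bianchi identity the covariant derivative of the torsion is
totally skew-symmetric, equal to `-σ/3`. -/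
theorem covDeriv_torsionForm_eq (hB : RiemannianBianchi nabla) {x : M}
    (u v w z : TangentSpace (𝓡 6) x) :
    covDeriv nabla (torsionForm nabla) x ![u, v, w, z] = -(1 / 3) * sigma nabla x u v w z := by
  have h : ∀ a b c d : TangentSpace (𝓡 6) x,
      covDeriv nabla (torsionForm nabla) x ![a, b, c, d] +
      covDeriv nabla (torsionForm nabla) x ![b, c, a, d] +
      covDeriv nabla (torsionForm nabla) x ![c, a, b, d] = - sigma nabla x a b c d := by
    intro a b c d
    have := R4_cyclic hm hs a b c d
    rw [hB x a b c d] at this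
    linarith
  have s₂₃ := fun a b c d : TangentSpace (𝓡 6) x => covDeriv_torsionForm_swap₂₃ hm a b c d
  have s₃₄ := fun a b c d : TangentSpace (𝓡 6) x => covDeriv_torsionForm_swap₃₄ hm hs a b c d
  have rot : ∀ a b c d : TangentSpace (𝓡 6) x, covDeriv nabla (torsionForm nabla) x ![a, b, c, d] =
      covDeriv nabla (torsionForm nabla) x ![a, c, d, b] := fun a b c d => by
    rw [s₂₃, s₃₄, neg_neg]
  have t₁ : sigma nabla x v w z u = -sigma nabla x u v w z := by
    rw [sigma_swap₃₄ v w z u, sigma_swap₂₃ v w u z, sigma_swap₁₂ v u w z, neg_neg]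
  have t₂ : sigma nabla x w z u v = -sigma nabla x v w z u := by
    rw [sigma_swap₃₄ w z u v, sigma_swap₂₃ w z v u, sigma_swap₁₂ w v z u, neg_neg]
  have t₃ : sigma nabla x z u v w = -sigma nabla x w z u v := by
    rw [sigma_swap₃₄ z u v w, sigma_swap₂₃ z u w v, sigma_swap₁₂ z w u v, neg_neg]
  have e1 := h u v w z
  have e2 := h v w z u
  have e3 := h w z u v
  have e4 := h z u v w
  rw [s₂₃ v w u z] at e1
  rw [← rot v u w z, s₂₃ w z v u, rot w v z u, rot w z u v, rot z v w u, rot z w u v] at e2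
  rw [rot w z u v, s₂₃ z u w v, s₂₃ u w z v, rot u z w v] at e3
  rw [rot v z u w] at e4
  linarith [rot z w u v, s₃₄ u v z w, s₂₃ u w v z]

end derivSkew

end

/-! ### Sums, permutations and compositions of tensor fields; the Levi-Civita connection -/

section

variable {M : Type*} [TopologicalSpace M] [ChartedSpace E6 M] [IsManifold (𝓡 6) ∞ M] [T2Space M]

section closure

variable {k : ℕ} {A : Tensor M k} (nabla : Connection M)

theorem covDeriv_eq_ext (hA : IsSmoothTensor A) {x : M} (w : Fin (k + 1) → TangentSpace (𝓡 6) x) :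
    covDeriv nabla A x w = covDerivField nabla A x (w 0) (fun i => VF.ext (w i.succ)) :=
  covDeriv_eq_covDerivField nabla hA w _ (by simp)

variable {ι : Type*} (s : Finset ι) (c : ι → ℝ) {B : ι → Tensor M k}

theorem IsSmoothTensor.sum (hB : ∀ j, IsSmoothTensor (B j)) :
    IsSmoothTensor (fun x v => ∑ j ∈ s, c j * B j x v) where
  multilinear x := by
    choose m hm using fun j => (hB j).multilinear x
    refine ⟨∑ j ∈ s, c j • m j, fun v => ?_⟩
    simp only [hm, sum_apply, smul_apply, smul_eq_mul]
  smooth V := by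
    have : (fun x => ∑ j ∈ s, c j * B j x (fun i => V i x)) =
        ∑ j ∈ s, fun x => c j * B j x (fun i => V i x) := by
      ext x; simp
    rw [this]
    exact contMDiff_finsetSum' fun j _ => contMDiff_const.mul ((hB j).smooth V)

theorem covDeriv_sum (hB : ∀ j, IsSmoothTensor (B j)) {x : M}
    (w : Fin (k + 1) → TangentSpace (𝓡 6) x) :
    covDeriv nabla (fun x v => ∑ j ∈ s, c j * B j x v) x w =
      ∑ j ∈ s, c j * covDeriv nabla (B j) x w := by
  rw [covDeriv_eq_ext nabla (IsSmoothTensor.sum s c hB)]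
  simp only [covDeriv_eq_ext nabla (hB _)]
  unfold covDerivField
  have h1 : mvfderiv (𝓡 6) (fun y => ∑ j ∈ s, c j * B j y (fun i => VF.ext (w i.succ) y)) x (w 0) =
      ∑ j ∈ s, c j * mvfderiv (𝓡 6) (fun y => B j y (fun i => VF.ext (w i.succ) y)) x (w 0) := by
    classical
    induction s using Finset.induction_on with
    | empty =>
      simp only [Finset.sum_empty]
      exact congrArg (fun L => L (w 0)) (mvfderiv_const (I := 𝓡 6) (0 : ℝ) (x := x))
    | insert a s ha ih =>
      have e : (fun y => ∑ j ∈ insert a s, c j * B j y (fun i => VF.ext (w i.succ) y)) =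
          (ContMDiffMap.const (c a) * ev (hB a) (fun i => VF.ext (w i.succ)) : SF M) +
            ev (IsSmoothTensor.sum s c hB) (fun i => VF.ext (w i.succ)) := by
        ext y
        rw [Finset.sum_insert ha]; rfl
      rw [e, mvfderiv_add (SF.mdiffAt _ x) (SF.mdiffAt _ x), Finset.sum_insert ha, ← ih]
      have e2 := mvfderiv_mul (SF.mdiffAt (M := M) (ContMDiffMap.const (c a)) x)
        ((ev (hB a) (fun i => VF.ext (w i.succ))).mdiffAt x)
      have e3 : mvfderiv (𝓡 6) (ContMDiffMap.const (c a) * ev (hB a) (fun i => VF.ext (w i.succ)) :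
          SF M) x (w 0) = c a * mvfderiv (𝓡 6)
            (fun y => B a y (fun i => VF.ext (w i.succ) y)) x (w 0) := by
        refine (congrArg (fun L => L (w 0)) e2).trans ?_
        have e4 : mvfderiv (𝓡 6) (ContMDiffMap.const (c a) : SF M) x = 0 :=
          mvfderiv_const (I := 𝓡 6) (c a) (x := x)
        rw [e4]
        simp
        rfl
      rw [add_apply, e3]
      rfl
  rw [h1, Finset.sum_comm, ← Finset.sum_sub_distrib]
  refine Finset.sum_congr rfl fun j _ => ?_
  rw [mul_sub, Finset.mul_sum]

/-- The arguments of a smooth tensor field may be permuted. -/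
theorem IsSmoothTensor.perm (hA : IsSmoothTensor A) (e : Equiv.Perm (Fin k)) :
    IsSmoothTensor (fun x v => A x (fun i => v (e i)) : Tensor M k) where
  multilinear x := by
    obtain ⟨m, hm⟩ := hA.multilinear x
    exact ⟨m.domDomCongr e, fun v => by rw [hm]; rfl⟩
  smooth V := hA.smooth (fun i => V (e i))

theorem covDeriv_perm (hA : IsSmoothTensor A) (e : Equiv.Perm (Fin k)) {x : M}
    (w : Fin (k + 1) → TangentSpace (𝓡 6) x) :
    covDeriv nabla (fun x v => A x (fun i => v (e i)) : Tensor M k) x w =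
      covDeriv nabla A x (Fin.cons (w 0) (fun i => w (e i).succ)) := by
  rw [covDeriv_eq_ext nabla (hA.perm e), covDeriv_eq_covDerivField nabla hA _
    (fun i => VF.ext (w (e i).succ)) (by simp)]
  unfold covDerivField
  simp only [Fin.cons_zero]
  congr 1
  refine Fintype.sum_equiv e.symm _ _ fun i => ?_
  congr 1
  ext1 j
  simp only [Function.update_apply, Equiv.apply_symm_apply, Equiv.eq_symm_apply]

end closure

section parallelEnd

variable {nabla : Connection M} [hsm : CovariantDerivative.ContMDiffCovariantDerivative nabla ∞]

/-- A field of endomorphisms which acts on smooth vector fields and commutes with `∇`. -/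
def IsParallelEnd (nabla : Connection M)
    [hsm : CovariantDerivative.ContMDiffCovariantDerivative nabla ∞]
    (K : ∀ x : M, TangentSpace (𝓡 6) x →L[ℝ] TangentSpace (𝓡 6) x) : Prop :=
  ∃ L : VF M → VF M, (∀ V x, L V x = K x (V x)) ∧ ∀ U V, nab nabla U (L V) = L (nab nabla U V)

theorem isParallelEnd_id : IsParallelEnd nabla (fun _ => ContinuousLinearMap.id ℝ _) :=
  ⟨fun V => V, fun _ _ => rfl, fun _ _ => rfl⟩

variable {k : ℕ} {A : Tensor M k}
  {K : Fin k → ∀ x : M, TangentSpace (𝓡 6) x →L[ℝ] TangentSpace (𝓡 6) x}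

theorem IsSmoothTensor.comp_end (hA : IsSmoothTensor A) (hK : ∀ i, IsParallelEnd nabla (K i)) :
    IsSmoothTensor (fun x v => A x (fun i => K i x (v i)) : Tensor M k) where
  multilinear x := by
    obtain ⟨m, hm⟩ := hA.multilinear x
    exact ⟨m.compLinearMap (fun i => (K i x).toLinearMap), fun v => by rw [hm]; rfl⟩
  smooth V := by
    choose L hL _ using hK
    have := hA.smooth (fun i => L i (V i))
    simpa only [hL] using this

/-- Composition with parallel endomorphisms commutes with covariant differentiation. -/
theorem covDeriv_comp_end (hA : IsSmoothTensor A) (hK : ∀ i, IsParallelEnd nabla (K i)) {x : M}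
    (w : Fin (k + 1) → TangentSpace (𝓡 6) x) :
    covDeriv nabla (fun x v => A x (fun i => K i x (v i)) : Tensor M k) x w =
      covDeriv nabla A x (Fin.cons (w 0) (fun i => K i x (w i.succ))) := by
  rw [covDeriv_eq_ext nabla (hA.comp_end hK)]
  choose L hL hLn using hK
  rw [covDeriv_eq_covDerivField nabla hA _ (fun i => L i (VF.ext (w i.succ))) (by simp [hL])]
  unfold covDerivField
  simp only [Fin.cons_zero, hL]
  congr 1
  refine Finset.sum_congr rfl fun i _ => ?_
  congr 1
  ext1 j
  by_cases h : j = i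
  · subst h
    simp only [Function.update_self]
    have h2 := congrArg (fun V : VF M => V x) (hLn j (VF.ext (w 0)) (VF.ext (w j.succ)))
    simp only [hL, nab_apply, VF.ext_self] at h2
    exact h2.symm
  · simp [h]

end parallelEnd

section leviCivita

variable [Bundle.RiemannianBundle (fun x : M => TangentSpace (𝓡 6) x)]
  [IsContMDiffRiemannianBundle (𝓡 6) ∞ E6 (fun x : M => TangentSpace (𝓡 6) x)]
  {nabla nablaG : Connection M}

/-- Uniqueness of the Levi-Civita connection: the difference of two of them is skew-symmetric in its
last two arguments and symmetric in the first two. -/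
theorem IsLeviCivita.apply_eq (h : IsLeviCivita nabla) (h' : IsLeviCivita nablaG) (V : VF M) (x : M)
    (u : TangentSpace (𝓡 6) x) : nablaG V x u = nabla V x u := by
  set a : VF M → VF M → VF M → ℝ := fun U V W =>
    inner ℝ (nablaG V x (U x) - nabla V x (U x)) (W x) with ha
  have h1 : ∀ U V W, a U V W = -a U W V := by
    intro U V W
    have e := h.metric.mvfderiv_inner_eq U (V.mdiffAt x) (W.mdiffAt x)
    have e' := h'.metric.mvfderiv_inner_eq U (V.mdiffAt x) (W.mdiffAt x)
    have e'' := e.symm.trans e'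
    simp only [ha, inner_sub_left]
    beta_reduce at e''
    rw [real_inner_comm (nabla W x (U x)) (V x), real_inner_comm (nablaG W x (U x)) (V x)] at e''
    linarith
  have h2 : ∀ U V W, a U V W = a V U W := by
    intro U V W
    have e := (CovariantDerivative.torsion_eq_zero_iff nabla).1 h.torsion_eq_zero
      (U.mdiffAt x) (V.mdiffAt x)
    have e' := (CovariantDerivative.torsion_eq_zero_iff nablaG).1 h'.torsion_eq_zero
      (U.mdiffAt x) (V.mdiffAt x)
    have e'' := e'.trans e.symm
    simp only [ha]
    congr 1
    rw [sub_eq_sub_iff_add_eq_add] at e'' ⊢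
    rw [e'', add_comm]
  have h3 : ∀ U V W, a U V W = 0 := by
    intro U V W
    have e1 := h2 U V W
    have e2 := h1 V U W
    have e3 := h2 V W U
    have e4 := h1 W V U
    have e5 := h2 W U V
    have e6 := h1 U W V
    linarith
  have h4 := h3 (VF.ext u) V (VF.ext (nablaG V x u - nabla V x u))
  simp only [ha, VF.ext_self] at h4
  exact sub_eq_zero.1 (inner_self_eq_zero.1 h4)

variable (hm : nabla.IsMetricCompatible)
    (hs : ∀ (x : M) (u v w : TangentSpace (𝓡 6) x),
      torsionForm nabla x ![u, v, w] = -torsionForm nabla x ![u, w, v])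
    (hLC : IsLeviCivita nablaG)
include hm hs hLC

/-- The Levi-Civita connection is `∇ - T/2`. -/
theorem leviCivita_apply (V : VF M) (x : M) (u : TangentSpace (𝓡 6) x) :
    nablaG V x u = nabla V x u + (1 / 2 : ℝ) • nabla.torsion x (V x) u :=
  (isLeviCivita_addOneForm nabla hm hs).apply_eq hLC V x u

theorem covDeriv_leviCivita {k : ℕ} {A : Tensor M k} (hA : IsSmoothTensor A) {x : M}
    (w : Fin (k + 1) → TangentSpace (𝓡 6) x) :
    covDeriv nablaG A x w = covDeriv nabla A x w - (1 / 2) * ∑ i, A x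
      (Function.update (fun j => w j.succ) i (nabla.torsion x (w i.succ) (w 0))) := by
  rw [covDeriv_eq_ext _ hA, covDeriv_eq_ext _ hA]
  unfold covDerivField
  simp only [leviCivita_apply hm hs hLC, hA.map_update_add, hA.map_update_smul,
    Finset.sum_add_distrib, VF.ext_self, Finset.mul_sum]
  ring

/-- The torsion satisfies `∇ᵍT = ∇T + σ/2`. -/
theorem covDeriv_leviCivita_torsionForm
    [hsm : CovariantDerivative.ContMDiffCovariantDerivative nabla ∞] {x : M}
    (u v w z : TangentSpace (𝓡 6) x) :
    covDeriv nablaG (torsionForm nabla) x ![u, v, w, z] =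
      covDeriv nabla (torsionForm nabla) x ![u, v, w, z] + (1 / 2) * sigma nabla x u v w z := by
  rw [covDeriv_leviCivita hm hs hLC isSmoothTensor_torsionForm]
  rw [Fin.sum_univ_three]
  have e1 : torsionForm nabla x (Function.update (fun j => ![u, v, w, z] j.succ) 0
      (nabla.torsion x v u)) = -inner ℝ (nabla.torsion x u v) (nabla.torsion x w z) := by
    simp only [torsionForm]
    change inner ℝ (nabla.torsion x (nabla.torsion x v u) w) z = _
    rw [inner_torsion_rotate hs, nabla.torsion_antisymm v u, inner_neg_right, real_inner_comm]
  have e2 : torsionForm nabla x (Function.update (fun j => ![u, v, w, z] j.succ) 1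
      (nabla.torsion x w u)) = -inner ℝ (nabla.torsion x w u) (nabla.torsion x v z) := by
    simp only [torsionForm]
    change inner ℝ (nabla.torsion x v (nabla.torsion x w u)) z = _
    rw [inner_torsion_swap hs, real_inner_comm]
  have e3 : torsionForm nabla x (Function.update (fun j => ![u, v, w, z] j.succ) 2
      (nabla.torsion x z u)) = -inner ℝ (nabla.torsion x v w) (nabla.torsion x u z) := by
    simp only [torsionForm]
    change inner ℝ (nabla.torsion x v w) (nabla.torsion x z u) = _
    rw [nabla.torsion_antisymm z u, inner_neg_right]
  have e4 : ∀ i : Fin 3, ![u, v, w, z] i.succ = ![v, w, z] i := fun i => rfl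
  simp only [e4, Matrix.cons_val_zero, Matrix.cons_val_one, Matrix.cons_val] at e1 e2 e3 ⊢
  rw [e1, e2, e3]
  unfold sigma
  ring

end leviCivita

end

/-! ### Orthonormal frames -/

section

variable {M : Type*} [TopologicalSpace M] [ChartedSpace E6 M] [IsManifold (𝓡 6) ∞ M] [T2Space M]
  [Bundle.RiemannianBundle (fun x : M => TangentSpace (𝓡 6) x)]
  [IsContMDiffRiemannianBundle (𝓡 6) ∞ E6 (fun x : M => TangentSpace (𝓡 6) x)]

theorem exists_rsqrt (f : SF M) (x : M) (hx : 0 < f x) :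
    ∃ g : SF M, ∀ᶠ y in 𝓝 x, g y = (Real.sqrt (f y))⁻¹ ∧ 0 < f y := by
  have ho : IsOpen {y | 0 < f y} := isOpen_lt continuous_const f.contMDiff.continuous
  obtain ⟨g, hg⟩ := exists_SF_eventuallyEq (f := fun y => (Real.sqrt (f y))⁻¹)
    (ho.mem_nhds hx) ho (by
      intro y hy
      have h1 : ContDiffAt ℝ ∞ (fun t : ℝ => (Real.sqrt t)⁻¹) (f y) :=
        (Real.contDiffAt_sqrt (ne_of_gt hy)).inv (Real.sqrt_pos.2 hy).ne'
      exact (h1.contMDiffAt.comp y (f.contMDiff y)).contMDiffWithinAt)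
  exact ⟨g, by filter_upwards [hg, ho.mem_nhds hx] with y h1 h2 using ⟨h1, h2⟩⟩

/-- An orthonormal basis at a point extends to smooth vector fields which are orthonormal near the
point, by the Gram-Schmidt process. -/
theorem exists_orthonormal_fields (x : M) (e : OrthonormalBasis (Fin 6) ℝ (TangentSpace (𝓡 6) x)) :
    ∃ E : Fin 6 → VF M, (∀ i, E i x = e i) ∧ ∀ᶠ y in 𝓝 x, Orthonormal ℝ (fun i => E i y) := by
  have key : ∀ n : ℕ, n ≤ 6 → ∃ E : Fin 6 → VF M, (∀ i, E i x = e i) ∧ ∀ᶠ y in 𝓝 x,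
      ∀ i j : Fin 6, (i : ℕ) < n → (j : ℕ) < n → inner ℝ (E i y) (E j y) =
        if i = j then (1 : ℝ) else 0 := by
    intro n hn
    induction n with
    | zero => exact ⟨fun i => VF.ext (e i), by simp, by simp⟩
    | succ n ih =>
      obtain ⟨E, hE, ho⟩ := ih (by omega)
      let N : Fin 6 := ⟨n, by omega⟩
      let s : Finset (Fin 6) := Finset.univ.filter (fun i => (i : ℕ) < n)
      -- the next field, made orthogonal to the preceding ones and not yet normalised
      let W : VF M := E N - ∑ i ∈ s, VF.fmul (ip (E N) (E i)) (E i)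
      have hWy : ∀ y, W y = E N y - ∑ i ∈ s, inner ℝ (E N y) (E i y) • E i y := by
        intro y
        have h := congrFun (map_sum (ContMDiffSection.coeAddHom (𝓡 6) E6 ∞
          (fun x : M => TangentSpace (𝓡 6) x)) (fun i => VF.fmul (ip (E N) (E i)) (E i)) s) y
        rw [Finset.sum_apply] at h
        exact congrArg (fun v => E N y - v) h
      have hWx : W x = e N := by
        rw [hWy, Finset.sum_eq_zero, sub_zero, hE]
        intro i hi
        have hi' : N ≠ i := by
          rintro rfl
          simp [s, N] at hi
        rw [hE, hE, e.orthonormal.2 hi', zero_smul]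
      obtain ⟨g, hg⟩ := exists_rsqrt (ip W W) x (by
        rw [ip_apply, hWx, real_inner_self_eq_norm_sq, e.orthonormal.1]; norm_num)
      have hgx : g x = 1 := by
        rw [hg.self_of_nhds.1, ip_apply, hWx, real_inner_self_eq_norm_sq, e.orthonormal.1]
        norm_num
      refine ⟨Function.update E N (VF.fmul g W), fun i => ?_, ?_⟩
      · by_cases hi : i = N
        · subst hi
          rw [Function.update_self, VF.fmul_apply, hgx, one_smul, hWx]
        · rw [Function.update_of_ne hi, hE]
      · filter_upwards [ho, hg] with y hoy hgy
        have hperp : ∀ j : Fin 6, (j : ℕ) < n → inner ℝ (W y) (E j y) = 0 := by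
          intro j hj
          rw [hWy, inner_sub_left, sum_inner]
          simp only [inner_smul_left]
          rw [Finset.sum_eq_single j]
          · rw [hoy j j hj hj]; simp
          · intro i hi hij
            rw [hoy i j (by simpa [s] using hi) hj, if_neg hij, mul_zero]
          · intro h; simp [s, hj] at h
        have hunit : inner ℝ (VF.fmul g W y) (VF.fmul g W y) = (1 : ℝ) := by
          rw [VF.fmul_apply, inner_smul_left, inner_smul_right, hgy.1]
          have h2 := hgy.2
          rw [ip_apply] at h2 ⊢
          have h3 : Real.sqrt (inner ℝ (W y) (W y)) ≠ 0 := (Real.sqrt_pos.2 h2).ne'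
          have h4 := Real.mul_self_sqrt h2.le
          simp only [conj_trivial]
          field_simp
          rw [sq, h4]
        have hcase : ∀ i : Fin 6, (i : ℕ) < n + 1 → i ≠ N → (i : ℕ) < n := by
          intro i hi hne
          have : (i : ℕ) ≠ n := fun h => hne (Fin.ext h)
          omega
        intro i j hi hj
        by_cases hiN : i = N <;> by_cases hjN : j = N
        · subst hiN; subst hjN
          simp only [Function.update_self, hunit, if_true]
        · subst hiN
          rw [Function.update_self, Function.update_of_ne hjN, VF.fmul_apply, inner_smul_left,
            hperp j (hcase j hj hjN), mul_zero, if_neg (Ne.symm hjN)]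
        · subst hjN
          rw [Function.update_self, Function.update_of_ne hiN, VF.fmul_apply, inner_smul_right,
            real_inner_comm, hperp i (hcase i hi hiN), mul_zero, if_neg hiN]
        · rw [Function.update_of_ne hiN, Function.update_of_ne hjN,
            hoy i j (hcase i hi hiN) (hcase j hj hjN)]
  obtain ⟨E, hE, ho⟩ := key 6 le_rfl
  refine ⟨E, hE, ho.mono fun y hy => ?_⟩
  rw [orthonormal_iff_ite]
  exact fun i j => hy i j i.2 j.2

theorem exists_orthonormalBasis_coe {x : M} {v : Fin 6 → TangentSpace (𝓡 6) x}
    (hv : Orthonormal ℝ v) :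
    ∃ e : OrthonormalBasis (Fin 6) ℝ (TangentSpace (𝓡 6) x), ∀ i, e i = v i := by
  have hf : FiniteDimensional ℝ (TangentSpace (𝓡 6) x) := inferInstanceAs (FiniteDimensional ℝ E6)
  have hc : Module.finrank ℝ (TangentSpace (𝓡 6) x) = Fintype.card (Fin 6) := by
    change Module.finrank ℝ E6 = _
    simp
  have hv' : Orthonormal ℝ (Set.univ.domRestrict v) :=
    hv.comp _ Subtype.val_injective
  obtain ⟨b, hb⟩ := hv'.exists_orthonormalBasis_extension_of_card_eq hc
  exact ⟨b, fun i => hb i (Set.mem_univ i)⟩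

/-- The contraction `∑ A(e_{i₁}, …, e_{i_p}) B(e_{i₁}, …, e_{i_p}, w₁, …, w_q)` over an orthonormal
basis. -/
def contr {p q : ℕ} (A : Tensor M p) (B : Tensor M (p + q)) : Tensor M q := fun x w =>
  ∑ i : Fin p → Fin 6, A x (fun l => frame x (i l)) * B x (Fin.append (fun l => frame x (i l)) w)

/-- A full contraction of two multilinear maps does not depend on the orthonormal basis. -/
theorem sum_orthonormalBasis_congr {E : Type*} [NormedAddCommGroup E] [InnerProductSpace ℝ E]
    {p : ℕ} (a b : MultilinearMap ℝ (fun _ : Fin p => E) ℝ) (e f : OrthonormalBasis (Fin 6) ℝ E) :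
    ∑ i : Fin p → Fin 6, a (fun l => e (i l)) * b (fun l => e (i l)) =
      ∑ i : Fin p → Fin 6, a (fun l => f (i l)) * b (fun l => f (i l)) := by
  have hexp : ∀ (m : MultilinearMap ℝ (fun _ : Fin p => E) ℝ) (i : Fin p → Fin 6),
      m (fun l => e (i l)) = ∑ j : Fin p → Fin 6, (∏ l, inner ℝ (f (j l)) (e (i l))) *
        m (fun l => f (j l)) := by
    intro m i
    have : (fun l => e (i l)) = fun l => ∑ c, (inner ℝ (f c) (e (i l)) : ℝ) • f c := by
      ext1 l; exact (f.sum_repr' (e (i l))).symm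
    rw [this, MultilinearMap.map_sum]
    refine Finset.sum_congr rfl fun j _ => ?_
    rw [MultilinearMap.map_smul_univ, smul_eq_mul]
  have hort : ∀ j k : Fin p → Fin 6, ∑ i : Fin p → Fin 6, (∏ l, inner ℝ (f (j l)) (e (i l))) *
      (∏ l, inner ℝ (f (k l)) (e (i l))) = if j = k then (1 : ℝ) else 0 := by
    intro j k
    simp only [← Finset.prod_mul_distrib]
    rw [← Fintype.prod_sum (fun l c => inner ℝ (f (j l)) (e c) * inner ℝ (f (k l)) (e c))]
    have : ∀ l, ∑ c, inner ℝ (f (j l)) (e c) * inner ℝ (f (k l)) (e c) =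
        if j l = k l then (1 : ℝ) else 0 := by
      intro l
      have h1 := e.sum_inner_mul_inner (f (j l)) (f (k l))
      simp only [real_inner_comm (e _) (f (k l))] at h1 ⊢
      rw [h1]
      exact orthonormal_iff_ite.1 f.orthonormal _ _
    simp only [this]
    by_cases h : j = k
    · simp [h]
    · rw [if_neg h]
      obtain ⟨l, hl⟩ := Function.ne_iff.1 h
      exact Finset.prod_eq_zero (Finset.mem_univ l) (if_neg hl)
  calc _ = ∑ i : Fin p → Fin 6, ∑ j : Fin p → Fin 6, ∑ k : Fin p → Fin 6,
        ((∏ l, inner ℝ (f (j l)) (e (i l))) * (∏ l, inner ℝ (f (k l)) (e (i l)))) *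
          (a (fun l => f (j l)) * b (fun l => f (k l))) := by
        refine Finset.sum_congr rfl fun i _ => ?_
        rw [hexp a, hexp b, Finset.sum_mul_sum]
        refine Finset.sum_congr rfl fun j _ => Finset.sum_congr rfl fun k _ => ?_
        ring
    _ = ∑ j : Fin p → Fin 6, ∑ k : Fin p → Fin 6, (if j = k then (1 : ℝ) else 0) *
          (a (fun l => f (j l)) * b (fun l => f (k l))) := by
        rw [Finset.sum_comm]
        refine Finset.sum_congr rfl fun j _ => ?_
        rw [Finset.sum_comm]
        refine Finset.sum_congr rfl fun k _ => ?_
        rw [← Finset.sum_mul, hort]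
    _ = _ := by simp

end

/-! ### Contractions of tensor fields -/

section

theorem append_update_left {α : Type*} {p q : ℕ} (a : Fin p → α) (w : Fin q → α) (l : Fin p)
    (z : α) : Fin.append (Function.update a l z) w =
      Function.update (Fin.append a w) (Fin.castAdd q l) z := by
  ext1 j
  refine Fin.addCases (fun j => ?_) (fun j => ?_) j
  · by_cases h : j = l
    · subst h; simp
    · have : Fin.castAdd q j ≠ Fin.castAdd q l := fun h' => h (Fin.castAdd_injective _ _ h')
      simp [h, this]
  · have : Fin.natAdd p j ≠ Fin.castAdd q l := by
      intro h; have := congrArg Fin.val h; simp at this; omega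
    simp [this]

theorem append_update_right {α : Type*} {p q : ℕ} (a : Fin p → α) (w : Fin q → α) (l : Fin q)
    (z : α) : Fin.append a (Function.update w l z) =
      Function.update (Fin.append a w) (Fin.natAdd p l) z := by
  ext1 j
  refine Fin.addCases (fun j => ?_) (fun j => ?_) j
  · have : Fin.castAdd q j ≠ Fin.natAdd p l := by
      intro h; have := congrArg Fin.val h; simp at this; omega
    simp [this]
  · by_cases h : j = l
    · subst h; simp
    · have : Fin.natAdd p j ≠ Fin.natAdd p l := fun h' => h (Fin.natAdd_injective _ _ h')
      simp [h, this]

/-- Freeze the last arguments of a multilinear map. -/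
def appendLeft {E : Type*} [AddCommGroup E] [Module ℝ E] {p q : ℕ}
    (m : MultilinearMap ℝ (fun _ : Fin (p + q) => E) ℝ) (w : Fin q → E) :
    MultilinearMap ℝ (fun _ : Fin p => E) ℝ where
  toFun v := m (Fin.append v w)
  map_update_add' := by
    intro inst v i a b
    obtain rfl : inst = fun a b => instDecidableEqFin p a b := Subsingleton.elim _ _
    rw [append_update_left, append_update_left, append_update_left, m.map_update_add]
  map_update_smul' := by
    intro inst v i a b
    obtain rfl : inst = fun a b => instDecidableEqFin p a b := Subsingleton.elim _ _
    rw [append_update_left, append_update_left, m.map_update_smul]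

/-- Freeze the first arguments of a multilinear map. -/
def appendRight {E : Type*} [AddCommGroup E] [Module ℝ E] {p q : ℕ}
    (m : MultilinearMap ℝ (fun _ : Fin (p + q) => E) ℝ) (v : Fin p → E) :
    MultilinearMap ℝ (fun _ : Fin q => E) ℝ where
  toFun w := m (Fin.append v w)
  map_update_add' := by
    intro inst v i a b
    obtain rfl : inst = fun a b => instDecidableEqFin q a b := Subsingleton.elim _ _
    rw [append_update_right, append_update_right, append_update_right, m.map_update_add]
  map_update_smul' := by
    intro inst v i a b
    obtain rfl : inst = fun a b => instDecidableEqFin q a b := Subsingleton.elim _ _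
    rw [append_update_right, append_update_right, m.map_update_smul]

/-- Skew-symmetry of the connection coefficients makes the derivatives of the frame cancel in a
full contraction. -/
theorem sum_update_skew {E : Type*} [AddCommGroup E] [Module ℝ E] {p : ℕ}
    (a b : MultilinearMap ℝ (fun _ : Fin p => E) ℝ) (e d : Fin 6 → E) (θ : Fin 6 → Fin 6 → ℝ)
    (hd : ∀ i, d i = ∑ c, θ i c • e c) (hθ : ∀ i c, θ i c = -θ c i) (l : Fin p) :
    ∑ i : Fin p → Fin 6, (a (Function.update (fun m => e (i m)) l (d (i l))) *
      b (fun m => e (i m)) +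
      a (fun m => e (i m)) * b (Function.update (fun m => e (i m)) l (d (i l)))) = 0 := by
  have hexp : ∀ (m : MultilinearMap ℝ (fun _ : Fin p => E) ℝ) (i : Fin p → Fin 6),
      m (Function.update (fun m => e (i m)) l (d (i l))) =
        ∑ c, θ (i l) c * m (fun r => e (Function.update i l c r)) := by
    intro m i
    rw [hd, MultilinearMap.map_update_sum]
    refine Finset.sum_congr rfl fun c _ => ?_
    rw [m.map_update_smul, smul_eq_mul]
    congr 2
    ext1 r
    by_cases h : r = l
    · subst h; simp
    · simp [h]
  rw [Finset.sum_add_distrib]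
  simp only [hexp, Finset.sum_mul, Finset.mul_sum]
  rw [← Fintype.sum_prod_type', ← Fintype.sum_prod_type']
  have hinv : Function.Involutive
      (fun z : (Fin p → Fin 6) × Fin 6 => (Function.update z.1 l z.2, z.1 l)) := by
    intro z
    ext1 <;> simp
  -- exchanging the old and the new index at the place `l` turns the first sum into minus the second
  rw [Fintype.sum_equiv (Function.Involutive.toPerm
    (fun z : (Fin p → Fin 6) × Fin 6 => (Function.update z.1 l z.2, z.1 l)) hinv)
    (fun z : (Fin p → Fin 6) × Fin 6 => a (fun m => e (z.1 m)) *
      (θ (z.1 l) z.2 * b fun r => e (Function.update z.1 l z.2 r)))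
    (fun z => -(θ (z.1 l) z.2 * a (fun r => e (Function.update z.1 l z.2 r)) *
      b (fun m => e (z.1 m)))) ?_]
  · rw [Finset.sum_neg_distrib]
    exact add_neg_cancel _
  · intro z
    simp only [Function.Involutive.coe_toPerm, Function.update_self, Function.update_idem,
      Function.update_eq_self]
    rw [hθ (z.1 l) z.2]
    ring

variable {M : Type*} [TopologicalSpace M] [ChartedSpace E6 M] [IsManifold (𝓡 6) ∞ M] [T2Space M]
  [Bundle.RiemannianBundle (fun x : M => TangentSpace (𝓡 6) x)]
  [IsContMDiffRiemannianBundle (𝓡 6) ∞ E6 (fun x : M => TangentSpace (𝓡 6) x)]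
  {p q : ℕ} {A : Tensor M p} {B : Tensor M (p + q)}

theorem contr_eq (hA : IsSmoothTensor A) (hB : IsSmoothTensor B) {x : M}
    (e : OrthonormalBasis (Fin 6) ℝ (TangentSpace (𝓡 6) x)) (w : Fin q → TangentSpace (𝓡 6) x) :
    contr A B x w =
      ∑ i : Fin p → Fin 6, A x (fun l => e (i l)) * B x (Fin.append (fun l => e (i l)) w) := by
  obtain ⟨a, ha⟩ := hA.multilinear x
  obtain ⟨b, hb⟩ := hB.multilinear x
  have := sum_orthonormalBasis_congr a (appendLeft b w) (frame x) e
  unfold contr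
  simp only [ha, hb]
  exact this

/-- Near `x`, a contraction may be computed in a smooth orthonormal frame. -/
theorem contr_eventuallyEq (hA : IsSmoothTensor A) (hB : IsSmoothTensor B) {x : M}
    {E : Fin 6 → VF M} (hE : ∀ᶠ y in 𝓝 x, Orthonormal ℝ (fun i => E i y)) (V : Fin q → VF M) :
    (fun y => contr A B y (fun i => V i y)) =ᶠ[𝓝 x]
      (∑ i : Fin p → Fin 6, ev hA (fun l => E (i l)) *
        ev hB (Fin.append (fun l => E (i l)) V) : SF M) := by
  filter_upwards [hE] with y hy
  obtain ⟨e, he⟩ := exists_orthonormalBasis_coe hy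
  rw [contr_eq hA hB e]
  have h := congrFun (map_sum (ContMDiffMap.coeFnAddMonoidHom : SF M →+ (M → ℝ))
    (fun i : Fin p → Fin 6 => ev hA (fun l => E (i l)) *
        ev hB (Fin.append (fun l => E (i l)) V)) Finset.univ) y
  rw [Finset.sum_apply] at h
  refine Eq.trans ?_ h.symm
  refine Finset.sum_congr rfl fun i _ => ?_
  change _ = A y _ * B y _
  simp only [he]
  congr 2
  ext1 j
  refine Fin.addCases (fun j => ?_) (fun j => ?_) j <;> simp

theorem IsSmoothTensor.contr (hA : IsSmoothTensor A) (hB : IsSmoothTensor B) :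
    IsSmoothTensor (ACYT.contr A B) where
  multilinear x := by
    obtain ⟨b, hb⟩ := hB.multilinear x
    refine ⟨∑ i : Fin p → Fin 6, A x (fun l => frame x (i l)) •
      appendRight b (fun l => frame x (i l)), fun v => ?_⟩
    simp only [ACYT.contr, hb, sum_apply, smul_apply, smul_eq_mul]
    rfl
  smooth V x := by
    obtain ⟨E, -, hE⟩ := exists_orthonormal_fields x (frame x)
    exact (ContMDiffMap.contMDiff _ x).congr_of_eventuallyEq (contr_eventuallyEq hA hB hE V)

/-- The covariant derivative of a metric connection commutes with contractions. -/
theorem covDeriv_contr {nabla : Connection M} (hm : nabla.IsMetricCompatible)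
    (hA : IsSmoothTensor A) (hB : IsSmoothTensor B) {x : M}
    (e : OrthonormalBasis (Fin 6) ℝ (TangentSpace (𝓡 6) x))
    (w : Fin (q + 1) → TangentSpace (𝓡 6) x) :
    covDeriv nabla (ACYT.contr A B) x w = ∑ i : Fin p → Fin 6,
      (covDeriv nabla A x (Matrix.vecCons (w 0) (fun l => e (i l))) *
          B x (Fin.append (fun l => e (i l)) (fun j => w j.succ)) +
        A x (fun l => e (i l)) * covDeriv nabla B x
          (Matrix.vecCons (w 0) (Fin.append (fun l => e (i l)) (fun j => w j.succ)))) := by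
  obtain ⟨E, hEx, hE⟩ := exists_orthonormal_fields x e
  obtain ⟨a, ha⟩ := hA.multilinear x
  obtain ⟨b, hb⟩ := hB.multilinear x
  rw [covDeriv_eq_ext nabla (hA.contr hB)]
  set V : Fin q → VF M := fun i => VF.ext (w i.succ) with hV
  set u := w 0 with hu
  have hVx : ∀ i, V i x = w i.succ := fun i => VF.ext_self _
  unfold covDerivField
  have h1 : mvfderiv (𝓡 6) (fun y => contr A B y (fun i => V i y)) x u =
      dir (VF.ext u) (∑ i : Fin p → Fin 6, ev hA (fun l => E (i l)) *
        ev hB (Fin.append (fun l => E (i l)) V)) x := by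
    rw [dir_apply, VF.ext_self]
    unfold mvfderiv
    have h3 := (contr_eventuallyEq hA hB hE V).mfderiv_eq (I := 𝓡 6) (I' := 𝓘(ℝ, ℝ))
    simp only [ContinuousLinearMap.comp_apply]
    rw [h3]
    rfl
  rw [h1, dir_sum, SF.sum_apply']
  have happ : ∀ i : Fin p → Fin 6, (fun j => (Fin.append (fun l => E (i l)) V j) x) =
      Fin.append (fun l => e (i l)) (fun j => w j.succ) := by
    intro i; ext1 j
    refine Fin.addCases (fun j => ?_) (fun j => ?_) j <;> simp [hEx, hVx]
  -- the connection coefficients of the frame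
  set θ : Fin 6 → Fin 6 → ℝ := fun i c => inner ℝ (e c) (nabla (E i) x u) with hθ
  have hd : ∀ i, nabla (E i) x u = ∑ c, θ i c • e c := fun i => (e.sum_repr' _).symm
  have hskew : ∀ i c, θ i c = -θ c i := by
    intro i c
    have h2 := hm.mvfderiv_inner_eq (VF.ext u) ((E i).mdiffAt x) ((E c).mdiffAt x)
    have h3 : (fun y => (inner ℝ (E i y) (E c y) : ℝ)) =ᶠ[𝓝 x]
        fun _ => if i = c then (1 : ℝ) else 0 := by
      filter_upwards [hE] with y hy
      exact orthonormal_iff_ite.1 hy i c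
    have h4 : mvfderiv (𝓡 6) (fun y => (inner ℝ (E i y) (E c y) : ℝ)) x = 0 := by
      have h5 := h3.mfderiv_eq (I := 𝓡 6) (I' := 𝓘(ℝ, ℝ))
      unfold mvfderiv
      rw [h5, mfderiv_const]
      exact ContinuousLinearMap.comp_zero _
    rw [h4] at h2
    beta_reduce at h2
    rw [VF.ext_self, hEx, hEx, real_inner_comm] at h2
    simp only [hθ]
    rw [real_inner_comm (nabla (E c) x u) (e i)]
    have h6 : (0 : ℝ) = inner ℝ (e c) (nabla (E i) x u) + inner ℝ (e i) (nabla (E c) x u) := h2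
    rw [real_inner_comm (nabla (E c) x u) (e i)] at h6
    linarith
  have hterm : ∀ i : Fin p → Fin 6, dir (VF.ext u) (ev hA (fun l => E (i l)) *
        ev hB (Fin.append (fun l => E (i l)) V)) x =
      (covDeriv nabla A x (Matrix.vecCons u (fun l => e (i l))) *
          B x (Fin.append (fun l => e (i l)) (fun j => w j.succ)) +
        A x (fun l => e (i l)) * covDeriv nabla B x
          (Matrix.vecCons u (Fin.append (fun l => e (i l)) (fun j => w j.succ)))) +
      ∑ l : Fin p, (a (Function.update (fun m => e (i m)) l (nabla (E (i l)) x u)) *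
          appendLeft b (fun j => w j.succ) (fun m => e (i m)) +
        a (fun m => e (i m)) * appendLeft b (fun j => w j.succ)
          (Function.update (fun m => e (i m)) l (nabla (E (i l)) x u))) +
      ∑ j : Fin q, A x (fun l => e (i l)) * B x (Fin.append (fun l => e (i l))
        (Function.update (fun j => w j.succ) j (nabla (V j) x u))) := by
    intro i
    rw [dir_mul]
    change dir (VF.ext u) (ev hA (fun l => E (i l))) x * B x _ +
      A x _ * dir (VF.ext u) (ev hB _) x = _
    rw [dir_ev nabla hA, dir_ev nabla hB, Fin.sum_univ_add]
    simp only [happ, hEx, VF.ext_self, Fin.append_left, Fin.append_right, ← append_update_left,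
      ← append_update_right, Finset.sum_add_distrib, ← Finset.sum_mul, ← Finset.mul_sum]
    simp only [← ha]
    have e1 : ∀ v, appendLeft b (fun j => w j.succ) v = B x (Fin.append v (fun j => w j.succ)) :=
      fun v => (hb _).symm
    simp only [e1]
    ring
  simp only [hterm, Finset.sum_add_distrib]
  have hzero : ∑ i : Fin p → Fin 6, ∑ l : Fin p,
      (a (Function.update (fun m => e (i m)) l (nabla (E (i l)) x u)) *
          appendLeft b (fun j => w j.succ) (fun m => e (i m)) +
        a (fun m => e (i m)) * appendLeft b (fun j => w j.succ)
          (Function.update (fun m => e (i m)) l (nabla (E (i l)) x u))) = 0 := by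
    rw [Finset.sum_comm]
    exact Finset.sum_eq_zero fun l _ =>
      sum_update_skew a _ e (fun i => nabla (E i) x u) θ hd hskew l
  have hlast : ∑ j : Fin q, contr A B x (Function.update (fun j => V j x) j (nabla (V j) x u)) =
      ∑ i : Fin p → Fin 6, ∑ j : Fin q, A x (fun l => e (i l)) * B x (Fin.append (fun l => e (i l))
        (Function.update (fun j => w j.succ) j (nabla (V j) x u))) := by
    rw [Finset.sum_comm]
    refine Finset.sum_congr rfl fun j _ => ?_
    rw [contr_eq hA hB e]
    simp only [hVx]
  simp only [Finset.sum_add_distrib] at hzero hlast ⊢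
  rw [hlast, hzero]
  ring

end

/-! ### Adapted bases and the pairing with `Ψ` -/

section

variable {M : Type*} [TopologicalSpace M] [ChartedSpace E6 M] [IsManifold (𝓡 6) ∞ M] [T2Space M]
  [Bundle.RiemannianBundle (fun x : M => TangentSpace (𝓡 6) x)]
  {J : ∀ x : M, TangentSpace (𝓡 6) x →L[ℝ] TangentSpace (𝓡 6) x}
  {Psi : ∀ x : M, (Fin 3 → TangentSpace (𝓡 6) x) → ℂ}

/-- An orthonormal basis of the form `(e₁, Je₁, e₃, Je₃, e₅, Je₅)` in which `Ψ` has the standard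
form. -/
structure IsAdapted (J : ∀ x : M, TangentSpace (𝓡 6) x →L[ℝ] TangentSpace (𝓡 6) x)
    (Psi : ∀ x : M, (Fin 3 → TangentSpace (𝓡 6) x) → ℂ) {x : M}
    (e : OrthonormalBasis (Fin 6) ℝ (TangentSpace (𝓡 6) x)) : Prop where
  J_pIdx : ∀ l, J x (e (pIdx l)) = e (qIdx l)
  J_qIdx : ∀ l, J x (e (qIdx l)) = -e (pIdx l)
  psi : ∀ i j k, Psi x ![e i, e j, e k] = stdPsi i j k

theorem exists_isAdapted (h : IsSU3Structure J Psi) (x : M) :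
    ∃ e : OrthonormalBasis (Fin 6) ℝ (TangentSpace (𝓡 6) x), IsAdapted J Psi e := by
  obtain ⟨e, h0, h2, h4, hPsi⟩ := h.adapted x
  have hp : ∀ l, J x (e (pIdx l)) = e (qIdx l) := by
    intro l; fin_cases l
    · exact h0
    · exact h2
    · exact h4
  refine ⟨e, hp, fun l => by rw [← hp, h.J_sq], fun i j k => ?_⟩
  rw [hPsi, stdPsi]
  congr 3
  ext a c
  have h1 : ∀ i j, (inner ℝ (e i) (e j) : ℝ) = if i = j then 1 else 0 :=
    orthonormal_iff_ite.1 e.orthonormal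
  have h2 : (![e i, e j, e k] c) = e (![i, j, k] c) := by fin_cases c <;> rfl
  have h3 : (![e 0, e 2, e 4] a) = e (pIdx a) := by fin_cases a <;> rfl
  have h4 : (![e 1, e 3, e 5] a) = e (qIdx a) := by fin_cases a <;> rfl
  simp only [unitaryCoframe]
  rw [h2, h3, h4, h1, h1]
  have hne : pIdx a ≠ qIdx a := by fin_cases a <;> decide
  generalize ![i, j, k] c = m
  by_cases hm : m = pIdx a
  · subst hm; simp [Ne.symm hne]
  · by_cases hm' : m = qIdx a
    · subst hm'; simp [hne, Ne.symm hne]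
    · simp [hm, hm', Ne.symm hm, Ne.symm hm']

theorem exists_linear_psi (h : IsSU3Structure J Psi) (x : M) :
    ∃ z : Fin 3 → TangentSpace (𝓡 6) x →ₗ[ℝ] ℂ,
      ∀ v, Psi x v = -(Matrix.of fun a c : Fin 3 => z a (v c)).det := by
  obtain ⟨e, -, -, -, hPsi⟩ := h.adapted x
  refine ⟨fun a => ⟨⟨fun v => ((inner ℝ (![e 0, e 2, e 4] a) v : ℝ) : ℂ) +
        Complex.I * ((inner ℝ (![e 1, e 3, e 5] a) v : ℝ) : ℂ), fun u v => ?_⟩, fun c v => ?_⟩,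
        fun v => hPsi v⟩
  · rw [inner_add_right, inner_add_right]; push_cast; ring
  · change ((inner ℝ (![e 0, e 2, e 4] a) (c • v) : ℝ) : ℂ) +
        Complex.I * ((inner ℝ (![e 1, e 3, e 5] a) (c • v) : ℝ) : ℂ) =
      c • (((inner ℝ (![e 0, e 2, e 4] a) v : ℝ) : ℂ) +
        Complex.I * ((inner ℝ (![e 1, e 3, e 5] a) v : ℝ) : ℂ))
    rw [inner_smul_right, inner_smul_right, Complex.real_smul]
    push_cast
    ring

theorem psi_isLinear (h : IsSU3Structure J Psi) (x : M) :
    (∀ v w, IsLinearMap ℝ (fun u => Psi x ![u, v, w])) ∧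
    (∀ u w, IsLinearMap ℝ (fun v => Psi x ![u, v, w])) ∧
    (∀ u v, IsLinearMap ℝ (fun w => Psi x ![u, v, w])) := by
  obtain ⟨z, hz⟩ := exists_linear_psi h x
  refine ⟨fun v w => ⟨fun a b => ?_, fun c a => ?_⟩, fun v w => ⟨fun a b => ?_, fun c a => ?_⟩,
    fun v w => ⟨fun a b => ?_, fun c a => ?_⟩⟩ <;>
  · simp only [hz, Matrix.det_fin_three, Matrix.of_apply, Matrix.cons_val, map_add, map_smul,
      Complex.real_smul]
    ring

theorem isSmoothTensor_psi_re (h : IsSU3Structure J Psi) :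
    IsSmoothTensor (fun x v => (Psi x v).re : Tensor M 3) where
  multilinear x := by
    obtain ⟨h1, h2, h3⟩ := psi_isLinear h x
    obtain ⟨m, hm⟩ := exists_multilinear_three (fun u v w => (Psi x ![u, v, w]).re)
      (fun v w => ⟨fun a b => by simp [(h1 v w).map_add], fun c a => by simp [(h1 v w).map_smul]⟩)
      (fun v w => ⟨fun a b => by simp [(h2 v w).map_add], fun c a => by simp [(h2 v w).map_smul]⟩)
      (fun v w => ⟨fun a b => by simp [(h3 v w).map_add], fun c a => by simp [(h3 v w).map_smul]⟩)
    refine ⟨m, fun v => ?_⟩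
    rw [← hm]
    congr 2
    ext1 i
    fin_cases i <;> rfl
  smooth V := by
    have := h.smooth_Psi (fun i => V i) (fun i => (V i).contMDiff)
    exact (Complex.reCLM.contDiff.contMDiff (n := ∞)).comp this

theorem isSmoothTensor_psi_im (h : IsSU3Structure J Psi) :
    IsSmoothTensor (fun x v => (Psi x v).im : Tensor M 3) where
  multilinear x := by
    obtain ⟨h1, h2, h3⟩ := psi_isLinear h x
    obtain ⟨m, hm⟩ := exists_multilinear_three (fun u v w => (Psi x ![u, v, w]).im)
      (fun v w => ⟨fun a b => by simp [(h1 v w).map_add], fun c a => by simp [(h1 v w).map_smul]⟩)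
      (fun v w => ⟨fun a b => by simp [(h2 v w).map_add], fun c a => by simp [(h2 v w).map_smul]⟩)
      (fun v w => ⟨fun a b => by simp [(h3 v w).map_add], fun c a => by simp [(h3 v w).map_smul]⟩)
    refine ⟨m, fun v => ?_⟩
    rw [← hm]
    congr 2
    ext1 i
    fin_cases i <;> rfl
  smooth V := by
    have := h.smooth_Psi (fun i => V i) (fun i => (V i).contMDiff)
    exact (Complex.imCLM.contDiff.contMDiff (n := ∞)).comp this

variable [IsContMDiffRiemannianBundle (𝓡 6) ∞ E6 (fun x : M => TangentSpace (𝓡 6) x)]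
  {nabla : Connection M}

theorem isSmoothEnd_J (h : IsSU3Structure J Psi) : IsSmoothEnd J := h.smooth_J

theorem inner_J_left (h : IsSU3Structure J Psi) {x : M} (u v : TangentSpace (𝓡 6) x) :
    inner ℝ (J x u) v = -inner ℝ u (J x v) := by
  have := h.J_orthogonal x u (J x v)
  rw [h.J_sq, inner_neg_right] at this
  linarith

/-- The components of the torsion in an orthonormal basis. -/
def torsionArray (nabla : Connection M) {x : M}
    (e : OrthonormalBasis (Fin 6) ℝ (TangentSpace (𝓡 6) x)) (i j k : Fin 6) : ℝ :=
  inner ℝ (nabla.torsion x (e i) (e j)) (e k)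

section skew

variable (hs : ∀ (x : M) (u v w : TangentSpace (𝓡 6) x),
    torsionForm nabla x ![u, v, w] = -torsionForm nabla x ![u, w, v])

include hs in
theorem isAlt3_torsionArray {x : M} (e : OrthonormalBasis (Fin 6) ℝ (TangentSpace (𝓡 6) x)) :
    IsAlt3 (torsionArray nabla e) where
  swap₁₂ i j k := by
    unfold torsionArray
    rw [nabla.torsion_antisymm, inner_neg_left]
  swap₂₃ i j k := inner_torsion_swap hs _ _ _

theorem sigma_eq_cyclicContraction {x : M}
    (e : OrthonormalBasis (Fin 6) ℝ (TangentSpace (𝓡 6) x)) (i j k l : Fin 6) :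
    sigma nabla x (e i) (e j) (e k) (e l) =
      cyclicContraction (torsionArray nabla e) (torsionArray nabla e) i j k l := by
  have h : ∀ a b c d, inner ℝ (nabla.torsion x (e a) (e b)) (nabla.torsion x (e c) (e d)) =
      ∑ m, torsionArray nabla e a b m * torsionArray nabla e c d m := by
    intro a b c d
    rw [← e.sum_inner_mul_inner]
    refine Finset.sum_congr rfl fun m _ => ?_
    rw [real_inner_comm (nabla.torsion x (e c) (e d))]
    rfl
  unfold sigma cyclicContraction
  rw [h, h, h, ← Finset.sum_add_distrib, ← Finset.sum_add_distrib]

theorem isAlt4_sigma {x : M} (f : Fin 6 → TangentSpace (𝓡 6) x) :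
    IsAlt4 (fun i j k l => sigma nabla x (f i) (f j) (f k) (f l)) where
  swap₁₂ _ _ _ _ := sigma_swap₁₂ _ _ _ _
  swap₂₃ _ _ _ _ := sigma_swap₂₃ _ _ _ _
  swap₃₄ _ _ _ _ := sigma_swap₃₄ _ _ _ _

end skew

section contraction

/-- The function `⟨A, Re Ψ⟩`. -/
def pairRe (Psi : ∀ x : M, (Fin 3 → TangentSpace (𝓡 6) x) → ℂ) (A : Tensor M 3) : Tensor M 0 :=
  contr A (fun x v => (Psi x v).re : Tensor M 3)

/-- The function `⟨A, Im Ψ⟩`. -/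
def pairIm (Psi : ∀ x : M, (Fin 3 → TangentSpace (𝓡 6) x) → ℂ) (A : Tensor M 3) : Tensor M 0 :=
  contr A (fun x v => (Psi x v).im : Tensor M 3)

theorem append_zero {α : Type*} (u : Fin 3 → α) (w : Fin 0 → α) :
    (Fin.append u w : Fin 3 → α) = u := by
  ext1 i
  exact Fin.append_left u w i

theorem pairRe_apply (h : IsSU3Structure J Psi) {A : Tensor M 3} (hA : IsSmoothTensor A) {x : M}
    {e : OrthonormalBasis (Fin 6) ℝ (TangentSpace (𝓡 6) x)} (he : IsAdapted J Psi e)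
    (hAlt : IsAlt3 (fun i j k => A x ![e i, e j, e k])) (w) :
    pairRe Psi A x w = -6 * (torsionZeta (fun i j k => A x ![e i, e j, e k])).re := by
  rw [← hAlt.sum_mul_stdPsi_re]
  refine (contr_eq (q := 0) hA (isSmoothTensor_psi_re h) e w).trans ?_
  rw [sum_fin_three_fun]
  refine Finset.sum_congr rfl fun a _ => Finset.sum_congr rfl fun b _ =>
    Finset.sum_congr rfl fun c _ => ?_
  have e1 : (fun l => e (![a, b, c] l)) = ![e a, e b, e c] := by ext1 l; fin_cases l <;> rfl
  rw [e1, append_zero, he.psi]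

theorem pairIm_apply (h : IsSU3Structure J Psi) {A : Tensor M 3} (hA : IsSmoothTensor A) {x : M}
    {e : OrthonormalBasis (Fin 6) ℝ (TangentSpace (𝓡 6) x)} (he : IsAdapted J Psi e)
    (hAlt : IsAlt3 (fun i j k => A x ![e i, e j, e k])) (w) :
    pairIm Psi A x w = 6 * (torsionZeta (fun i j k => A x ![e i, e j, e k])).im := by
  rw [← hAlt.sum_mul_stdPsi_im]
  refine (contr_eq (q := 0) hA (isSmoothTensor_psi_im h) e w).trans ?_
  rw [sum_fin_three_fun]
  refine Finset.sum_congr rfl fun a _ => Finset.sum_congr rfl fun b _ =>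
    Finset.sum_congr rfl fun c _ => ?_
  have e1 : (fun l => e (![a, b, c] l)) = ![e a, e b, e c] := by ext1 l; fin_cases l <;> rfl
  rw [e1, append_zero, he.psi]

/-- The pairing with a parallel form `B` commutes with covariant differentiation. -/
theorem covDeriv_contr_parallel (hm : nabla.IsMetricCompatible) {p q : ℕ} {A : Tensor M p}
    {B : Tensor M (p + q)} (hA : IsSmoothTensor A) (hB : IsSmoothTensor B)
    (hp : IsParallel nabla B) {x : M} (e : OrthonormalBasis (Fin 6) ℝ (TangentSpace (𝓡 6) x))
    (w : Fin (q + 1) → TangentSpace (𝓡 6) x) :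
    covDeriv nabla (contr A B) x w = ∑ i : Fin p → Fin 6,
      covDeriv nabla A x (Matrix.vecCons (w 0) (fun l => e (i l))) *
          B x (Fin.append (fun l => e (i l)) (fun j => w j.succ)) := by
  rw [covDeriv_contr hm hA hB e w]
  refine Finset.sum_congr rfl fun i _ => ?_
  rw [hp x _, mul_zero, add_zero]

theorem covDeriv_pairRe (h : IsSU3Structure J Psi) (hm : nabla.IsMetricCompatible)
    (hp : IsParallel nabla (fun x v => (Psi x v).re))
    {A : Tensor M 3} (hA : IsSmoothTensor A) {x : M}
    {e : OrthonormalBasis (Fin 6) ℝ (TangentSpace (𝓡 6) x)} (he : IsAdapted J Psi e)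
    (u : TangentSpace (𝓡 6) x)
    (hAlt : IsAlt3 (fun i j k => covDeriv nabla A x ![u, e i, e j, e k])) :
    covDeriv nabla (pairRe Psi A) x ![u] =
      -6 * (torsionZeta (fun i j k => covDeriv nabla A x ![u, e i, e j, e k])).re := by
  rw [← hAlt.sum_mul_stdPsi_re]
  refine (covDeriv_contr_parallel (q := 0) hm hA (isSmoothTensor_psi_re h) hp e ![u]).trans ?_
  rw [sum_fin_three_fun]
  refine Finset.sum_congr rfl fun a _ => Finset.sum_congr rfl fun b _ =>
    Finset.sum_congr rfl fun c _ => ?_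
  have e1 : (fun l => e (![a, b, c] l)) = ![e a, e b, e c] := by ext1 l; fin_cases l <;> rfl
  rw [e1, append_zero, he.psi]
  rfl

theorem covDeriv_pairIm (h : IsSU3Structure J Psi) (hm : nabla.IsMetricCompatible)
    (hp : IsParallel nabla (fun x v => (Psi x v).im))
    {A : Tensor M 3} (hA : IsSmoothTensor A) {x : M}
    {e : OrthonormalBasis (Fin 6) ℝ (TangentSpace (𝓡 6) x)} (he : IsAdapted J Psi e)
    (u : TangentSpace (𝓡 6) x)
    (hAlt : IsAlt3 (fun i j k => covDeriv nabla A x ![u, e i, e j, e k])) :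
    covDeriv nabla (pairIm Psi A) x ![u] =
      6 * (torsionZeta (fun i j k => covDeriv nabla A x ![u, e i, e j, e k])).im := by
  rw [← hAlt.sum_mul_stdPsi_im]
  refine (covDeriv_contr_parallel (q := 0) hm hA (isSmoothTensor_psi_im h) hp e ![u]).trans ?_
  rw [sum_fin_three_fun]
  refine Finset.sum_congr rfl fun a _ => Finset.sum_congr rfl fun b _ =>
    Finset.sum_congr rfl fun c _ => ?_
  have e1 : (fun l => e (![a, b, c] l)) = ![e a, e b, e c] := by ext1 l; fin_cases l <;> rfl
  rw [e1, append_zero, he.psi]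
  rfl

theorem covDeriv_zero_tensor (A : Tensor M 0) (x : M) (u : TangentSpace (𝓡 6) x) :
    covDeriv nabla A x ![u] = mvfderiv (𝓡 6) (fun y => A y ![]) x u := by
  unfold covDeriv
  rw [Finset.univ_eq_empty, Finset.sum_empty, sub_zero]
  have : ∀ y, (fun i : Fin 0 => field (![u] i.succ) y) = ![] := fun y => Subsingleton.elim _ _
  simp only [this]
  rfl

end contraction

end

/-! ### Functions with zero derivative, and the Nijenhuis tensor -/

section

section constant

variable {M : Type*} [TopologicalSpace M] [ChartedSpace E6 M] [IsManifold (𝓡 6) ∞ M]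

/-- A smooth function with zero derivative on a connected manifold is constant. -/
theorem SF.eq_of_mvfderiv_eq_zero [PreconnectedSpace M] (f : SF M)
    (h : ∀ (x : M) (u : TangentSpace (𝓡 6) x), mvfderiv (𝓡 6) f x u = 0) (x y : M) : f x = f y := by
  refine IsLocallyConstant.apply_eq_of_preconnectedSpace
    ((IsLocallyConstant.iff_eventually_eq f).2 fun x => ?_) x y
  set φ := extChartAt (𝓡 6) x with hφ
  obtain ⟨r, hr, hball⟩ := Metric.isOpen_iff.1 (isOpen_extChartAt_target (I := 𝓡 6) x) (φ x)
    (mem_extChartAt_target (I := 𝓡 6) x)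
  have hd : ∀ z ∈ Metric.ball (φ x) r, HasFDerivAt (𝕜 := ℝ) (f ∘ φ.symm) (0 : E6 →L[ℝ] ℝ) z := by
    intro z hz
    have h1 : MDifferentiableAt 𝓘(ℝ, E6) (𝓡 6) φ.symm z :=
      ((contMDiffOn_extChartAt_symm (I := 𝓡 6) (n := ∞) x).contMDiffAt
        ((isOpen_extChartAt_target (I := 𝓡 6) x).mem_nhds (hball hz))).mdifferentiableAt (by simp)
    have h2 := HasMFDerivAt.comp z (f.mdiffAt (φ.symm z)).hasMFDerivAt h1.hasMFDerivAt
    have h3 : mfderiv (𝓡 6) 𝓘(ℝ, ℝ) f (φ.symm z) = 0 := by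
      ext u; exact h (φ.symm z) u
    rw [h3, ContinuousLinearMap.zero_comp] at h2
    exact hasMFDerivAt_iff_hasFDerivAt.1 h2
  have hc : ∀ z ∈ Metric.ball (φ x) r, f (φ.symm z) = f x := by
    intro z hz
    have := Metric.isOpen_ball.is_const_of_fderiv_eq_zero (𝕜 := ℝ) (f := f ∘ φ.symm)
      (convex_ball (φ x) r).isPreconnected
      (fun z hz => (hd z hz).differentiableAt.differentiableWithinAt)
      (fun z hz => (hd z hz).fderiv) hz (Metric.mem_ball_self hr)
    simpa [hφ] using this
  filter_upwards [extChartAt_source_mem_nhds (I := 𝓡 6) x,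
    (continuousAt_extChartAt (I := 𝓡 6) x).preimage_mem_nhds (Metric.ball_mem_nhds _ hr)]
    with y hy hy'
  rw [← hc (φ y) hy', φ.left_inv hy]

end constant

section nijenhuis

variable {M : Type*} [TopologicalSpace M] [ChartedSpace E6 M] [IsManifold (𝓡 6) ∞ M] [T2Space M]
  {J : ∀ x : M, TangentSpace (𝓡 6) x →L[ℝ] TangentSpace (𝓡 6) x} (hJ : IsSmoothEnd J)

/-- The Nijenhuis tensor of two smooth vector fields. -/
def nij (U V : VF M) : VF M :=
  lie (app hJ U) (app hJ V) - lie U V - app hJ (lie (app hJ U) V) - app hJ (lie U (app hJ V))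

theorem nijenhuis_eq {x : M} (u v : TangentSpace (𝓡 6) x) :
    nijenhuis J x u v = nij hJ (VF.ext u) (VF.ext v) x := by
  have hu := VF.ext_eventuallyEq u
  have hv := VF.ext_eventuallyEq v
  have hJu : ∀ᶠ y in 𝓝 x, app hJ (VF.ext u) y = J y (field u y) := by
    filter_upwards [hu] with y hy; rw [app_apply, hy]
  have hJv : ∀ᶠ y in 𝓝 x, app hJ (VF.ext v) y = J y (field v y) := by
    filter_upwards [hv] with y hy; rw [app_apply, hy]
  unfold nijenhuis
  rw [← Filter.EventuallyEq.mlieBracket_vectorField_eq hu hv,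
    ← Filter.EventuallyEq.mlieBracket_vectorField_eq hJu hJv,
    ← Filter.EventuallyEq.mlieBracket_vectorField_eq hJu hv,
    ← Filter.EventuallyEq.mlieBracket_vectorField_eq hu hJv]
  rfl

/-- If `a + ib` is a pseudo-holomorphic function then its derivative vanishes on the image of the
Nijenhuis tensor. -/
theorem dir_nij {a b : SF M} (ha : ∀ U, dir (app hJ U) a = -dir U b)
    (hb : ∀ U, dir (app hJ U) b = dir U a) (U V : VF M) :
    dir (nij hJ U V) a = 0 ∧ dir (nij hJ U V) b = 0 := by
  have hneg : ∀ (W : VF M) (f : SF M), dir W (-f) = -dir W f := fun W f => by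
    rw [eq_neg_iff_add_eq_zero, ← dir_add, neg_add_cancel]; exact dir_const _ 0
  unfold nij
  constructor <;>
  · simp only [dir_sub_left, ha, hb, dir_lie, hneg]
    ring

variable {nabla : Connection M} [hsm : CovariantDerivative.ContMDiffCovariantDerivative nabla ∞]
  (hp : ∀ (x : M) (u v : TangentSpace (𝓡 6) x),
      nabla (fun y => J y (field v y)) x u = J x (nabla (field v) x u))

include hJ hp in
/-- The Nijenhuis tensor is determined by the torsion of a complex connection. -/
theorem nijenhuis_eq_torsion (hJ2 : ∀ x v, J x (J x v) = -v) {x : M} (u v : TangentSpace (𝓡 6) x) :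
    nijenhuis J x u v = nabla.torsion x u v - nabla.torsion x (J x u) (J x v)
      + J x (nabla.torsion x (J x u) v) + J x (nabla.torsion x u (J x v)) := by
  rw [nijenhuis_eq hJ]
  have h1 := fun U V : VF M => nab_app hJ hp U V
  have h2 := fun (U : VF M) => (VF.ext' (fun y => hJ2 y (U y)) : app hJ (app hJ U) = -U)
  simp only [nij, lie_eq (nabla := nabla), h1, VF.sub_apply, app_apply, tor_apply, VF.ext_self,
    map_sub, hJ2]
  abel

end nijenhuis

end

/-! ### The pseudo-holomorphic function `⟨T, Ψ⟩` -/

section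

theorem torsionZeta_smul (c : ℝ) (t : Fin 6 → Fin 6 → Fin 6 → ℝ) :
    torsionZeta (fun i j k => c * t i j k) = c * torsionZeta t := by
  apply Complex.ext <;> simp [torsionZeta] <;> ring

theorem eq_of_inner_basis {E : Type*} [NormedAddCommGroup E] [InnerProductSpace ℝ E] {ι : Type*}
    [Fintype ι] (e : OrthonormalBasis ι ℝ E) {u v : E}
    (h : ∀ i, (inner ℝ (e i) u : ℝ) = inner ℝ (e i) v) : u = v := by
  rw [← e.sum_repr' u, ← e.sum_repr' v]
  simp only [h]

variable {M : Type*} [TopologicalSpace M] [ChartedSpace E6 M] [IsManifold (𝓡 6) ∞ M] [T2Space M]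
  [Bundle.RiemannianBundle (fun x : M => TangentSpace (𝓡 6) x)]
  [IsContMDiffRiemannianBundle (𝓡 6) ∞ E6 (fun x : M => TangentSpace (𝓡 6) x)]
  {J : ∀ x : M, TangentSpace (𝓡 6) x →L[ℝ] TangentSpace (𝓡 6) x}
  {Psi : ∀ x : M, (Fin 3 → TangentSpace (𝓡 6) x) → ℂ} {nabla : Connection M}

/-- The components of `u ⌟ σ` in an orthonormal basis. -/
def sigmaArray (nabla : Connection M) {x : M}
    (e : OrthonormalBasis (Fin 6) ℝ (TangentSpace (𝓡 6) x)) (u : TangentSpace (𝓡 6) x)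
    (i j k : Fin 6) : ℝ := sigma nabla x u (e i) (e j) (e k)

section

variable [hsm : CovariantDerivative.ContMDiffCovariantDerivative nabla ∞]

theorem isSmoothTensor_pairRe (h : IsSU3Structure J Psi) :
    IsSmoothTensor (pairRe Psi (torsionForm nabla)) :=
  IsSmoothTensor.contr (q := 0) isSmoothTensor_torsionForm (isSmoothTensor_psi_re h)

theorem isSmoothTensor_pairIm (h : IsSU3Structure J Psi) :
    IsSmoothTensor (pairIm Psi (torsionForm nabla)) :=
  IsSmoothTensor.contr (q := 0) isSmoothTensor_torsionForm (isSmoothTensor_psi_im h)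

/-- The smooth function `⟨T, Re Ψ⟩`. -/
def torRe (nabla : Connection M) [hsm : CovariantDerivative.ContMDiffCovariantDerivative nabla ∞]
    (h : IsSU3Structure J Psi) : SF M := ev (isSmoothTensor_pairRe (nabla := nabla) h) ![]

/-- The smooth function `⟨T, Im Ψ⟩`. -/
def torIm (nabla : Connection M) [hsm : CovariantDerivative.ContMDiffCovariantDerivative nabla ∞]
    (h : IsSU3Structure J Psi) : SF M := ev (isSmoothTensor_pairIm (nabla := nabla) h) ![]

variable (h : IsSU3Structure J Psi) (hm : nabla.IsMetricCompatible)
  (hs : ∀ (x : M) (u v w : TangentSpace (𝓡 6) x),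
      torsionForm nabla x ![u, v, w] = -torsionForm nabla x ![u, w, v])

include hs in
theorem torRe_apply {x : M} {e : OrthonormalBasis (Fin 6) ℝ (TangentSpace (𝓡 6) x)}
    (he : IsAdapted J Psi e) : torRe nabla h x = -6 * (torsionZeta (torsionArray nabla e)).re :=
  pairRe_apply h isSmoothTensor_torsionForm he (isAlt3_torsionArray hs e) _

include hs in
theorem torIm_apply {x : M} {e : OrthonormalBasis (Fin 6) ℝ (TangentSpace (𝓡 6) x)}
    (he : IsAdapted J Psi e) : torIm nabla h x = 6 * (torsionZeta (torsionArray nabla e)).im :=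
  pairIm_apply h isSmoothTensor_torsionForm he (isAlt3_torsionArray hs e) _

theorem isAlt3_sigmaArray {x : M} (e : OrthonormalBasis (Fin 6) ℝ (TangentSpace (𝓡 6) x))
    (u : TangentSpace (𝓡 6) x) : IsAlt3 (sigmaArray nabla e u) :=
  ⟨fun _ _ _ => sigma_swap₂₃ _ _ _ _, fun _ _ _ => sigma_swap₃₄ _ _ _ _⟩

variable (hB : RiemannianBianchi nabla)
include hm hs hB

theorem mvfderiv_torRe (hp : IsParallel nabla (fun x v => (Psi x v).re)) {x : M}
    {e : OrthonormalBasis (Fin 6) ℝ (TangentSpace (𝓡 6) x)} (he : IsAdapted J Psi e)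
    (u : TangentSpace (𝓡 6) x) :
    mvfderiv (𝓡 6) (torRe nabla h) x u = 2 * (torsionZeta (sigmaArray nabla e u)).re := by
  have h1 := (isAlt3_sigmaArray (nabla := nabla) e u)
  have h2 : (fun i j k => covDeriv nabla (torsionForm nabla) x ![u, e i, e j, e k]) =
      fun i j k => -(1 / 3) * sigmaArray nabla e u i j k := by
    funext i j k; exact covDeriv_torsionForm_eq hm hs hB _ _ _ _
  have h3 := covDeriv_pairRe h hm hp (isSmoothTensor_torsionForm (nabla := nabla)) he u (by
    rw [h2]
    exact ⟨fun i j k => by rw [h1.swap₁₂]; ring, fun i j k => by rw [h1.swap₂₃]; ring⟩)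
  rw [h2, torsionZeta_smul, covDeriv_zero_tensor] at h3
  have h4 : (fun y => pairRe Psi (torsionForm nabla) y ![]) = torRe nabla h := by
    funext y; exact congrArg _ (Subsingleton.elim _ _)
  rw [h4, Complex.re_ofReal_mul] at h3
  rw [h3]; ring

theorem mvfderiv_torIm (hp : IsParallel nabla (fun x v => (Psi x v).im)) {x : M}
    {e : OrthonormalBasis (Fin 6) ℝ (TangentSpace (𝓡 6) x)} (he : IsAdapted J Psi e)
    (u : TangentSpace (𝓡 6) x) :
    mvfderiv (𝓡 6) (torIm nabla h) x u = -2 * (torsionZeta (sigmaArray nabla e u)).im := by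
  have h1 := (isAlt3_sigmaArray (nabla := nabla) e u)
  have h2 : (fun i j k => covDeriv nabla (torsionForm nabla) x ![u, e i, e j, e k]) =
      fun i j k => -(1 / 3) * sigmaArray nabla e u i j k := by
    funext i j k; exact covDeriv_torsionForm_eq hm hs hB _ _ _ _
  have h3 := covDeriv_pairIm h hm hp (isSmoothTensor_torsionForm (nabla := nabla)) he u (by
    rw [h2]
    exact ⟨fun i j k => by rw [h1.swap₁₂]; ring, fun i j k => by rw [h1.swap₂₃]; ring⟩)
  rw [h2, torsionZeta_smul, covDeriv_zero_tensor] at h3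
  have h4 : (fun y => pairIm Psi (torsionForm nabla) y ![]) = torIm nabla h := by
    funext y; exact congrArg _ (Subsingleton.elim _ _)
  rw [h4, Complex.im_ofReal_mul] at h3
  rw [h3]; ring

variable (hre : IsParallel nabla (fun x v => (Psi x v).re))
  (him : IsParallel nabla (fun x v => (Psi x v).im))
include hre him

theorem mvfderiv_qIdx {x : M} {e : OrthonormalBasis (Fin 6) ℝ (TangentSpace (𝓡 6) x)}
    (he : IsAdapted J Psi e) (l : Fin 3) :
    mvfderiv (𝓡 6) (torRe nabla h) x (e (qIdx l)) =
        -mvfderiv (𝓡 6) (torIm nabla h) x (e (pIdx l)) ∧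
      mvfderiv (𝓡 6) (torIm nabla h) x (e (qIdx l)) =
        mvfderiv (𝓡 6) (torRe nabla h) x (e (pIdx l)) := by
  have h1 : torsionZeta (sigmaArray nabla e (e (qIdx l))) =
      -Complex.I * torsionZeta (sigmaArray nabla e (e (pIdx l))) :=
    (isAlt4_sigma (nabla := nabla) e).torsionZeta_J l
  rw [mvfderiv_torRe h hm hs hB hre he, mvfderiv_torIm h hm hs hB him he,
    mvfderiv_torRe h hm hs hB hre he, mvfderiv_torIm h hm hs hB him he, h1]
  constructor <;> simp

/-- The function `⟨T, Re Ψ⟩ + i⟨T, Im Ψ⟩` is pseudo-holomorphic. -/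
theorem mvfderiv_J {x : M} (u : TangentSpace (𝓡 6) x) :
    mvfderiv (𝓡 6) (torRe nabla h) x (J x u) = -mvfderiv (𝓡 6) (torIm nabla h) x u ∧
      mvfderiv (𝓡 6) (torIm nabla h) x (J x u) = mvfderiv (𝓡 6) (torRe nabla h) x u := by
  obtain ⟨e, he⟩ := exists_isAdapted h x
  have h1 : (mvfderiv (𝓡 6) (torRe nabla h) x).toLinearMap ∘ₗ (J x).toLinearMap =
      -(mvfderiv (𝓡 6) (torIm nabla h) x).toLinearMap := by
    refine e.toBasis.ext fun i => ?_
    rw [e.coe_toBasis]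
    obtain ⟨l, rfl⟩ | ⟨l, rfl⟩ := exists_eq_pIdx_or_qIdx i
    · simpa [he.J_pIdx] using (mvfderiv_qIdx h hm hs hB hre him he l).1
    · simpa [he.J_qIdx] using (mvfderiv_qIdx h hm hs hB hre him he l).2.symm
  have h2 : (mvfderiv (𝓡 6) (torIm nabla h) x).toLinearMap ∘ₗ (J x).toLinearMap =
      (mvfderiv (𝓡 6) (torRe nabla h) x).toLinearMap := by
    refine e.toBasis.ext fun i => ?_
    rw [e.coe_toBasis]
    obtain ⟨l, rfl⟩ | ⟨l, rfl⟩ := exists_eq_pIdx_or_qIdx i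
    · simpa [he.J_pIdx] using (mvfderiv_qIdx h hm hs hB hre him he l).2
    · simpa [he.J_qIdx] using (mvfderiv_qIdx h hm hs hB hre him he l).1.symm
  exact ⟨LinearMap.congr_fun h1 u, LinearMap.congr_fun h2 u⟩

end

/-- In an adapted basis, the component `ζ` of the torsion determines the Nijenhuis tensor:
`N(e_{l+1}, e_{l+2}) = Re ζ e_l - Im ζ Je_l`. -/
theorem nijenhuis_adapted [hsm : CovariantDerivative.ContMDiffCovariantDerivative nabla ∞]
    (h : IsSU3Structure J Psi) (hs : ∀ (x : M) (u v w : TangentSpace (𝓡 6) x),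
      torsionForm nabla x ![u, v, w] = -torsionForm nabla x ![u, w, v])
    (hp : ∀ (x : M) (u v : TangentSpace (𝓡 6) x),
      nabla (fun y => J y (field v y)) x u = J x (nabla (field v) x u)) {x : M}
    {e : OrthonormalBasis (Fin 6) ℝ (TangentSpace (𝓡 6) x)} (he : IsAdapted J Psi e) (l : Fin 3) :
    nijenhuis J x (e (pIdx (l + 1))) (e (pIdx (l + 2))) =
      (torsionZeta (torsionArray nabla e)).re • e (pIdx l) -
        (torsionZeta (torsionArray nabla e)).im • e (qIdx l) := by
  have ht := isAlt3_torsionArray hs e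
  have h0 : ∀ i j k, inner ℝ (e k) (nabla.torsion x (e i) (e j)) = torsionArray nabla e i j k :=
    fun i j k => real_inner_comm _ _
  have hp' : ∀ i j l, inner ℝ (e (pIdx l)) (J x (nabla.torsion x (e i) (e j))) =
      -torsionArray nabla e i j (qIdx l) := fun i j l => by
    rw [← h0, ← he.J_pIdx, inner_J_left h, neg_neg]
  have hq' : ∀ i j l, inner ℝ (e (qIdx l)) (J x (nabla.torsion x (e i) (e j))) =
      torsionArray nabla e i j (pIdx l) := fun i j l => by
    rw [← h0, ← neg_neg (e (pIdx l)), ← he.J_qIdx, inner_neg_left, inner_J_left h, neg_neg]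
  have ho : ∀ i j, (inner ℝ (e i) (e j) : ℝ) = if i = j then 1 else 0 :=
    orthonormal_iff_ite.1 e.orthonormal
  rw [nijenhuis_eq_torsion h.smooth_J hp h.J_sq]
  simp only [he.J_pIdx]
  refine eq_of_inner_basis e fun i => ?_
  obtain ⟨k, rfl⟩ | ⟨k, rfl⟩ := exists_eq_pIdx_or_qIdx i
  · simp only [inner_add_right, inner_sub_right, inner_smul_right, hp', h0, ho]
    fin_cases l <;> fin_cases k <;> simp [pIdx, qIdx, torsionZeta] <;>
      (try simp only [ht.self₁₂, ht.self₂₃, ht.sort₁₂, ht.sort₂₃, Fin.reduceLT]) <;> ring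
  · simp only [inner_add_right, inner_sub_right, inner_smul_right, hq', h0, ho]
    fin_cases l <;> fin_cases k <;> simp [pIdx, qIdx, torsionZeta] <;>
      (try simp only [ht.self₁₂, ht.self₂₃, ht.sort₁₂, ht.sort₂₃, Fin.reduceLT]) <;> ring

end

/-! ### Constancy of `⟨T, Ψ⟩` -/

section

variable {M : Type*} [TopologicalSpace M] [ChartedSpace E6 M] [IsManifold (𝓡 6) ∞ M] [T2Space M]
  [Bundle.RiemannianBundle (fun x : M => TangentSpace (𝓡 6) x)]
  [IsContMDiffRiemannianBundle (𝓡 6) ∞ E6 (fun x : M => TangentSpace (𝓡 6) x)]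
  {J : ∀ x : M, TangentSpace (𝓡 6) x →L[ℝ] TangentSpace (𝓡 6) x}
  {Psi : ∀ x : M, (Fin 3 → TangentSpace (𝓡 6) x) → ℂ} {nabla : Connection M}

section holomorphic

theorem linearMap_eq_zero_of_adapted {x : M} {e : OrthonormalBasis (Fin 6) ℝ (TangentSpace (𝓡 6) x)}
    (L : TangentSpace (𝓡 6) x →L[ℝ] ℝ) (hp : ∀ l, L (e (pIdx l)) = 0)
    (hq : ∀ l, L (e (qIdx l)) = 0) : L = 0 := by
  have : L.toLinearMap = 0 := by
    refine e.toBasis.ext fun i => ?_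
    rw [e.coe_toBasis]
    obtain ⟨l, rfl⟩ | ⟨l, rfl⟩ := exists_eq_pIdx_or_qIdx i
    · exact hp l
    · exact hq l
  ext u
  exact LinearMap.congr_fun this u

/-- Where the pseudo-holomorphic function `⟨T, Ψ⟩` does not vanish, the Nijenhuis tensor is onto,
so that the derivative of the function vanishes. -/
theorem mvfderiv_torsion_psi_of_ne [hsm : CovariantDerivative.ContMDiffCovariantDerivative nabla ∞]
    (hA : IsACYT J Psi nabla) (hB : RiemannianBianchi nabla) {x : M}
    (hne : torRe nabla hA.su3 x ^ 2 + torIm nabla hA.su3 x ^ 2 ≠ 0) :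
    mvfderiv (𝓡 6) (torRe nabla hA.su3) x = 0 ∧ mvfderiv (𝓡 6) (torIm nabla hA.su3) x = 0 := by
  obtain ⟨e, he⟩ := exists_isAdapted hA.su3 x
  set a := torRe nabla hA.su3 with ha
  set b := torIm nabla hA.su3 with hb
  have hax : a x = -6 * _ := torRe_apply hA.su3 hA.skew he
  have hbx : b x = 6 * _ := torIm_apply hA.su3 hA.skew he
  have hJd := fun (y : M) (u : TangentSpace (𝓡 6) y) =>
    mvfderiv_J hA.su3 hA.metric hA.skew hB hA.parallel_re hA.parallel_im u
  have key := dir_nij hA.su3.smooth_J (a := a) (b := b)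
    (fun U => by ext y; exact (hJd y (U y)).1) (fun U => by ext y; exact (hJd y (U y)).2)
  have hp : ∀ l, mvfderiv (𝓡 6) a x (e (pIdx l)) = 0 ∧ mvfderiv (𝓡 6) b x (e (pIdx l)) = 0 := by
    intro l
    obtain ⟨k1, k2⟩ := key (VF.ext (e (pIdx (l + 1)))) (VF.ext (e (pIdx (l + 2))))
    have k1' := congrArg (fun f : SF M => f x) k1
    have k2' := congrArg (fun f : SF M => f x) k2
    simp only [dir_apply] at k1' k2'
    rw [← nijenhuis_eq hA.su3.smooth_J,
      nijenhuis_adapted hA.su3 hA.skew hA.parallel_J he] at k1' k2'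
    obtain ⟨j1, j2⟩ := hJd x (e (pIdx l))
    rw [he.J_pIdx] at j1 j2
    rw [map_sub, map_smul, map_smul, j1] at k1'
    rw [map_sub, map_smul, map_smul, j2] at k2'
    simp only [smul_eq_mul, ContMDiffMap.coe_zero, Pi.zero_apply] at k1' k2'
    rw [hax, hbx] at hne
    generalize (torsionZeta (torsionArray nabla e)).re = A at *
    generalize (torsionZeta (torsionArray nabla e)).im = I at *
    have hne' : A ^ 2 + I ^ 2 ≠ 0 := fun h0 => hne (by linear_combination 36 * h0)
    constructor
    · refine (mul_eq_zero.1 (?_ : (A ^ 2 + I ^ 2) * _ = 0)).resolve_left hne'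
      linear_combination A * k1' - I * k2'
    · refine (mul_eq_zero.1 (?_ : (A ^ 2 + I ^ 2) * _ = 0)).resolve_left hne'
      linear_combination I * k1' + A * k2'
  constructor
  · refine linearMap_eq_zero_of_adapted _ (fun l => (hp l).1) fun l => ?_
    rw [← he.J_pIdx, (hJd x _).1, (hp l).2, neg_zero]
  · refine linearMap_eq_zero_of_adapted _ (fun l => (hp l).2) fun l => ?_
    rw [← he.J_pIdx, (hJd x _).2, (hp l).1]

/-- Under the Riemannian first Bianchi identity the function `⟨T, Ψ⟩` is constant. Indeed the
derivative of `|⟨T, Ψ⟩|²` vanishes both where the function is zero and where it is not; so the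
function is either nowhere or identically zero. -/
theorem mvfderiv_torsion_psi [PreconnectedSpace M]
    [hsm : CovariantDerivative.ContMDiffCovariantDerivative nabla ∞]
    (hA : IsACYT J Psi nabla) (hB : RiemannianBianchi nabla) (x : M) :
    mvfderiv (𝓡 6) (torRe nabla hA.su3) x = 0 ∧ mvfderiv (𝓡 6) (torIm nabla hA.su3) x = 0 := by
  set a := torRe nabla hA.su3 with ha
  set b := torIm nabla hA.su3 with hb
  have hd : ∀ (y : M) (u : TangentSpace (𝓡 6) y), mvfderiv (𝓡 6) (a * a + b * b : SF M) y u =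
      2 * (a y * mvfderiv (𝓡 6) a y u + b y * mvfderiv (𝓡 6) b y u) := by
    intro y u
    have h1 := congrArg (fun f : SF M => f y) (dir_add (VF.ext u) (a * a) (b * b))
    rw [dir_mul, dir_mul] at h1
    simp only [dir_apply, VF.ext_self, ContMDiffMap.coe_add, ContMDiffMap.coe_mul, Pi.add_apply,
      Pi.mul_apply] at h1
    refine h1.trans ?_
    ring
  have hc := SF.eq_of_mvfderiv_eq_zero (a * a + b * b) fun y u => by
    rw [hd]
    by_cases hy : a y ^ 2 + b y ^ 2 = 0
    · have h1 : a y = 0 := by nlinarith [sq_nonneg (a y), sq_nonneg (b y)]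
      have h2 : b y = 0 := by nlinarith [sq_nonneg (a y), sq_nonneg (b y)]
      rw [h1, h2]; ring
    · obtain ⟨h1, h2⟩ := mvfderiv_torsion_psi_of_ne hA hB hy
      rw [← ha] at h1
      rw [← hb] at h2
      rw [h1, h2]; simp
  have hv : ∀ y, (a * a + b * b : SF M) y = a y ^ 2 + b y ^ 2 := fun y => by
    simp only [ContMDiffMap.coe_add, ContMDiffMap.coe_mul, Pi.add_apply, Pi.mul_apply]; ring
  by_cases hx : a x ^ 2 + b x ^ 2 = 0
  · have hz : ∀ y, a y = 0 ∧ b y = 0 := by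
      intro y
      have hy : a y ^ 2 + b y ^ 2 = 0 := by rw [← hv, hc y x, hv, hx]
      constructor <;> nlinarith [sq_nonneg (a y), sq_nonneg (b y)]
    have h1 : (a : M → ℝ) = fun _ => 0 := funext fun y => (hz y).1
    have h2 : (b : M → ℝ) = fun _ => 0 := funext fun y => (hz y).2
    rw [h1, h2]
    exact ⟨mvfderiv_const (I := 𝓡 6) (0 : ℝ), mvfderiv_const (I := 𝓡 6) (0 : ℝ)⟩
  · exact mvfderiv_torsion_psi_of_ne hA hB hx

/-- Under the Riemannian first Bianchi identity the contraction of `σ` with `Ψ`, a multiple of the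
derivative of `⟨T, Ψ⟩`, vanishes; thus `σ` is of type `(2,2)`. -/
theorem torsionZeta_sigmaArray [PreconnectedSpace M]
    [hsm : CovariantDerivative.ContMDiffCovariantDerivative nabla ∞]
    (hA : IsACYT J Psi nabla) (hB : RiemannianBianchi nabla) {x : M}
    {e : OrthonormalBasis (Fin 6) ℝ (TangentSpace (𝓡 6) x)} (he : IsAdapted J Psi e)
    (u : TangentSpace (𝓡 6) x) : torsionZeta (sigmaArray nabla e u) = 0 := by
  obtain ⟨h1, h2⟩ := mvfderiv_torsion_psi hA hB x
  have h1' := mvfderiv_torRe hA.su3 hA.metric hA.skew hB hA.parallel_re he u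
  have h2' := mvfderiv_torIm hA.su3 hA.metric hA.skew hB hA.parallel_im he u
  rw [h1, zero_apply] at h1'
  rw [h2, zero_apply] at h2'
  apply Complex.ext
  · rw [Complex.zero_re]; linarith
  · rw [Complex.zero_im]; linarith

end holomorphic

/-! ### The form `σ` as a tensor field -/

section sigma

theorem exists_multilinear_four {E : Type*} [AddCommGroup E] [Module ℝ E] (f : E → E → E → E → ℝ)
    (h₁ : ∀ v w z, IsLinearMap ℝ (fun u => f u v w z))
    (h₂ : ∀ u w z, IsLinearMap ℝ (fun v => f u v w z))
    (h₃ : ∀ u v z, IsLinearMap ℝ (fun w => f u v w z))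
    (h₄ : ∀ u v w, IsLinearMap ℝ (fun z => f u v w z)) :
    ∃ m : MultilinearMap ℝ (fun _ : Fin 4 => E) ℝ, ∀ v, f (v 0) (v 1) (v 2) (v 3) = m v := by
  refine ⟨⟨fun v => f (v 0) (v 1) (v 2) (v 3), ?_, ?_⟩, fun v => rfl⟩
  · intro inst v i a b
    obtain rfl : inst = fun a b => instDecidableEqFin 4 a b := Subsingleton.elim _ _
    fin_cases i
    · exact (h₁ _ _ _).map_add a b
    · exact (h₂ _ _ _).map_add a b
    · exact (h₃ _ _ _).map_add a b
    · exact (h₄ _ _ _).map_add a b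
  · intro inst v i c a
    obtain rfl : inst = fun a b => instDecidableEqFin 4 a b := Subsingleton.elim _ _
    fin_cases i
    · exact (h₁ _ _ _).map_smul c a
    · exact (h₂ _ _ _).map_smul c a
    · exact (h₃ _ _ _).map_smul c a
    · exact (h₄ _ _ _).map_smul c a

/-- The form `σ` as a tensor field. -/
def sigmaForm (nabla : Connection M) : Tensor M 4 :=
  fun x v => sigma nabla x (v 0) (v 1) (v 2) (v 3)

theorem sigma_isLinear₁ {x : M} (v w z : TangentSpace (𝓡 6) x) :
    IsLinearMap ℝ (fun u => sigma nabla x u v w z) where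
  map_add a b := by
    simp only [sigma, torsion_add_left, map_add (nabla.torsion x _), inner_add_left,
      inner_add_right]
    ring
  map_smul c a := by
    simp only [sigma, torsion_smul_left, map_smul (nabla.torsion x _), inner_smul_left,
      inner_smul_right,
      conj_trivial, smul_eq_mul]
    ring

theorem sigma_isLinear₂ {x : M} (u w z : TangentSpace (𝓡 6) x) :
    IsLinearMap ℝ (fun v => sigma nabla x u v w z) where
  map_add a b := by
    simp only [sigma, torsion_add_left, map_add (nabla.torsion x _), inner_add_left,
      inner_add_right]
    ring
  map_smul c a := by
    simp only [sigma, torsion_smul_left, map_smul (nabla.torsion x _), inner_smul_left,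
      inner_smul_right,
      conj_trivial, smul_eq_mul]
    ring

theorem sigma_isLinear₃ {x : M} (u v z : TangentSpace (𝓡 6) x) :
    IsLinearMap ℝ (fun w => sigma nabla x u v w z) where
  map_add a b := by
    simp only [sigma, torsion_add_left, map_add (nabla.torsion x _), inner_add_left,
      inner_add_right]
    ring
  map_smul c a := by
    simp only [sigma, torsion_smul_left, map_smul (nabla.torsion x _), inner_smul_left,
      inner_smul_right,
      conj_trivial, smul_eq_mul]
    ring

theorem sigma_isLinear₄ {x : M} (u v w : TangentSpace (𝓡 6) x) :
    IsLinearMap ℝ (fun z => sigma nabla x u v w z) where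
  map_add a b := by
    simp only [sigma, map_add (nabla.torsion x _), inner_add_right]
    ring
  map_smul c a := by
    simp only [sigma, map_smul (nabla.torsion x _), inner_smul_right, smul_eq_mul]
    ring

/-- A multilinear `4`-tensor which vanishes on a basis vanishes. -/
theorem eq_zero_of_basis_four {E : Type*} [AddCommGroup E] [Module ℝ E] {ι : Type*} [Finite ι]
    (b : Module.Basis ι ℝ E) (f : E → E → E → E → ℝ)
    (h₁ : ∀ v w z, IsLinearMap ℝ (fun u => f u v w z))
    (h₂ : ∀ u w z, IsLinearMap ℝ (fun v => f u v w z))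
    (h₃ : ∀ u v z, IsLinearMap ℝ (fun w => f u v w z))
    (h₄ : ∀ u v w, IsLinearMap ℝ (fun z => f u v w z))
    (h : ∀ i j k l, f (b i) (b j) (b k) (b l) = 0) (u v w z : E) : f u v w z = 0 := by
  have ext : ∀ {g : E → ℝ}, IsLinearMap ℝ g → (∀ i, g (b i) = 0) → ∀ u, g u = 0 := by
    intro g hg h0 u
    have : hg.mk' g = 0 := b.ext fun i => h0 i
    exact LinearMap.congr_fun this u
  exact ext (h₁ v w z) (fun i => ext (h₂ _ w z) (fun j => ext (h₃ _ _ z) (fun k =>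
    ext (h₄ _ _ _) (fun l => h i j k l) z) w) v) u

variable [hsm : CovariantDerivative.ContMDiffCovariantDerivative nabla ∞]

theorem isSmoothTensor_sigmaForm : IsSmoothTensor (sigmaForm nabla) where
  multilinear x := exists_multilinear_four (fun u v w z => sigma nabla x u v w z)
    sigma_isLinear₁ sigma_isLinear₂ sigma_isLinear₃ sigma_isLinear₄
  smooth V := by
    have : (fun x => sigmaForm nabla x (fun i => V i x)) =
        (ip (tor nabla (V 0) (V 1)) (tor nabla (V 2) (V 3)) +
        ip (tor nabla (V 1) (V 2)) (tor nabla (V 0) (V 3)) +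
        ip (tor nabla (V 2) (V 0)) (tor nabla (V 1) (V 3)) : SF M) := by
      ext1 x
      simp only [ContMDiffMap.coe_add, Pi.add_apply, ip_apply, tor_apply, sigmaForm, sigma]
    rw [this]
    exact ContMDiffMap.contMDiff _

/-- The Leibniz rule for the quadratic form `σ`. -/
theorem covDeriv_sigmaForm (hm : nabla.IsMetricCompatible) {x : M}
    (u X Y Z V : TangentSpace (𝓡 6) x) :
    covDeriv nabla (sigmaForm nabla) x ![u, X, Y, Z, V] =
      covDeriv nabla (torsionForm nabla) x ![u, X, Y, nabla.torsion x Z V] +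
      covDeriv nabla (torsionForm nabla) x ![u, Y, Z, nabla.torsion x X V] +
      covDeriv nabla (torsionForm nabla) x ![u, Z, X, nabla.torsion x Y V] +
      (covDeriv nabla (torsionForm nabla) x ![u, Z, V, nabla.torsion x X Y] +
      covDeriv nabla (torsionForm nabla) x ![u, X, V, nabla.torsion x Y Z] +
      covDeriv nabla (torsionForm nabla) x ![u, Y, V, nabla.torsion x Z X]) := by
  have hD : ∀ a b c d : TangentSpace (𝓡 6) x, covDeriv nabla (torsionForm nabla) x ![a, b, c, d] =
      inner ℝ (dtor nabla (VF.ext a) (VF.ext b) (VF.ext c) x) d := by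
    intro a b c d
    simpa using covDeriv_torsionForm hm (VF.ext a) (VF.ext b) (VF.ext c) (VF.ext d) x
  rw [covDeriv_eq_covDerivField nabla isSmoothTensor_sigmaForm _
    ![VF.ext X, VF.ext Y, VF.ext Z, VF.ext V] (by intro i; fin_cases i <;> simp)]
  unfold covDerivField
  have h1 : (fun y => sigmaForm nabla y
      (fun i => ![VF.ext X, VF.ext Y, VF.ext Z, VF.ext V] i y)) =
      (ip (tor nabla (VF.ext X) (VF.ext Y)) (tor nabla (VF.ext Z) (VF.ext V)) +
        ip (tor nabla (VF.ext Y) (VF.ext Z)) (tor nabla (VF.ext X) (VF.ext V)) +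
        ip (tor nabla (VF.ext Z) (VF.ext X)) (tor nabla (VF.ext Y) (VF.ext V)) : SF M) := by
    ext1 y
    simp [ip_apply, tor_apply, sigmaForm, sigma]
  have hn : ∀ P Q : VF M, nab nabla (VF.ext u) (tor nabla P Q) = dtor nabla (VF.ext u) P Q +
      tor nabla (nab nabla (VF.ext u) P) Q + tor nabla P (nab nabla (VF.ext u) Q) := by
    intro P Q; unfold dtor; abel
  have h3 := dir_add (VF.ext u)
    (ip (tor nabla (VF.ext X) (VF.ext Y)) (tor nabla (VF.ext Z) (VF.ext V)) +
        ip (tor nabla (VF.ext Y) (VF.ext Z)) (tor nabla (VF.ext X) (VF.ext V)))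
    (ip (tor nabla (VF.ext Z) (VF.ext X)) (tor nabla (VF.ext Y) (VF.ext V)))
  rw [dir_add (VF.ext u) (ip _ _), dir_ip hm, dir_ip hm, dir_ip hm] at h3
  simp only [hn, ip_add_left, ip_add_right] at h3
  have h2 := congrArg (fun f : SF M => f x) h3
  simp only [dir_apply, ContMDiffMap.coe_add, Pi.add_apply, ip_apply, tor_apply, VF.ext_self]
    at h2
  rw [h1, Fin.sum_univ_four]
  simp only [hD, Matrix.cons_val_zero]
  refine (congrArg (· - _) h2).trans ?_
  have s0 := real_inner_comm (dtor nabla (VF.ext u) (VF.ext Z) (VF.ext V) x) (nabla.torsion x X Y)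
  have s1 := real_inner_comm (dtor nabla (VF.ext u) (VF.ext X) (VF.ext V) x) (nabla.torsion x Y Z)
  have s2 := real_inner_comm (dtor nabla (VF.ext u) (VF.ext Y) (VF.ext V) x) (nabla.torsion x Z X)
  simp only [sigmaForm, sigma, Function.update_apply]
  simp [nab_apply]
  rw [← s0, ← s1, ← s2]
  ring

end sigma

end

/-! ### Vanishing of `σ` -/

section

variable {M : Type*} [TopologicalSpace M] [ChartedSpace E6 M] [IsManifold (𝓡 6) ∞ M] [T2Space M]
  [Bundle.RiemannianBundle (fun x : M => TangentSpace (𝓡 6) x)]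
  [IsContMDiffRiemannianBundle (𝓡 6) ∞ E6 (fun x : M => TangentSpace (𝓡 6) x)]
  {J : ∀ x : M, TangentSpace (𝓡 6) x →L[ℝ] TangentSpace (𝓡 6) x}
  {Psi : ∀ x : M, (Fin 3 → TangentSpace (𝓡 6) x) → ℂ} {nabla : Connection M}

theorem covDeriv_zero (nabla : Connection M) {k : ℕ} {A : Tensor M k} (hA : ∀ x v, A x v = 0)
    {x : M} (w : Fin (k + 1) → TangentSpace (𝓡 6) x) : covDeriv nabla A x w = 0 := by
  unfold covDeriv
  simp only [hA, Finset.sum_const_zero, sub_zero]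
  exact congrArg (fun L => L (w 0)) (mvfderiv_const (I := 𝓡 6) (0 : ℝ) (x := x))

variable [hsm : CovariantDerivative.ContMDiffCovariantDerivative nabla ∞]

/-- The covariant derivative of `σ` in an orthonormal basis, under the Riemannian first Bianchi
identity. -/
theorem covDeriv_sigmaForm_basis (hm : nabla.IsMetricCompatible)
    (hs : ∀ (x : M) (u v w : TangentSpace (𝓡 6) x),
      torsionForm nabla x ![u, v, w] = -torsionForm nabla x ![u, w, v])
    (hB : RiemannianBianchi nabla) {x : M}
    (e : OrthonormalBasis (Fin 6) ℝ (TangentSpace (𝓡 6) x)) (m i j k l : Fin 6) :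
    covDeriv nabla (sigmaForm nabla) x ![e m, e i, e j, e k, e l] =
      -(1 / 3) * derivContraction (torsionArray nabla e)
        (cyclicContraction (torsionArray nabla e) (torsionArray nabla e)) m i j k l := by
  have h : ∀ a b c d f, sigma nabla x (e a) (e b) (e c) (nabla.torsion x (e d) (e f)) =
      ∑ n, torsionArray nabla e d f n *
        cyclicContraction (torsionArray nabla e) (torsionArray nabla e) a b c n := by
    intro a b c d f
    have hT : nabla.torsion x (e d) (e f) = ∑ n, torsionArray nabla e d f n • e n := by
      rw [← e.sum_repr' (nabla.torsion x (e d) (e f))]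
      refine Finset.sum_congr rfl fun n _ => ?_
      rw [real_inner_comm]; rfl
    rw [hT]
    have := map_sum ((sigma_isLinear₄ (nabla := nabla) (e a) (e b) (e c)).mk')
      (fun n => torsionArray nabla e d f n • e n) Finset.univ
    refine this.trans (Finset.sum_congr rfl fun n _ => ?_)
    rw [map_smul, ← sigma_eq_cyclicContraction]
    rfl
  rw [covDeriv_sigmaForm hm]
  simp only [covDeriv_torsionForm_eq hm hs hB, h]
  unfold derivContraction
  set s := cyclicContraction (torsionArray nabla e) (torsionArray nabla e)
  unfold cyclicContraction
  simp only [Finset.mul_sum, ← Finset.sum_add_distrib]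
  refine Finset.sum_congr rfl fun n _ => ?_
  ring

/-- The derivatives of `σ` are of type `(2,2)`, like `σ`, because `Ψ` is parallel. -/
theorem isType22_derivContraction [PreconnectedSpace M] (hA : IsACYT J Psi nabla)
    (hB : RiemannianBianchi nabla) {x : M}
    {e : OrthonormalBasis (Fin 6) ℝ (TangentSpace (𝓡 6) x)} (he : IsAdapted J Psi e) (m : Fin 6) :
    IsType22 (derivContraction (torsionArray nabla e)
        (cyclicContraction (torsionArray nabla e) (torsionArray nabla e)) m) := by
  have ht := isAlt3_torsionArray hA.skew e
  set t := torsionArray nabla e with htdef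
  have h4 := ht.isAlt4_derivContraction ht.isAlt4_cyclicContraction m
  set d := derivContraction t (cyclicContraction t t) m with hd
  have e1 : ∀ {y : M} (f : OrthonormalBasis (Fin 6) ℝ (TangentSpace (𝓡 6) y)) (a b c : Fin 6),
      (fun l => f (![a, b, c] l)) = ![f a, f b, f c] := by
    intro y f a b c; ext1 l; fin_cases l <;> rfl
  have e2 : ∀ {y : M} (a b c : TangentSpace (𝓡 6) y) (w : Fin 1 → TangentSpace (𝓡 6) y),
      Fin.append ![a, b, c] w = ![a, b, c, w 0] := by
    intro y a b c w; ext1 l; fin_cases l <;> rfl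
  -- rotating the last argument to the front of a `4`-form changes its sign
  have hrot : ∀ {y : M} (f : OrthonormalBasis (Fin 6) ℝ (TangentSpace (𝓡 6) y))
      (u : TangentSpace (𝓡 6) y) (a b c : Fin 6),
      sigma nabla y (f a) (f b) (f c) u = -sigmaArray nabla f u a b c := by
    intro y f u a b c
    unfold sigmaArray
    rw [sigma_swap₃₄ _ _ _ u, sigma_swap₂₃ _ _ u, sigma_swap₁₂ _ u, neg_neg]
  have hrot' : ∀ l a b c, d a b c l = -d l a b c := by
    intro l a b c
    have := h4.swap₃₄ a b c l; have := h4.swap₂₃ a b l c; have := h4.swap₁₂ a l b c; linarith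
  have hal : ∀ l, IsAlt3 (d l) := fun l =>
    ⟨fun i j k => h4.swap₂₃ l i j k, fun i j k => h4.swap₃₄ l i j k⟩
  -- `σ` being of type `(2,2)`, its contraction with `Ψ` is identically zero
  have hzre : ∀ (y : M) w,
      contr (q := 1) (fun x v => (Psi x v).re) (sigmaForm nabla) y w = 0 := by
    intro y w
    obtain ⟨f, hf⟩ := exists_isAdapted hA.su3 y
    rw [contr_eq (q := 1) (isSmoothTensor_psi_re hA.su3) isSmoothTensor_sigmaForm f,
      sum_fin_three_fun]
    have h0 := (isAlt3_sigmaArray (nabla := nabla) f (w 0)).sum_mul_stdPsi_re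
    rw [torsionZeta_sigmaArray hA hB hf] at h0
    have : ∀ a b c, (Psi y (fun l => f (![a, b, c] l))).re *
        sigmaForm nabla y (Fin.append (fun l => f (![a, b, c] l)) w) =
        -(sigmaArray nabla f (w 0) a b c * (stdPsi a b c).re) := by
      intro a b c
      rw [e1, hf.psi, e2]
      have := hrot f (w 0) a b c
      change _ * sigma nabla y (f a) (f b) (f c) (w 0) = _
      rw [this]; ring
    simp only [this, Finset.sum_neg_distrib, h0]
    simp
  have hzim : ∀ (y : M) w,
      contr (q := 1) (fun x v => (Psi x v).im) (sigmaForm nabla) y w = 0 := by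
    intro y w
    obtain ⟨f, hf⟩ := exists_isAdapted hA.su3 y
    rw [contr_eq (q := 1) (isSmoothTensor_psi_im hA.su3) isSmoothTensor_sigmaForm f,
      sum_fin_three_fun]
    have h0 := (isAlt3_sigmaArray (nabla := nabla) f (w 0)).sum_mul_stdPsi_im
    rw [torsionZeta_sigmaArray hA hB hf] at h0
    have : ∀ a b c, (Psi y (fun l => f (![a, b, c] l))).im *
        sigmaForm nabla y (Fin.append (fun l => f (![a, b, c] l)) w) =
        -(sigmaArray nabla f (w 0) a b c * (stdPsi a b c).im) := by
      intro a b c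
      rw [e1, hf.psi, e2]
      have := hrot f (w 0) a b c
      change _ * sigma nabla y (f a) (f b) (f c) (w 0) = _
      rw [this]; ring
    simp only [this, Finset.sum_neg_distrib, h0]
    simp
  have hcov : ∀ a b c l, covDeriv nabla (sigmaForm nabla) x (Matrix.vecCons (e m)
      (Fin.append (fun l => e (![a, b, c] l)) (fun _ : Fin 1 => e l))) = (1 / 3) * d l a b c := by
    intro a b c l
    rw [e1, e2]
    refine (covDeriv_sigmaForm_basis hA.metric hA.skew hB e m a b c l).trans ?_
    rw [← htdef, ← hd, hrot']
    ring
  -- hence so is the derivative of this contraction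
  refine h4.isType22 fun l => ?_
  apply Complex.ext
  · have h1 := covDeriv_zero nabla hzre (x := x) ![e m, e l]
    rw [covDeriv_contr hA.metric (isSmoothTensor_psi_re hA.su3) isSmoothTensor_sigmaForm e,
      sum_fin_three_fun] at h1
    have h2 : ∀ a b c, covDeriv nabla (fun x v => (Psi x v).re) x (Matrix.vecCons (![e m, e l] 0)
        (fun r => e (![a, b, c] r))) * sigmaForm nabla x (Fin.append (fun r => e (![a, b, c] r))
          (fun j => ![e m, e l] j.succ)) + (Psi x (fun r => e (![a, b, c] r))).re *
        covDeriv nabla (sigmaForm nabla) x (Matrix.vecCons (![e m, e l] 0)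
          (Fin.append (fun r => e (![a, b, c] r)) (fun j => ![e m, e l] j.succ))) =
        (1 / 3) * (d l a b c * (stdPsi a b c).re) := by
      intro a b c
      rw [hA.parallel_re]
      have e3 : (fun j : Fin 1 => ![e m, e l] j.succ) = fun _ => e l := by
        ext1 j; fin_cases j; rfl
      rw [e3, Matrix.cons_val_zero, hcov, e1, he.psi]
      ring
    simp only [h2, ← Finset.mul_sum, (hal l).sum_mul_stdPsi_re] at h1
    rw [Complex.zero_re]; linarith
  · have h1 := covDeriv_zero nabla hzim (x := x) ![e m, e l]
    rw [covDeriv_contr hA.metric (isSmoothTensor_psi_im hA.su3) isSmoothTensor_sigmaForm e,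
      sum_fin_three_fun] at h1
    have h2 : ∀ a b c, covDeriv nabla (fun x v => (Psi x v).im) x (Matrix.vecCons (![e m, e l] 0)
        (fun r => e (![a, b, c] r))) * sigmaForm nabla x (Fin.append (fun r => e (![a, b, c] r))
          (fun j => ![e m, e l] j.succ)) + (Psi x (fun r => e (![a, b, c] r))).im *
        covDeriv nabla (sigmaForm nabla) x (Matrix.vecCons (![e m, e l] 0)
          (Fin.append (fun r => e (![a, b, c] r)) (fun j => ![e m, e l] j.succ))) =
        (1 / 3) * (d l a b c * (stdPsi a b c).im) := by
      intro a b c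
      rw [hA.parallel_im]
      have e3 : (fun j : Fin 1 => ![e m, e l] j.succ) = fun _ => e l := by
        ext1 j; fin_cases j; rfl
      rw [e3, Matrix.cons_val_zero, hcov, e1, he.psi]
      ring
    simp only [h2, ← Finset.mul_sum, (hal l).sum_mul_stdPsi_im] at h1
    rw [Complex.zero_im]; linarith

/-- Under the Riemannian first Bianchi identity `σ` vanishes. -/
theorem sigma_eq_zero [PreconnectedSpace M] (hA : IsACYT J Psi nabla)
    (hB : RiemannianBianchi nabla) {x : M} (u v w z : TangentSpace (𝓡 6) x) :
    sigma nabla x u v w z = 0 := by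
  obtain ⟨e, he⟩ := exists_isAdapted hA.su3 x
  refine eq_zero_of_basis_four e.toBasis (sigma nabla x) sigma_isLinear₁ sigma_isLinear₂
    sigma_isLinear₃ sigma_isLinear₄ (fun i j k l => ?_) u v w z
  have ht := isAlt3_torsionArray hA.skew e
  simp only [e.coe_toBasis]
  rw [sigma_eq_cyclicContraction]
  refine ht.cyclicContraction_eq_zero (ht.isAlt4_cyclicContraction.isType22 fun i => ?_)
    (isType22_derivContraction hA hB he) i j k l
  have h1 := torsionZeta_sigmaArray hA hB he (e i)
  have h2 : sigmaArray nabla e (e i) =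
      cyclicContraction (torsionArray nabla e) (torsionArray nabla e) i := by
    funext a b c
    exact sigma_eq_cyclicContraction e i a b c
  rwa [h2] at h1

/-- Under the Riemannian first Bianchi identity the torsion is parallel. -/
theorem isParallel_torsionForm [PreconnectedSpace M] (hA : IsACYT J Psi nabla)
    (hB : RiemannianBianchi nabla) : IsParallel nabla (torsionForm nabla) := by
  intro x w
  have h := covDeriv_torsionForm_eq hA.metric hA.skew hB (w 0) (w 1) (w 2) (w 3)
  rw [sigma_eq_zero hA hB, mul_zero] at h
  rw [← h]
  congr 1
  ext1 i; fin_cases i <;> rfl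

end

/-! ### The Ricci tensor and the first Bianchi identity -/

section

variable {M : Type*} [TopologicalSpace M] [ChartedSpace E6 M] [IsManifold (𝓡 6) ∞ M] [T2Space M]

section parallel

variable {nabla : Connection M} [hsm : CovariantDerivative.ContMDiffCovariantDerivative nabla ∞]
  {k : ℕ} {A : Tensor M k}

theorem dir_ev_of_isParallel (hA : IsSmoothTensor A) (hp : IsParallel nabla A) (U : VF M)
    (V : Fin k → VF M) :
    dir U (ev hA V) = ∑ i, ev hA (Function.update V i (nab nabla U (V i))) := by
  ext x
  rw [dir_ev nabla hA, hp x, zero_add, SF.sum_apply']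
  refine Finset.sum_congr rfl fun i _ => ?_
  rw [ev_apply, update_VF_apply]
  rfl

/-- The curvature acts trivially, as a derivation, on a parallel tensor field. -/
theorem sum_curvature_of_isParallel (hA : IsSmoothTensor A) (hp : IsParallel nabla A) {x : M}
    (u v : TangentSpace (𝓡 6) x) (w : Fin k → TangentSpace (𝓡 6) x) :
    ∑ i, A x (Function.update w i (curvature nabla x u v (w i))) = 0 := by
  set U : VF M := VF.ext u
  set V : VF M := VF.ext v
  set W : Fin k → VF M := fun i => VF.ext (w i) with hW
  have h1 := dir_lie U V (ev hA W)
  have h2 : ∀ X Y : VF M, dir X (dir Y (ev hA W)) = ∑ i, ∑ j, ev hA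
      (Function.update (Function.update W i (nab nabla Y (W i))) j
        (nab nabla X (Function.update W i (nab nabla Y (W i)) j))) := by
    intro X Y
    rw [dir_ev_of_isParallel hA hp, dir_sum]
    exact Finset.sum_congr rfl fun i _ => dir_ev_of_isParallel hA hp _ _
  rw [dir_ev_of_isParallel hA hp, h2, h2] at h1
  rw [Finset.sum_comm (f := fun i j => ev hA
      (Function.update (Function.update W i (nab nabla U (W i))) j
        (nab nabla V (Function.update W i (nab nabla U (W i)) j)))), ← Finset.sum_sub_distrib] at h1
  have h3 : ∀ i, ∑ j, ev hA (Function.update (Function.update W i (nab nabla V (W i))) j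
        (nab nabla U (Function.update W i (nab nabla V (W i)) j))) -
      ∑ j, ev hA (Function.update (Function.update W j (nab nabla U (W j))) i
        (nab nabla V (Function.update W j (nab nabla U (W j)) i))) =
      ev hA (Function.update W i (nab nabla U (nab nabla V (W i)))) -
        ev hA (Function.update W i (nab nabla V (nab nabla U (W i)))) := by
    intro i
    rw [← Finset.sum_sub_distrib, Finset.sum_eq_single i]
    · simp only [Function.update_self, Function.update_idem]
    · intro j _ hji
      rw [Function.update_of_ne hji, Function.update_of_ne hji.symm,
        Function.update_comm hji.symm, sub_self]
    · simp
  simp only [h3] at h1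
  have h4 := congrArg (fun f : SF M => f x) h1
  simp only [SF.sum_apply', ContMDiffMap.coe_sub, Pi.sub_apply, ev_apply, update_VF_apply] at h4
  obtain ⟨m, hm⟩ := hA.multilinear x
  have h5 : ∀ i, A x (Function.update w i (curvature nabla x u v (w i))) =
      A x (Function.update w i (nab nabla U (nab nabla V (W i)) x)) -
      A x (Function.update w i (nab nabla V (nab nabla U (W i)) x)) -
      A x (Function.update w i (nab nabla (lie U V) (W i) x)) := by
    intro i
    rw [curvature_eq_curv_ext]
    simp only [curv, VF.sub_apply, hm, MultilinearMap.map_update_sub]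
    rfl
  have hWx : (fun j => W j x) = w := by funext j; exact VF.ext_self _
  rw [hWx] at h4
  simp only [h5, Finset.sum_sub_distrib] at h4 ⊢
  rw [h4, sub_self]

end parallel

section metric

variable [Bundle.RiemannianBundle (fun x : M => TangentSpace (𝓡 6) x)]
  [IsContMDiffRiemannianBundle (𝓡 6) ∞ E6 (fun x : M => TangentSpace (𝓡 6) x)]
  {J : ∀ x : M, TangentSpace (𝓡 6) x →L[ℝ] TangentSpace (𝓡 6) x}
  {Psi : ∀ x : M, (Fin 3 → TangentSpace (𝓡 6) x) → ℂ} {nabla : Connection M}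
  [hsm : CovariantDerivative.ContMDiffCovariantDerivative nabla ∞]

theorem sum_fin_six_eq {β : Type*} [AddCommMonoid β] (f : Fin 6 → β) :
    ∑ i, f i = ∑ l, (f (pIdx l) + f (qIdx l)) := by
  rw [Fin.sum_univ_six, Fin.sum_univ_three]
  simp only [pIdx, qIdx, Matrix.cons_val]
  abel

/-- The curvature takes values in `su(3)`: its complex trace vanishes. -/
theorem sum_R4_pIdx_qIdx (hA : IsACYT J Psi nabla) {x : M}
    {e : OrthonormalBasis (Fin 6) ℝ (TangentSpace (𝓡 6) x)} (he : IsAdapted J Psi e)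
    (u v : TangentSpace (𝓡 6) x) : ∑ l, R4 nabla x u v (e (pIdx l)) (e (qIdx l)) = 0 := by
  have h := sum_curvature_of_isParallel (isSmoothTensor_psi_im hA.su3) hA.parallel_im u v
    ![e 0, e 2, e 4]
  obtain ⟨h1, h2, h3⟩ := psi_isLinear hA.su3 x
  have hexp : ∀ (L : TangentSpace (𝓡 6) x → ℂ), IsLinearMap ℝ L → ∀ a,
      (L a).im = ∑ c, (inner ℝ a (e c) : ℝ) * (L (e c)).im := by
    intro L hL a
    have h4 := map_sum hL.mk' (fun c => (inner ℝ (e c) a : ℝ) • e c) Finset.univ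
    rw [e.sum_repr' a] at h4
    have h5 : L a = ∑ c, (inner ℝ a (e c) : ℝ) • L (e c) := by
      refine h4.trans (Finset.sum_congr rfl fun c _ => ?_)
      rw [map_smul, real_inner_comm]
      rfl
    rw [h5, Complex.im_sum]
    simp
  have s0 : ∀ a, (Psi x ![a, e 2, e 4]).im = -inner ℝ a (e 1) := by
    intro a
    rw [hexp _ (h1 (e 2) (e 4)) a]
    simp only [he.psi]
    simp [Fin.sum_univ_six, stdPsi, Matrix.det_fin_three, unitaryCoframe, pIdx, qIdx]
  have s1 : ∀ a, (Psi x ![e 0, a, e 4]).im = -inner ℝ a (e 3) := by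
    intro a
    rw [hexp _ (h2 (e 0) (e 4)) a]
    simp only [he.psi]
    simp [Fin.sum_univ_six, stdPsi, Matrix.det_fin_three, unitaryCoframe, pIdx, qIdx]
  have s2 : ∀ a, (Psi x ![e 0, e 2, a]).im = -inner ℝ a (e 5) := by
    intro a
    rw [hexp _ (h3 (e 0) (e 2)) a]
    simp only [he.psi]
    simp [Fin.sum_univ_six, stdPsi, Matrix.det_fin_three, unitaryCoframe, pIdx, qIdx]
  have u0 : ∀ a, Function.update ![e 0, e 2, e 4] 0 a = ![a, e 2, e 4] := fun a => by
    ext1 i; fin_cases i <;> rfl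
  have u1 : ∀ a, Function.update ![e 0, e 2, e 4] 1 a = ![e 0, a, e 4] := fun a => by
    ext1 i; fin_cases i <;> rfl
  have u2 : ∀ a, Function.update ![e 0, e 2, e 4] 2 a = ![e 0, e 2, a] := fun a => by
    ext1 i; fin_cases i <;> rfl
  rw [Fin.sum_univ_three, u0, u1, u2, s0, s1, s2] at h
  rw [Fin.sum_univ_three]
  unfold R4
  simp only [pIdx, qIdx, Matrix.cons_val] at h ⊢
  linarith

/-- The Ricci tensor may be computed in any orthonormal basis. -/
theorem ricci_eq (x : M) (e : OrthonormalBasis (Fin 6) ℝ (TangentSpace (𝓡 6) x))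
    (v w : TangentSpace (𝓡 6) x) :
    ricci nabla x v w = ∑ i, R4 nabla x (e i) v w (e i) := by
  have h : ∀ f : OrthonormalBasis (Fin 6) ℝ (TangentSpace (𝓡 6) x),
      ∑ i, R4 nabla x (f i) v w (f i) =
        LinearMap.trace ℝ _ (curvature_isLinear₁ (nabla := nabla) v w).mk' := by
    intro f
    rw [LinearMap.trace_eq_sum_inner _ f]
    exact Finset.sum_congr rfl fun i _ => real_inner_comm _ _
  rw [h e, ← h (frame x)]
  rfl

variable (hA : IsACYT J Psi nabla)
include hA

theorem R4_J_right {x : M} (u v w z : TangentSpace (𝓡 6) x) :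
    R4 nabla x u v w (J x z) = -R4 nabla x u v (J x w) z := by
  unfold R4
  rw [curvature_app hA.su3.smooth_J hA.parallel_J, inner_J_left hA.su3, neg_neg]

theorem R4_J_J {x : M} (u v w z : TangentSpace (𝓡 6) x) :
    R4 nabla x u v (J x w) (J x z) = R4 nabla x u v w z := by
  unfold R4
  rw [curvature_app hA.su3.smooth_J hA.parallel_J, hA.su3.J_orthogonal]

omit hA

/-- The cyclic sum of the curvature over its first three arguments. -/
def cyclicR4 (nabla : Connection M) {x : M} (u v w z : TangentSpace (𝓡 6) x) : ℝ :=
  R4 nabla x u v w z + R4 nabla x v w u z + R4 nabla x w u v z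

/-- For a pair symmetric curvature tensor, the cyclic sum is totally skew-symmetric. -/
theorem isAlt4_cyclicR4 (hm : nabla.IsMetricCompatible) (hS : IsPairSymmetric nabla) {x : M}
    (f : Fin 6 → TangentSpace (𝓡 6) x) :
    IsAlt4 (fun i j k l => cyclicR4 nabla (f i) (f j) (f k) (f l)) where
  swap₁₂ i j k l := by
    unfold cyclicR4
    rw [R4_swap_left (f i) (f j), R4_swap_left (f j) (f k), R4_swap_left (f k) (f i)]
    ring
  swap₂₃ i j k l := by
    unfold cyclicR4
    rw [R4_swap_left (f i) (f j), R4_swap_left (f j) (f k), R4_swap_left (f k) (f i)]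
    ring
  swap₃₄ i j k l := by
    unfold cyclicR4
    rw [R4_swap_right hm (f i), hS x (f j) (f l) (f i), R4_swap_left (f i) (f k) (f j),
      hS x (f l) (f i) (f j), R4_swap_right hm (f j) (f k)]
    ring

include hA

/-- The contraction of the cyclic sum of the curvature with the Kähler form. -/
theorem sum_cyclicR4 (hS : IsPairSymmetric nabla) {x : M}
    {e : OrthonormalBasis (Fin 6) ℝ (TangentSpace (𝓡 6) x)} (he : IsAdapted J Psi e)
    (u v : TangentSpace (𝓡 6) x) :
    2 * ∑ l, cyclicR4 nabla u v (e (pIdx l)) (e (qIdx l)) =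
      ricci nabla x v (J x u) - ricci nabla x u (J x v) := by
  rw [ricci_eq x e, ricci_eq x e, ← Finset.sum_sub_distrib]
  have h1 : ∀ i, R4 nabla x (e i) v (J x u) (e i) - R4 nabla x (e i) u (J x v) (e i) =
      R4 nabla x v (e i) u (J x (e i)) + R4 nabla x (e i) u v (J x (e i)) := by
    intro i
    rw [R4_swap_left v, R4_J_right hA, R4_J_right hA]; ring
  simp only [h1]
  rw [sum_fin_six_eq]
  simp only [he.J_pIdx, he.J_qIdx]
  have h0 := sum_R4_pIdx_qIdx hA he u v
  have hneg : ∀ a b c d : TangentSpace (𝓡 6) x, R4 nabla x a b c (-d) = -R4 nabla x a b c d :=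
    fun a b c d => (R4_isLinear₄ (nabla := nabla) a b c).map_neg d
  have h2 : ∀ l, (R4 nabla x v (e (pIdx l)) u (e (qIdx l)) +
        R4 nabla x (e (pIdx l)) u v (e (qIdx l)) +
      (R4 nabla x v (e (qIdx l)) u (-e (pIdx l)) + R4 nabla x (e (qIdx l)) u v (-e (pIdx l)))) =
      2 * cyclicR4 nabla u v (e (pIdx l)) (e (qIdx l)) -
        2 * R4 nabla x u v (e (pIdx l)) (e (qIdx l)) := by
    intro l
    unfold cyclicR4
    rw [hneg, hneg, hS x v (e (qIdx l)), hS x (e (qIdx l)) u, R4_swap_left u (e (pIdx l)),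
      R4_swap_right hA.metric v (e (pIdx l)) (e (qIdx l)) u]
    ring
  simp only [h2, Finset.sum_sub_distrib, ← Finset.mul_sum, h0]
  ring

/-- For a pair symmetric, Ricci flat torsion connection the first Bianchi identity holds: the cyclic
sum of the curvature is a `4`-form whose contraction with the Kähler form is given by the Ricci
tensor, and on a six-dimensional space this contraction is injective on `4`-forms. -/
theorem riemannianBianchi_of_ricci (hS : IsPairSymmetric nabla) (hR : IsRicciFlat nabla) :
    RiemannianBianchi nabla := by
  intro x u v w z
  obtain ⟨e, he⟩ := exists_isAdapted hA.su3 x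
  have hlin := eq_zero_of_basis_four e.toBasis (fun u v w z => cyclicR4 nabla u v w z)
    (fun v w z => ?_) (fun u w z => ?_) (fun u v z => ?_) (fun u v w => ?_) (fun i j k l => ?_)
    u v w z
  · exact hlin
  · unfold cyclicR4
    exact ⟨fun a b => by
        rw [(R4_isLinear₁ v w z).map_add, (R4_isLinear₃ v w z).map_add,
          (R4_isLinear₂ w v z).map_add]; ring,
      fun c a => by
        rw [(R4_isLinear₁ v w z).map_smul, (R4_isLinear₃ v w z).map_smul,
          (R4_isLinear₂ w v z).map_smul]; simp only [smul_eq_mul]; ring⟩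
  · unfold cyclicR4
    exact ⟨fun a b => by
        rw [(R4_isLinear₂ u w z).map_add, (R4_isLinear₁ w u z).map_add,
          (R4_isLinear₃ w u z).map_add]; ring,
      fun c a => by
        rw [(R4_isLinear₂ u w z).map_smul, (R4_isLinear₁ w u z).map_smul,
          (R4_isLinear₃ w u z).map_smul]; simp only [smul_eq_mul]; ring⟩
  · unfold cyclicR4
    exact ⟨fun a b => by
        rw [(R4_isLinear₃ u v z).map_add, (R4_isLinear₂ v u z).map_add,
          (R4_isLinear₁ u v z).map_add]; ring,
      fun c a => by
        rw [(R4_isLinear₃ u v z).map_smul, (R4_isLinear₂ v u z).map_smul,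
          (R4_isLinear₁ u v z).map_smul]; simp only [smul_eq_mul]; ring⟩
  · unfold cyclicR4
    exact ⟨fun a b => by
        rw [(R4_isLinear₄ u v w).map_add, (R4_isLinear₄ v w u).map_add,
          (R4_isLinear₄ w u v).map_add]; ring,
      fun c a => by
        rw [(R4_isLinear₄ u v w).map_smul, (R4_isLinear₄ v w u).map_smul,
          (R4_isLinear₄ w u v).map_smul]; simp only [smul_eq_mul]; ring⟩
  · simp only [e.coe_toBasis]
    refine (isAlt4_cyclicR4 hA.metric hS e).eq_zero_of_contraction (fun a b => ?_) i j k l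
    have h := sum_cyclicR4 hA hS he (e a) (e b)
    rw [hR, hR, Fin.sum_univ_three] at h
    simp only [pIdx, qIdx, Matrix.cons_val] at h
    linarith

omit hA in
theorem isPairSymmetric_of_riemannianBianchi (hm : nabla.IsMetricCompatible)
    (hB : RiemannianBianchi nabla) : IsPairSymmetric nabla := by
  intro x u v w z
  have l := fun a b c d : TangentSpace (𝓡 6) x => R4_swap_left (nabla := nabla) a b c d
  have r := fun a b c d : TangentSpace (𝓡 6) x => R4_swap_right hm a b c d
  have b1 := hB x u v w z
  have b2 := hB x v w z u
  have b3 := hB x w z u v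
  have b4 := hB x z u v w
  linarith [l u v w z, l v w u z, l w u v z, r u v w z, r v w u z, r w u v z, l v w z u,
    l w z v u, l z v w u, r w z v u, r z v w u, l w z u v, l z u w v, l u w z v, r z u w v,
    r u w z v, l z u v w, l u v z w, l v z u w, r u v z w, r v z u w, r w z u v, r z u v w]

/-- Under the first Bianchi identity the Ricci tensor is symmetric and `J`-invariant, and
`sum_cyclicR4` shows that `Ric(u, v) = -Ric(v, u)`. -/
theorem isRicciFlat_of_riemannianBianchi (hB : RiemannianBianchi nabla) : IsRicciFlat nabla := by
  have hS := isPairSymmetric_of_riemannianBianchi hA.metric hB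
  have hsymm : ∀ (x : M) v w, ricci nabla x v w = ricci nabla x w v := by
    intro x v w
    unfold ricci
    refine Finset.sum_congr rfl fun i _ => ?_
    rw [hS x, R4_swap_left w, R4_swap_right hA.metric (frame x i) w, neg_neg]
  have hJ : ∀ (x : M) v w, ricci nabla x (J x v) (J x w) = ricci nabla x v w := by
    intro x v w
    obtain ⟨e, he⟩ := exists_isAdapted hA.su3 x
    have hneg : ∀ a b d : TangentSpace (𝓡 6) x, R4 nabla x (-d) a b (-d) = R4 nabla x d a b d :=
      fun a b d => by
        rw [(R4_isLinear₁ (nabla := nabla) a b _).map_neg,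
          (R4_isLinear₄ (nabla := nabla) _ a b).map_neg, neg_neg]
    have hinv : ∀ a, R4 nabla x (J x a) (J x v) (J x w) (J x a) = R4 nabla x a v w a := by
      intro a
      rw [R4_J_J hA, hS x, R4_J_J hA, hS x]
    rw [ricci_eq x e, ricci_eq x e, sum_fin_six_eq, sum_fin_six_eq]
    refine Finset.sum_congr rfl fun l _ => ?_
    rw [← hinv (e (pIdx l)), ← hinv (e (qIdx l)), he.J_pIdx, he.J_qIdx, hneg, add_comm]
  intro x u v
  obtain ⟨e, he⟩ := exists_isAdapted hA.su3 x
  have h1 := sum_cyclicR4 hA hS he (J x u) v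
  have h2 : ∀ a b c d : TangentSpace (𝓡 6) x, cyclicR4 nabla a b c d = 0 := fun a b c d =>
    hB x a b c d
  simp only [h2, Finset.sum_const_zero, mul_zero, hA.su3.J_sq, hJ] at h1
  have h3 : ricci nabla x v (-u) = -ricci nabla x v u := by
    unfold ricci
    rw [← Finset.sum_neg_distrib]
    exact Finset.sum_congr rfl fun i _ => (R4_isLinear₃ (nabla := nabla) _ _ _).map_neg u
  rw [h3, hsymm x v u] at h1
  linarith

end metric

end

/-! ### The Nijenhuis tensor and the differential of the Kähler form -/

section

variable {M : Type*} [TopologicalSpace M] [ChartedSpace E6 M] [IsManifold (𝓡 6) ∞ M] [T2Space M]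
  [Bundle.RiemannianBundle (fun x : M => TangentSpace (𝓡 6) x)]
  [IsContMDiffRiemannianBundle (𝓡 6) ∞ E6 (fun x : M => TangentSpace (𝓡 6) x)]
  {J : ∀ x : M, TangentSpace (𝓡 6) x →L[ℝ] TangentSpace (𝓡 6) x}
  {Psi : ∀ x : M, (Fin 3 → TangentSpace (𝓡 6) x) → ℂ} {nabla : Connection M}

theorem eq_of_isParallel_zero [PreconnectedSpace M] {A : Tensor M 0} (hA : IsSmoothTensor A)
    (hp : IsParallel nabla A) (x y : M) : A x ![] = A y ![] := by
  have h0 : ∀ z, ev hA ![] z = A z ![] := fun z => congrArg (A z) (Subsingleton.elim _ _)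
  rw [← h0, ← h0]
  refine SF.eq_of_mvfderiv_eq_zero _ (fun z u => ?_) x y
  have h1 : ⇑(ev hA ![]) = fun z => A z ![] := funext h0
  rw [h1, ← covDeriv_zero_tensor (nabla := nabla), hp]

variable [hsm : CovariantDerivative.ContMDiffCovariantDerivative nabla ∞]

/-- Linear combinations of a parallel tensor field composed with parallel endomorphisms are
parallel. -/
theorem isParallel_sum_comp_end {k n : ℕ} {A : Tensor M k} (hA : IsSmoothTensor A)
    (hp : IsParallel nabla A) (c : Fin n → ℝ)
    {K : Fin n → Fin k → ∀ x : M, TangentSpace (𝓡 6) x →L[ℝ] TangentSpace (𝓡 6) x}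
    (hK : ∀ j i, IsParallelEnd nabla (K j i)) :
    IsSmoothTensor (fun x v => ∑ j, c j * A x (fun i => K j i x (v i)) : Tensor M k) ∧
      IsParallel nabla (fun x v => ∑ j, c j * A x (fun i => K j i x (v i)) : Tensor M k) := by
  have h1 := fun j => hA.comp_end (hK j)
  refine ⟨IsSmoothTensor.sum _ c h1, fun x w => ?_⟩
  rw [covDeriv_sum nabla _ c h1]
  refine Finset.sum_eq_zero fun j _ => ?_
  rw [covDeriv_comp_end hA (hK j), hp, mul_zero]

theorem isParallelEnd_J (hA : IsACYT J Psi nabla) : IsParallelEnd nabla J :=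
  ⟨app (isSmoothEnd_J hA.su3), fun _ _ => rfl, fun U V =>
    nab_app (isSmoothEnd_J hA.su3) hA.parallel_J U V⟩

/-- If the torsion is parallel, so is the Nijenhuis tensor
`N(u, v, w) = T(u, v, w) - T(Ju, Jv, w) - T(Ju, v, Jw) - T(u, Jv, Jw)`. -/
theorem nijenhuisForm_parallel (hA : IsACYT J Psi nabla)
    (hp : IsParallel nabla (torsionForm nabla)) :
    IsSmoothTensor (nijenhuisForm J) ∧ IsParallel nabla (nijenhuisForm J) := by
  have hJ := isParallelEnd_J hA
  have hI := isParallelEnd_id (nabla := nabla)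
  let K : Fin 4 → Fin 3 → ∀ x : M, TangentSpace (𝓡 6) x →L[ℝ] TangentSpace (𝓡 6) x :=
    ![![fun _ => ContinuousLinearMap.id ℝ _, fun _ => ContinuousLinearMap.id ℝ _,
        fun _ => ContinuousLinearMap.id ℝ _],
      ![J, J, fun _ => ContinuousLinearMap.id ℝ _], ![J, fun _ => ContinuousLinearMap.id ℝ _, J],
      ![fun _ => ContinuousLinearMap.id ℝ _, J, J]]
  have h := isParallel_sum_comp_end isSmoothTensor_torsionForm hp ![1, -1, -1, -1] (K := K)
    (by intro j i; fin_cases j <;> fin_cases i <;> first | exact hJ | exact hI)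
  have he : nijenhuisForm J = fun x v => ∑ j, (![1, -1, -1, -1] : Fin 4 → ℝ) j *
      torsionForm nabla x (fun i => K j i x (v i)) := by
    funext x v
    refine Eq.trans ?_ (Fin.sum_univ_four _).symm
    change inner ℝ (nijenhuis J x (v 0) (v 1)) (v 2) =
      1 * inner ℝ (nabla.torsion x (v 0) (v 1)) (v 2) +
      -1 * inner ℝ (nabla.torsion x (J x (v 0)) (J x (v 1))) (v 2) +
      -1 * inner ℝ (nabla.torsion x (J x (v 0)) (v 1)) (J x (v 2)) +
      -1 * inner ℝ (nabla.torsion x (v 0) (J x (v 1))) (J x (v 2))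
    rw [nijenhuis_eq_torsion (isSmoothEnd_J hA.su3) hA.parallel_J hA.su3.J_sq]
    simp only [inner_add_left, inner_sub_left, inner_J_left hA.su3]
    ring
  rw [he]
  exact h

theorem normSq_eq_of_isParallel [PreconnectedSpace M] (hm : nabla.IsMetricCompatible) {k : ℕ}
    {A : Tensor M k} (hA : IsSmoothTensor A) (hp : IsParallel nabla A) (x y : M) :
    normSq A x = normSq A y := by
  have h0 : ∀ z, normSq A z = contr (q := 0) A A z ![] := by
    intro z
    unfold normSq contr
    refine Finset.sum_congr rfl fun i _ => ?_
    have : (Fin.append (fun l => frame z (i l)) ![] : Fin k → TangentSpace (𝓡 6) z) =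
        fun l => frame z (i l) := by
      ext1 l
      exact Fin.append_left _ _ l
    rw [sq, this]
  rw [h0, h0]
  refine eq_of_isParallel_zero (IsSmoothTensor.contr (q := 0) hA hA) (nabla := nabla)
    (fun z w => ?_) x y
  rw [covDeriv_contr (q := 0) hm hA hA (frame z)]
  refine Finset.sum_eq_zero fun i _ => ?_
  rw [hp, hp, zero_mul, mul_zero, add_zero]

section kaehler

theorem isSmoothTensor_kaehlerForm (h : IsSU3Structure J Psi) :
    IsSmoothTensor (kaehlerForm J) where
  multilinear x := by
    refine ⟨⟨fun v => inner ℝ (v 0) (J x (v 1)), ?_, ?_⟩, fun v => rfl⟩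
    · intro inst v i a b
      obtain rfl : inst = fun a b => instDecidableEqFin 2 a b := Subsingleton.elim _ _
      fin_cases i
      · exact inner_add_left a b _
      · change inner ℝ (v 0) (J x (a + b)) = _
        rw [map_add, inner_add_right]; rfl
    · intro inst v i c a
      obtain rfl : inst = fun a b => instDecidableEqFin 2 a b := Subsingleton.elim _ _
      fin_cases i
      · exact inner_smul_left a _ c
      · change inner ℝ (v 0) (J x (c • a)) = _
        rw [map_smul, inner_smul_right]; rfl
  smooth V := (ip (V 0) (app (isSmoothEnd_J h) (V 1))).contMDiff

theorem isParallel_kaehlerForm (hA : IsACYT J Psi nabla) : IsParallel nabla (kaehlerForm J) := by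
  intro x w
  rw [covDeriv_eq_ext nabla (isSmoothTensor_kaehlerForm hA.su3)]
  unfold covDerivField
  have h := congrArg (fun f : SF M => f x) (dir_ip hA.metric (VF.ext (w 0)) (VF.ext (w 1))
    (app (isSmoothEnd_J hA.su3) (VF.ext (w 2))))
  rw [nab_app (isSmoothEnd_J hA.su3) hA.parallel_J] at h
  simp only [dir_apply, ContMDiffMap.coe_add, Pi.add_apply, ip_apply, app_apply, nab_apply,
    VF.ext_self] at h
  rw [Fin.sum_univ_two, sub_eq_zero]
  refine Eq.trans ?_ (h.trans ?_)
  · rfl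
  · simp [kaehlerForm]

omit hsm in
theorem mlieBracket_field_eq {x : M} (u v : TangentSpace (𝓡 6) x) :
    VectorField.mlieBracket (𝓡 6) (field u) (field v) x =
      nabla (field v) x u - nabla (field u) x v - nabla.torsion x u v := by
  have h := nabla.torsion_apply (field_mdiffAt u) (field_mdiffAt v)
  simp only [field_self] at h
  rw [h]
  abel

theorem dForm_two_eq (A : Tensor M 2) (x : M) (v : Fin 3 → TangentSpace (𝓡 6) x) :
    dForm A x v =
      mvfderiv (𝓡 6) (fun y => A y ![field (v 1) y, field (v 2) y]) x (v 0)
      - mvfderiv (𝓡 6) (fun y => A y ![field (v 0) y, field (v 2) y]) x (v 1)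
      + mvfderiv (𝓡 6) (fun y => A y ![field (v 0) y, field (v 1) y]) x (v 2)
      - (A x ![VectorField.mlieBracket (𝓡 6) (field (v 0)) (field (v 1)) x, v 2]
        - A x ![VectorField.mlieBracket (𝓡 6) (field (v 0)) (field (v 2)) x, v 1]
        + A x ![VectorField.mlieBracket (𝓡 6) (field (v 1)) (field (v 2)) x, v 0]) := by
  have h0 : ∀ {y : M} (w : Fin 3 → TangentSpace (𝓡 6) y), (0 : Fin 3).removeNth w =
    ![w 1, w 2] := by
    intro y w; ext1 i; fin_cases i <;> rfl
  have h1 : ∀ {y : M} (w : Fin 3 → TangentSpace (𝓡 6) y), (1 : Fin 3).removeNth w =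
    ![w 0, w 2] := by
    intro y w; ext1 i; fin_cases i <;> rfl
  have h2 : ∀ {y : M} (w : Fin 3 → TangentSpace (𝓡 6) y), (2 : Fin 3).removeNth w =
    ![w 0, w 1] := by
    intro y w; ext1 i; fin_cases i <;> rfl
  have g0 : ∀ {y : M} (w : Fin 2 → TangentSpace (𝓡 6) y), (0 : Fin 2).removeNth w = ![w 1] := by
    intro y w; ext1 i; fin_cases i; rfl
  have g1 : ∀ {y : M} (w : Fin 2 → TangentSpace (𝓡 6) y), (1 : Fin 2).removeNth w = ![w 0] := by
    intro y w; ext1 i; fin_cases i; rfl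
  unfold dForm
  refine (congrArg₂ (· - ·) (Fin.sum_univ_three _) ((Fin.sum_univ_two _).trans
    (congrArg₂ (· + ·) (Fin.sum_univ_two _) (Fin.sum_univ_two _)))).trans ?_
  have i0 : (0 : Fin 2).castSucc = (0 : Fin 3) := rfl
  have i1 : (1 : Fin 2).castSucc = (1 : Fin 3) := rfl
  have j0 : (0 : Fin 2).succ = (1 : Fin 3) := rfl
  have j1 : (1 : Fin 2).succ = (2 : Fin 3) := rfl
  simp only [i0, i1, j0, j1, h0, h1, h2, g0, g1, Matrix.cons_val_zero, Matrix.cons_val_one,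
    le_refl, if_true, Fin.zero_le, if_neg (show ¬ (1 : Fin 2) ≤ 0 by decide)]
  simp
  ring

theorem dForm_three_eq (A : Tensor M 3) (x : M) (v : Fin 4 → TangentSpace (𝓡 6) x) :
    dForm A x v =
      mvfderiv (𝓡 6) (fun y => A y ![field (v 1) y, field (v 2) y, field (v 3) y]) x (v 0)
      - mvfderiv (𝓡 6) (fun y => A y ![field (v 0) y, field (v 2) y, field (v 3) y]) x (v 1)
      + mvfderiv (𝓡 6) (fun y => A y ![field (v 0) y, field (v 1) y, field (v 3) y]) x (v 2)
      - mvfderiv (𝓡 6) (fun y => A y ![field (v 0) y, field (v 1) y, field (v 2) y]) x (v 3)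
      - (A x ![VectorField.mlieBracket (𝓡 6) (field (v 0)) (field (v 1)) x, v 2, v 3]
        - A x ![VectorField.mlieBracket (𝓡 6) (field (v 0)) (field (v 2)) x, v 1, v 3]
        + A x ![VectorField.mlieBracket (𝓡 6) (field (v 0)) (field (v 3)) x, v 1, v 2]
        + A x ![VectorField.mlieBracket (𝓡 6) (field (v 1)) (field (v 2)) x, v 0, v 3]
        - A x ![VectorField.mlieBracket (𝓡 6) (field (v 1)) (field (v 3)) x, v 0, v 2]
        + A x ![VectorField.mlieBracket (𝓡 6) (field (v 2)) (field (v 3)) x, v 0, v 1]) := by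
  have h0 : ∀ {y : M} (w : Fin 4 → TangentSpace (𝓡 6) y),
      (0 : Fin 4).removeNth w = ![w 1, w 2, w 3] := by
    intro y w; ext1 i; fin_cases i <;> rfl
  have h1 : ∀ {y : M} (w : Fin 4 → TangentSpace (𝓡 6) y),
      (1 : Fin 4).removeNth w = ![w 0, w 2, w 3] := by
    intro y w; ext1 i; fin_cases i <;> rfl
  have h2 : ∀ {y : M} (w : Fin 4 → TangentSpace (𝓡 6) y),
      (2 : Fin 4).removeNth w = ![w 0, w 1, w 3] := by
    intro y w; ext1 i; fin_cases i <;> rfl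
  have h3 : ∀ {y : M} (w : Fin 4 → TangentSpace (𝓡 6) y),
      (3 : Fin 4).removeNth w = ![w 0, w 1, w 2] := by
    intro y w; ext1 i; fin_cases i <;> rfl
  have g0 : ∀ {y : M} (w : Fin 3 → TangentSpace (𝓡 6) y), (0 : Fin 3).removeNth w =
    ![w 1, w 2] := by
    intro y w; ext1 i; fin_cases i <;> rfl
  have g1 : ∀ {y : M} (w : Fin 3 → TangentSpace (𝓡 6) y), (1 : Fin 3).removeNth w =
    ![w 0, w 2] := by
    intro y w; ext1 i; fin_cases i <;> rfl
  have g2 : ∀ {y : M} (w : Fin 3 → TangentSpace (𝓡 6) y), (2 : Fin 3).removeNth w =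
    ![w 0, w 1] := by
    intro y w; ext1 i; fin_cases i <;> rfl
  unfold dForm
  refine (congrArg₂ (· - ·) (Fin.sum_univ_four _) ((Fin.sum_univ_three _).trans
    (congrArg₂ (· + ·) (congrArg₂ (· + ·) (Fin.sum_univ_three _) (Fin.sum_univ_three _))
      (Fin.sum_univ_three _)))).trans ?_
  have i0 : (0 : Fin 3).castSucc = (0 : Fin 4) := rfl
  have i1 : (1 : Fin 3).castSucc = (1 : Fin 4) := rfl
  have i2 : (2 : Fin 3).castSucc = (2 : Fin 4) := rfl
  have j0 : (0 : Fin 3).succ = (1 : Fin 4) := rfl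
  have j1 : (1 : Fin 3).succ = (2 : Fin 4) := rfl
  have j2 : (2 : Fin 3).succ = (3 : Fin 4) := rfl
  simp only [i0, i1, i2, j0, j1, j2, h0, h1, h2, h3, g0, g1, g2, Matrix.cons_val,
    le_refl, if_true, Fin.zero_le, if_neg (show ¬ (1 : Fin 3) ≤ 0 by decide),
    if_neg (show ¬ (2 : Fin 3) ≤ 0 by decide), if_neg (show ¬ (2 : Fin 3) ≤ 1 by decide),
    if_pos (show (1 : Fin 3) ≤ 2 by decide)]
  simp
  ring

/-- The exterior derivative of a parallel `2`-form, for a connection with torsion. -/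
theorem dForm_two_of_isParallel {A : Tensor M 2} (hA : IsSmoothTensor A) (hp : IsParallel nabla A)
    (hs : ∀ (x : M) (u v : TangentSpace (𝓡 6) x), A x ![u, v] = -A x ![v, u]) {x : M}
    (v : Fin 3 → TangentSpace (𝓡 6) x) :
    dForm A x v = A x ![nabla.torsion x (v 0) (v 1), v 2]
      + A x ![nabla.torsion x (v 2) (v 0), v 1] + A x ![nabla.torsion x (v 1) (v 2), v 0] := by
  have hsub : ∀ a b c : TangentSpace (𝓡 6) x, A x ![a - b, c] = A x ![a, c] - A x ![b, c] := by
    intro a b c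
    obtain ⟨m, hm⟩ := hA.multilinear x
    have := m.map_update_sub ![a, c] 0 a b
    have e : ∀ z, Function.update ![a, c] 0 z = ![z, c] := fun z => by
      ext1 i; fin_cases i <;> rfl
    simp only [e] at this
    rw [hm, hm, hm, this]
  have key : ∀ a b c : TangentSpace (𝓡 6) x,
      mvfderiv (𝓡 6) (fun y => A y ![field b y, field c y]) x a =
        A x ![nabla (field b) x a, c] + A x ![b, nabla (field c) x a] := by
    intro a b c
    have h := hp x ![a, b, c]
    unfold covDeriv at h
    rw [Fin.sum_univ_two, sub_eq_zero] at h
    have e1 : (fun y => A y (fun i => field (![a, b, c] i.succ) y)) =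
        fun y => A y ![field b y, field c y] := by
      funext y; congr 1; ext1 i; fin_cases i <;> rfl
    have e2 : Function.update (fun j : Fin 2 => ![a, b, c] j.succ) 0
        (nabla (field (![a, b, c] (Fin.succ 0))) x (![a, b, c] 0)) = ![nabla (field b) x a, c] := by
      ext1 i; fin_cases i <;> rfl
    have e3 : Function.update (fun j : Fin 2 => ![a, b, c] j.succ) 1
        (nabla (field (![a, b, c] (Fin.succ 1))) x (![a, b, c] 0)) = ![b, nabla (field c) x a] := by
      ext1 i; fin_cases i <;> rfl
    rw [e1, e2, e3] at h
    exact h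
  rw [dForm_two_eq, key, key, key]
  simp only [mlieBracket_field_eq (nabla := nabla), hsub]
  rw [hs x (v 1) (nabla (field (v 2)) x (v 0)), hs x (v 0) (nabla (field (v 2)) x (v 1)),
    hs x (v 0) (nabla (field (v 1)) x (v 2)), nabla.torsion_antisymm (v 2) (v 0)]
  have hn : ∀ a c : TangentSpace (𝓡 6) x, A x ![-a, c] = -A x ![a, c] := by
    intro a c
    have := hsub 0 a c
    have h0 := hsub 0 0 c
    rw [sub_self, sub_self] at h0
    rw [h0, zero_sub, zero_sub] at this
    exact this
  rw [hn]
  ring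

/-- If the torsion is parallel, so is `dF(u, v, w) = T(u, v, Jw) + T(u, Jv, w) + T(Ju, v, w)`. -/
theorem isParallel_dForm_kaehlerForm (hA : IsACYT J Psi nabla)
    (hp : IsParallel nabla (torsionForm nabla)) : IsParallel nabla (dForm (kaehlerForm J)) := by
  have hJ := isParallelEnd_J hA
  have hI := isParallelEnd_id (nabla := nabla)
  let K : Fin 3 → Fin 3 → ∀ x : M, TangentSpace (𝓡 6) x →L[ℝ] TangentSpace (𝓡 6) x :=
    ![![fun _ => ContinuousLinearMap.id ℝ _, fun _ => ContinuousLinearMap.id ℝ _, J],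
      ![fun _ => ContinuousLinearMap.id ℝ _, J, fun _ => ContinuousLinearMap.id ℝ _],
      ![J, fun _ => ContinuousLinearMap.id ℝ _, fun _ => ContinuousLinearMap.id ℝ _]]
  have h := (isParallel_sum_comp_end isSmoothTensor_torsionForm hp (fun _ : Fin 3 => 1) (K := K)
    (by intro j i; fin_cases j <;> fin_cases i <;> first | exact hJ | exact hI)).2
  have he : dForm (kaehlerForm J) = fun x v => ∑ j, (fun _ : Fin 3 => (1 : ℝ)) j *
      torsionForm nabla x (fun i => K j i x (v i)) := by
    funext x v
    refine Eq.trans ?_ (Fin.sum_univ_three _).symm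
    change _ = 1 * inner ℝ (nabla.torsion x (v 0) (v 1)) (J x (v 2)) +
      1 * inner ℝ (nabla.torsion x (v 0) (J x (v 1))) (v 2) +
      1 * inner ℝ (nabla.torsion x (J x (v 0)) (v 1)) (v 2)
    rw [dForm_two_of_isParallel (isSmoothTensor_kaehlerForm hA.su3) (isParallel_kaehlerForm hA)
      (fun y a b => by
        change inner ℝ a (J y b) = -inner ℝ b (J y a)
        rw [real_inner_comm, inner_J_left hA.su3])]
    change inner ℝ (nabla.torsion x (v 0) (v 1)) (J x (v 2)) +
      inner ℝ (nabla.torsion x (v 2) (v 0)) (J x (v 1)) +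
      inner ℝ (nabla.torsion x (v 1) (v 2)) (J x (v 0)) = _
    rw [inner_torsion_rotate hA.skew (v 2) (v 0), inner_torsion_rotate hA.skew (J x (v 0)) (v 1)]
    ring
  rw [he]
  exact h

end kaehler

end

/-! ### The Hodge star and harmonic torsion -/

section

section algebra

/-- A skew-symmetric endomorphism, being trace free, acts trivially on alternating forms of top
degree. -/
theorem AlternatingMap.sum_update_skew {E : Type*} [NormedAddCommGroup E] [InnerProductSpace ℝ E]
    (f : E [⋀^Fin 6]→ₗ[ℝ] ℝ) (e : OrthonormalBasis (Fin 6) ℝ E) (S : E →ₗ[ℝ] E)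
    (hS : ∀ a, inner ℝ a (S a) = (0 : ℝ)) (v : Fin 6 → E) :
    ∑ l, f (Function.update v l (S (v l))) = 0 := by
  let g : Fin 6 → Fin 6 → E →ₗ[ℝ] E := fun l => Function.update (fun _ => LinearMap.id) l S
  have hg : ∀ l (w : Fin 6 → E), (fun i => g l i (w i)) = Function.update w l (S (w l)) := by
    intro l w
    ext1 i
    by_cases h : i = l
    · subst h; simp [g]
    · simp [g, h]
  have hm : (∑ l, f.toMultilinearMap.compLinearMap (g l)) = 0 := by
    refine Module.Basis.ext_multilinear (fun _ => e.toBasis) fun i => ?_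
    simp only [sum_apply, zero_apply, MultilinearMap.compLinearMap_apply,
      e.coe_toBasis]
    have hi : ∀ l, (fun j => g l j (e (i j))) =
        Function.update (fun j => e (i j)) l (S (e (i l))) := fun l => hg l (fun j => e (i j))
    simp only [hi]
    by_cases hinj : Function.Injective i
    · have hsurj := Finite.injective_iff_surjective.1 hinj
      refine Finset.sum_eq_zero fun l _ => ?_
      rw [← e.sum_repr' (S (e (i l)))]
      refine (f.toMultilinearMap.map_update_sum _ l _ _).trans (Finset.sum_eq_zero fun c _ => ?_)
      rw [MultilinearMap.map_update_smul]
      obtain ⟨m, rfl⟩ := hsurj c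
      by_cases hml : m = l
      · subst hml
        rw [hS, zero_smul]
      · have : f (Function.update (fun j => e (i j)) l (e (i m))) = 0 :=
          f.map_eq_zero_of_eq _ (by rw [Function.update_self, Function.update_of_ne hml])
            (Ne.symm hml)
        exact (congrArg _ this).trans (smul_zero _)
    · obtain ⟨l, m, hlm, hne⟩ : ∃ l m, i l = i m ∧ l ≠ m := by
        simpa [Function.Injective] using hinj
      have h1 : ∑ k, f (Function.update (fun j => e (i j)) k (S (e (i k)))) =
          f (Function.update (fun j => e (i j)) l (S (e (i l)))) +
            f (Function.update (fun j => e (i j)) m (S (e (i m)))) := by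
        refine Finset.sum_eq_add l m hne (fun k _ hk => ?_) (by simp) (by simp)
        refine f.map_eq_zero_of_eq _ ?_ hne
        rw [Function.update_of_ne hk.1.symm, Function.update_of_ne hk.2.symm, hlm]
      have h2 : Function.update (fun j => e (i j)) l (S (e (i l))) =
          Function.update (fun j => e (i j)) m (S (e (i m))) ∘ Equiv.swap l m := by
        ext1 j
        by_cases hjl : j = l
        · subst hjl; simp [hlm]
        · by_cases hjm : j = m
          · subst hjm
            simp [hne, hne.symm, hlm]
          · simp [Equiv.swap_apply_of_ne_of_ne hjl hjm, hjl, hjm]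
      refine Eq.trans h1 ?_
      rw [h2, f.map_swap _ hne, neg_add_cancel]
  have := congrArg (fun m => m v) hm
  simp only [sum_apply, zero_apply, MultilinearMap.compLinearMap_apply,
    hg] at this
  exact this

variable {α : Type*} {p q : ℕ}

theorem update_castAdd_comp (v : Fin (p + q) → α) (l : Fin p) (z : α) :
    (fun i => Function.update v (Fin.castAdd q l) z (Fin.castAdd q i)) =
      Function.update (fun i => v (Fin.castAdd q i)) l z := by
  ext1 i
  by_cases h : i = l
  · subst h; simp
  · have : Fin.castAdd q i ≠ Fin.castAdd q l := fun h' => h (Fin.castAdd_injective _ _ h')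
    simp [h, this]

theorem update_natAdd_comp (v : Fin (p + q) → α) (l : Fin q) (z : α) :
    (fun i => Function.update v (Fin.natAdd p l) z (Fin.natAdd p i)) =
      Function.update (fun i => v (Fin.natAdd p i)) l z := by
  ext1 i
  by_cases h : i = l
  · subst h; simp
  · have : Fin.natAdd p i ≠ Fin.natAdd p l := fun h' => h (Fin.natAdd_injective _ _ h')
    simp [h, this]

theorem update_castAdd_comp_natAdd (v : Fin (p + q) → α) (l : Fin p) (z : α) :
    (fun i => Function.update v (Fin.castAdd q l) z (Fin.natAdd p i)) =
      fun i => v (Fin.natAdd p i) := by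
  ext1 i
  have : Fin.natAdd p i ≠ Fin.castAdd q l := by
    intro h; have := congrArg Fin.val h; simp at this; omega
  simp [this]

theorem update_natAdd_comp_castAdd (v : Fin (p + q) → α) (l : Fin q) (z : α) :
    (fun i => Function.update v (Fin.natAdd p l) z (Fin.castAdd q i)) =
      fun i => v (Fin.castAdd q i) := by
  ext1 i
  have : Fin.castAdd q i ≠ Fin.natAdd p l := by
    intro h; have := congrArg Fin.val h; simp at this; omega
  simp [this]

/-- The tensor product of two scalar multilinear maps. -/
def mulMultilinear {E : Type*} [AddCommGroup E] [Module ℝ E]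
    (a : MultilinearMap ℝ (fun _ : Fin p => E) ℝ) (b : MultilinearMap ℝ (fun _ : Fin q => E) ℝ) :
    MultilinearMap ℝ (fun _ : Fin (p + q) => E) ℝ where
  toFun v := a (fun i => v (Fin.castAdd q i)) * b (fun j => v (Fin.natAdd p j))
  map_update_add' := by
    intro inst v i z z'
    obtain rfl : inst = fun a b => instDecidableEqFin _ a b := Subsingleton.elim _ _
    refine Fin.addCases (fun l => ?_) (fun l => ?_) i
    · simp only [update_castAdd_comp, update_castAdd_comp_natAdd, a.map_update_add]; ring
    · simp only [update_natAdd_comp, update_natAdd_comp_castAdd, b.map_update_add]; ring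
  map_update_smul' := by
    intro inst v i c z
    obtain rfl : inst = fun a b => instDecidableEqFin _ a b := Subsingleton.elim _ _
    refine Fin.addCases (fun l => ?_) (fun l => ?_) i
    · simp only [update_castAdd_comp, update_castAdd_comp_natAdd, a.map_update_smul, smul_eq_mul]
      ring
    · simp only [update_natAdd_comp, update_natAdd_comp_castAdd, b.map_update_smul, smul_eq_mul]
      ring

end algebra

variable {M : Type*} [TopologicalSpace M] [ChartedSpace E6 M] [IsManifold (𝓡 6) ∞ M]

section product

variable {p q : ℕ} {A : Tensor M p} {B : Tensor M q}

/-- The tensor product of two tensor fields. -/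
def tensorMul (A : Tensor M p) (B : Tensor M q) : Tensor M (p + q) := fun x v =>
  A x (fun i => v (Fin.castAdd q i)) * B x (fun j => v (Fin.natAdd p j))

theorem IsSmoothTensor.tensorMul (hA : IsSmoothTensor A) (hB : IsSmoothTensor B) :
    IsSmoothTensor (ACYT.tensorMul A B) where
  multilinear x := by
    obtain ⟨a, ha⟩ := hA.multilinear x
    obtain ⟨b, hb⟩ := hB.multilinear x
    refine ⟨mulMultilinear a b, fun v => ?_⟩
    change A x _ * B x _ = a _ * b _
    rw [ha, hb]
  smooth V := (hA.smooth fun i => V (Fin.castAdd q i)).mul (hB.smooth fun j => V (Fin.natAdd p j))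

theorem IsParallel.tensorMul [T2Space M] {nabla : Connection M} (hA : IsSmoothTensor A)
    (hB : IsSmoothTensor B) (hpA : IsParallel nabla A) (hpB : IsParallel nabla B) :
    IsParallel nabla (ACYT.tensorMul A B) := by
  intro x w
  rw [covDeriv_eq_ext nabla (hA.tensorMul hB)]
  set V : Fin (p + q) → VF M := fun i => VF.ext (w i.succ) with hV
  unfold covDerivField
  have h1 : mvfderiv (𝓡 6) (fun y => ACYT.tensorMul A B y (fun i => V i y)) x (w 0) =
      dir (VF.ext (w 0)) (ev hA (fun i => V (Fin.castAdd q i)) *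
        ev hB (fun j => V (Fin.natAdd p j))) x := by
    rw [dir_apply, VF.ext_self]; rfl
  rw [h1, dir_mul]
  simp only [ContMDiffMap.coe_add, ContMDiffMap.coe_mul, Pi.add_apply, Pi.mul_apply]
  rw [dir_ev nabla hA, dir_ev nabla hB, hpA, hpB, Fin.sum_univ_add, sub_eq_zero]
  simp only [ACYT.tensorMul, update_castAdd_comp, update_castAdd_comp_natAdd, update_natAdd_comp,
    update_natAdd_comp_castAdd, VF.ext_self, ev_apply, zero_add, Finset.sum_mul, Finset.mul_sum]

end product

variable [T2Space M]
  [Bundle.RiemannianBundle (fun x : M => TangentSpace (𝓡 6) x)]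
  [IsContMDiffRiemannianBundle (𝓡 6) ∞ E6 (fun x : M => TangentSpace (𝓡 6) x)]
  {J : ∀ x : M, TangentSpace (𝓡 6) x →L[ℝ] TangentSpace (𝓡 6) x}
  {Psi : ∀ x : M, (Fin 3 → TangentSpace (𝓡 6) x) → ℂ} {nabla nablaG : Connection M}

section volume

/-- The tensor field `F ⊗ F ⊗ F`. -/
def kaehlerCube (J : ∀ x : M, TangentSpace (𝓡 6) x →L[ℝ] TangentSpace (𝓡 6) x) : Tensor M 6 :=
  tensorMul (tensorMul (kaehlerForm J) (kaehlerForm J)) (kaehlerForm J)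

theorem volForm_eq (J : ∀ x : M, TangentSpace (𝓡 6) x →L[ℝ] TangentSpace (𝓡 6) x) :
    volForm J = fun x v => ∑ s : Equiv.Perm (Fin 6), (-(1 / 48) * ((Equiv.Perm.sign s : ℤ) : ℝ)) *
      kaehlerCube J x (fun i => v (s i)) := by
  funext x v
  unfold volForm
  rw [Finset.mul_sum]
  refine Finset.sum_congr rfl fun s _ => ?_
  rw [← mul_assoc]
  rfl

theorem isSmoothTensor_kaehlerCube (h : IsSU3Structure J Psi) : IsSmoothTensor (kaehlerCube J) :=
  ((isSmoothTensor_kaehlerForm h).tensorMul (isSmoothTensor_kaehlerForm h)).tensorMul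
    (isSmoothTensor_kaehlerForm h)

theorem isSmoothTensor_volForm (h : IsSU3Structure J Psi) : IsSmoothTensor (volForm J) := by
  rw [volForm_eq]
  exact IsSmoothTensor.sum _ _ fun s => (isSmoothTensor_kaehlerCube h).perm s

/-- The volume form is alternating. -/
theorem exists_alternating_volForm (h : IsSU3Structure J Psi) (x : M) :
    ∃ f : TangentSpace (𝓡 6) x [⋀^Fin 6]→ₗ[ℝ] ℝ, ∀ v, volForm J x v = f v := by
  obtain ⟨m, hm⟩ := (isSmoothTensor_kaehlerCube h).multilinear x
  refine ⟨(-(1 / 48) : ℝ) • MultilinearMap.alternatization m, fun v => ?_⟩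
  rw [volForm_eq]
  simp only [hm, AlternatingMap.smul_apply, MultilinearMap.alternatization_apply, Finset.smul_sum]
  refine Finset.sum_congr rfl fun s _ => ?_
  rw [Units.smul_def, zsmul_eq_mul, smul_eq_mul, mul_assoc]
  rfl

theorem isParallel_volForm [hsm : CovariantDerivative.ContMDiffCovariantDerivative nabla ∞]
    (hA : IsACYT J Psi nabla) : IsParallel nabla (volForm J) := by
  have hF := isSmoothTensor_kaehlerForm hA.su3
  have hpF := isParallel_kaehlerForm hA
  have hC : IsParallel nabla (kaehlerCube J) :=
    IsParallel.tensorMul (hF.tensorMul hF) hF (IsParallel.tensorMul hF hF hpF hpF) hpF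
  intro x w
  rw [volForm_eq, covDeriv_sum nabla _ _ fun s => (isSmoothTensor_kaehlerCube hA.su3).perm s]
  refine Finset.sum_eq_zero fun s _ => ?_
  rw [covDeriv_perm nabla (isSmoothTensor_kaehlerCube hA.su3), hC, mul_zero]

/-- The Riemannian volume form is parallel for the Levi-Civita connection. -/
theorem isParallel_leviCivita_volForm
    [hsm : CovariantDerivative.ContMDiffCovariantDerivative nabla ∞]
    (hA : IsACYT J Psi nabla) (hLC : IsLeviCivita nablaG) : IsParallel nablaG (volForm J) := by
  intro x w
  rw [covDeriv_leviCivita hA.metric hA.skew hLC (isSmoothTensor_volForm hA.su3),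
    isParallel_volForm hA]
  obtain ⟨f, hf⟩ := exists_alternating_volForm hA.su3 x
  simp only [hf]
  have hT : ∀ a b : TangentSpace (𝓡 6) x, nabla.torsion x a b = -nabla.torsion x b a :=
    fun a b => nabla.torsion_antisymm a b
  have h := AlternatingMap.sum_update_skew f (frame x) (-(nabla.torsion x (w 0)).toLinearMap)
    (fun a => by
      have h1 := inner_torsion_swap hA.skew (w 0) a a
      change inner ℝ a (-(nabla.torsion x (w 0) a)) = (0 : ℝ)
      rw [inner_neg_right, real_inner_comm]
      linarith) (fun j => w j.succ)
  have h2 : ∀ i : Fin 6, nabla.torsion x (w i.succ) (w 0) =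
      (-(nabla.torsion x (w 0)).toLinearMap) (w i.succ) := fun i => hT _ _
  simp only [h2]
  rw [h]
  ring

end volume

section harmonic

/-- A form of degree three which is parallel for a torsion free connection is closed. -/
theorem dForm_three_of_isParallel {A : Tensor M 3} (hA : IsSmoothTensor A)
    (hp : IsParallel nablaG A) (h0 : nablaG.torsion = 0)
    (h12 : ∀ (x : M) (u v w : TangentSpace (𝓡 6) x), A x ![u, v, w] = -A x ![v, u, w])
    (h23 : ∀ (x : M) (u v w : TangentSpace (𝓡 6) x), A x ![u, v, w] = -A x ![u, w, v]) {x : M}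
    (v : Fin 4 → TangentSpace (𝓡 6) x) : dForm A x v = 0 := by
  have hsub : ∀ a b c d : TangentSpace (𝓡 6) x,
      A x ![a - b, c, d] = A x ![a, c, d] - A x ![b, c, d] := by
    intro a b c d
    obtain ⟨m, hm⟩ := hA.multilinear x
    have := m.map_update_sub ![a, c, d] 0 a b
    have e : ∀ z, Function.update ![a, c, d] 0 z = ![z, c, d] := fun z => by
      ext1 i; fin_cases i <;> rfl
    simp only [e] at this
    rw [hm, hm, hm, this]
  have key : ∀ a b c d : TangentSpace (𝓡 6) x,
      mvfderiv (𝓡 6) (fun y => A y ![field b y, field c y, field d y]) x a =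
        A x ![nablaG (field b) x a, c, d] - A x ![nablaG (field c) x a, b, d] +
          A x ![nablaG (field d) x a, b, c] := by
    intro a b c d
    have h := hp x ![a, b, c, d]
    unfold covDeriv at h
    rw [Fin.sum_univ_three, sub_eq_zero] at h
    have e1 : (fun y => A y (fun i => field (![a, b, c, d] i.succ) y)) =
        fun y => A y ![field b y, field c y, field d y] := by
      funext y; congr 1; ext1 i; fin_cases i <;> rfl
    have e2 : ∀ z, Function.update (fun j : Fin 3 => ![a, b, c, d] j.succ) 0 z = ![z, c, d] := by
      intro z; ext1 i; fin_cases i <;> rfl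
    have e3 : ∀ z, Function.update (fun j : Fin 3 => ![a, b, c, d] j.succ) 1 z = ![b, z, d] := by
      intro z; ext1 i; fin_cases i <;> rfl
    have e4 : ∀ z, Function.update (fun j : Fin 3 => ![a, b, c, d] j.succ) 2 z = ![b, c, z] := by
      intro z; ext1 i; fin_cases i <;> rfl
    rw [e1, e2, e3, e4, h12 x b, h23 x b c, h12 x b, neg_neg, ← sub_eq_add_neg] at h
    exact h
  have hbr : ∀ a b : TangentSpace (𝓡 6) x, VectorField.mlieBracket (𝓡 6) (field a) (field b) x =
      nablaG (field b) x a - nablaG (field a) x b := by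
    intro a b
    rw [mlieBracket_field_eq (nabla := nablaG), h0]
    exact sub_zero _
  rw [dForm_three_eq]
  simp only [key, hbr, hsub]
  ring

/-- The Hodge star of a `3`-form is a multiple of its contraction with the volume form, written as a
sum with one term for the use of `IsSmoothTensor.sum` and `covDeriv_sum`. -/
theorem hodgeStar_three (A : Tensor M 3) : hodgeStar J (show 3 + 3 = 6 from rfl) A =
    fun x w => ∑ _j : Unit, (1 / (Nat.factorial 3 : ℝ)) *
      contr (q := 3) A (volForm J) x w := by
  funext x w
  rw [Fintype.sum_unique]
  rfl

theorem isSmoothTensor_hodgeStar (h : IsSU3Structure J Psi) {A : Tensor M 3}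
    (hA : IsSmoothTensor A) : IsSmoothTensor (hodgeStar J (show 3 + 3 = 6 from rfl) A) := by
  rw [hodgeStar_three]
  exact IsSmoothTensor.sum Finset.univ (fun _ : Unit => (1 / (Nat.factorial 3 : ℝ)))
    fun _ => IsSmoothTensor.contr (q := 3) hA (isSmoothTensor_volForm h)

theorem isParallel_hodgeStar [hsm : CovariantDerivative.ContMDiffCovariantDerivative nabla ∞]
    (hA : IsACYT J Psi nabla) (hLC : IsLeviCivita nablaG) {A : Tensor M 3}
    (hAs : IsSmoothTensor A) (hp : IsParallel nablaG A) :
    IsParallel nablaG (hodgeStar J (show 3 + 3 = 6 from rfl) A) := by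
  intro x w
  have hv := isSmoothTensor_volForm hA.su3
  rw [hodgeStar_three, covDeriv_sum nablaG Finset.univ (fun _ : Unit => (1 / (Nat.factorial 3 : ℝ)))
    fun _ => IsSmoothTensor.contr (q := 3) hAs hv]
  refine Finset.sum_eq_zero fun _ _ => mul_eq_zero_of_right _ ?_
  rw [covDeriv_contr (q := 3) hLC.metric hAs hv (frame x)]
  refine Finset.sum_eq_zero fun i _ => ?_
  have h1 : covDeriv nablaG (volForm J) x
      (Matrix.vecCons (w 0) (Fin.append (fun l => frame x (i l)) (fun j => w j.succ))) = 0 :=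
    isParallel_leviCivita_volForm hA hLC x _
  rw [hp, zero_mul, zero_add]
  exact mul_eq_zero_of_right _ h1

/-- The Hodge star of a `3`-form is skew-symmetric. -/
theorem hodgeStar_swap (h : IsSU3Structure J Psi) (A : Tensor M 3) {x : M}
    (w w' : Fin 3 → TangentSpace (𝓡 6) x) {i j : Fin 3} (hij : i ≠ j)
    (hw : w' = w ∘ Equiv.swap i j) :
    hodgeStar J (show 3 + 3 = 6 from rfl) A x w' =
      -hodgeStar J (show 3 + 3 = 6 from rfl) A x w := by
  obtain ⟨f, hf⟩ := exists_alternating_volForm h x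
  unfold hodgeStar
  rw [← mul_neg, ← Finset.sum_neg_distrib]
  congr 1
  refine Finset.sum_congr rfl fun k _ => ?_
  rw [← mul_neg, hf, hf]
  congr 1
  have hne : Fin.natAdd 3 i ≠ Fin.natAdd 3 j := fun h => hij (Fin.natAdd_injective _ _ h)
  rw [← f.map_swap (i := Fin.natAdd 3 i) (j := Fin.natAdd 3 j) _ hne]
  congr 1
  subst hw
  ext1 a
  change Fin.append (fun l => frame x (k l)) (w ∘ Equiv.swap i j) a =
    Fin.append (fun l => frame x (k l)) w (Equiv.swap (Fin.natAdd 3 i) (Fin.natAdd 3 j) a)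
  refine Fin.addCases (m := 3) (n := 3) (fun l => ?_) (fun l => ?_) a
  · rw [Equiv.swap_apply_of_ne_of_ne, Fin.append_left, Fin.append_left]
    · intro h; have := congrArg Fin.val h; simp at this; omega
    · intro h; have := congrArg Fin.val h; simp at this; omega
  · rw [Fin.append_right, Function.comp_apply]
    by_cases hl : l = i
    · subst hl; rw [Equiv.swap_apply_left, Equiv.swap_apply_left, Fin.append_right]
    · by_cases hl' : l = j
      · subst hl'; rw [Equiv.swap_apply_right, Equiv.swap_apply_right, Fin.append_right]
      · rw [Equiv.swap_apply_of_ne_of_ne hl hl', Equiv.swap_apply_of_ne_of_ne, Fin.append_right]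
        · exact fun h => hl (Fin.natAdd_injective _ _ h)
        · exact fun h => hl' (Fin.natAdd_injective _ _ h)

/-- If the torsion `T` is parallel for the Levi-Civita connection, so is `*T`, and both forms are
closed. -/
theorem isHarmonic_torsionForm [hsm : CovariantDerivative.ContMDiffCovariantDerivative nabla ∞]
    (hA : IsACYT J Psi nabla) (hLC : IsLeviCivita nablaG)
    (hp : IsParallel nablaG (torsionForm nabla)) : IsHarmonic J (torsionForm nabla) := by
  have hT : IsSmoothTensor (torsionForm nabla) := isSmoothTensor_torsionForm
  refine ⟨fun x v => dForm_three_of_isParallel hT hp hLC.torsion_eq_zero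
    (fun y a b c => ?_) hA.skew v, fun x v => ?_⟩
  · change inner ℝ (nabla.torsion y a b) c = -inner ℝ (nabla.torsion y b a) c
    rw [nabla.torsion_antisymm a b, inner_neg_left]
  · have h := fun y (w : Fin 4 → TangentSpace (𝓡 6) y) => dForm_three_of_isParallel
      (isSmoothTensor_hodgeStar hA.su3 hT) (isParallel_hodgeStar hA hLC hT hp) hLC.torsion_eq_zero
      (fun y a b c => hodgeStar_swap hA.su3 _ ![b, a, c] ![a, b, c] (i := 0) (j := 1) (by decide)
        (by ext1 i; fin_cases i <;> rfl))
      (fun y a b c => hodgeStar_swap hA.su3 _ ![a, c, b] ![a, b, c] (i := 1) (j := 2) (by decide)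
        (by ext1 i; fin_cases i <;> rfl)) w
    unfold codiff
    rw [neg_eq_zero]
    unfold hodgeStar
    refine mul_eq_zero_of_right _ (Finset.sum_eq_zero fun i _ => ?_)
    exact mul_eq_zero_of_left (h x _) _

end harmonic

end

/-! ### Parallel torsion -/

section

variable {M : Type*} [TopologicalSpace M] [ChartedSpace E6 M] [IsManifold (𝓡 6) ∞ M] [T2Space M]
  [Bundle.RiemannianBundle (fun x : M => TangentSpace (𝓡 6) x)]
  [IsContMDiffRiemannianBundle (𝓡 6) ∞ E6 (fun x : M => TangentSpace (𝓡 6) x)]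
  {J : ∀ x : M, TangentSpace (𝓡 6) x →L[ℝ] TangentSpace (𝓡 6) x}
  {Psi : ∀ x : M, (Fin 3 → TangentSpace (𝓡 6) x) → ℂ} {nabla nablaG : Connection M}
  [hsm : CovariantDerivative.ContMDiffCovariantDerivative nabla ∞]

theorem isParallel_leviCivita_torsionForm (hA : IsACYT J Psi nabla) (hLC : IsLeviCivita nablaG)
    (hp : IsParallel nabla (torsionForm nabla))
    (h : ∀ (x : M) (u v w z : TangentSpace (𝓡 6) x), sigma nabla x u v w z = 0) :
    IsParallel nablaG (torsionForm nabla) := by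
  intro x w
  have h1 := covDeriv_leviCivita_torsionForm hA.metric hA.skew hLC (w 0) (w 1) (w 2) (w 3)
  rw [hp, h, mul_zero, add_zero] at h1
  rw [← h1]
  congr 1
  ext1 i; fin_cases i <;> rfl

/-- If `∇ᵍT = ∇T = 0` then `σ = 2(∇ᵍT - ∇T)` vanishes, and with it the cyclic sum of the
curvature. -/
theorem riemannianBianchi_of_isParallel (hA : IsACYT J Psi nabla) (hLC : IsLeviCivita nablaG)
    (hpG : IsParallel nablaG (torsionForm nabla)) (hp : IsParallel nabla (torsionForm nabla)) :
    RiemannianBianchi nabla := by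
  intro x u v w z
  have h1 := covDeriv_leviCivita_torsionForm hA.metric hA.skew hLC u v w z
  rw [hp, hpG] at h1
  rw [R4_cyclic hA.metric hA.skew, hp, hp, hp]
  linarith

end

end ACYT

end

theorem mainTheorem3
    {M : Type*} [TopologicalSpace M] [T2Space M] [SecondCountableTopology M] [ConnectedSpace M]
    [ChartedSpace ACYT.E6 M] [IsManifold (𝓡 6) ∞ M]
    [Bundle.RiemannianBundle (fun x : M => TangentSpace (𝓡 6) x)]
    [IsContMDiffRiemannianBundle (𝓡 6) ∞ ACYT.E6 (fun x : M => TangentSpace (𝓡 6) x)]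
    (J : ∀ x : M, TangentSpace (𝓡 6) x →L[ℝ] TangentSpace (𝓡 6) x)
    (Psi : ∀ x : M, (Fin 3 → TangentSpace (𝓡 6) x) → ℂ)
    (nabla : ACYT.Connection M) (hACYT : ACYT.IsACYT J Psi nabla)
    (nablaG : ACYT.Connection M) (hLC : ACYT.IsLeviCivita nablaG) :
    ((ACYT.IsPairSymmetric nabla ∧ ACYT.IsRicciFlat nabla ∧
        ∃ c : ℝ, ∀ x : M, ACYT.normSq (ACYT.nijenhuisForm J) x = c) ↔
      (ACYT.IsParallel nablaG (ACYT.torsionForm nabla) ∧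
        ACYT.IsParallel nabla (ACYT.torsionForm nabla))) ∧
    ((ACYT.IsPairSymmetric nabla ∧ ACYT.IsRicciFlat nabla ∧
        ∃ c : ℝ, ∀ x : M, ACYT.normSq (ACYT.nijenhuisForm J) x = c) →
      ACYT.IsHarmonic J (ACYT.torsionForm nabla) ∧
        ACYT.IsParallel nabla (ACYT.nijenhuisForm J) ∧
        ACYT.IsParallel nabla (ACYT.dForm (ACYT.kaehlerForm J))) ∧
    ((ACYT.IsPairSymmetric nabla ∧ ACYT.IsRicciFlat nabla ∧
        ∃ c : ℝ, ∀ x : M, ACYT.normSq (ACYT.nijenhuisForm J) x = c) ↔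
      ACYT.RiemannianBianchi nabla) := by
  have := hACYT.smooth
  -- given the first Bianchi identity, the norm of `N` is constant since `N` is parallel
  have hAB : (ACYT.IsPairSymmetric nabla ∧ ACYT.IsRicciFlat nabla ∧
      ∃ c : ℝ, ∀ x : M, ACYT.normSq (ACYT.nijenhuisForm J) x = c) ↔
      ACYT.RiemannianBianchi nabla := by
    refine ⟨fun h => ACYT.riemannianBianchi_of_ricci hACYT h.1 h.2.1, fun hB =>
      ⟨ACYT.isPairSymmetric_of_riemannianBianchi hACYT.metric hB,
        ACYT.isRicciFlat_of_riemannianBianchi hACYT hB, ?_⟩⟩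
    obtain ⟨hN, hNp⟩ := ACYT.nijenhuisForm_parallel hACYT (ACYT.isParallel_torsionForm hACYT hB)
    obtain ⟨x₀⟩ := (inferInstance : Nonempty M)
    exact ⟨_, fun x => ACYT.normSq_eq_of_isParallel hACYT.metric hN hNp x x₀⟩
  have hBT : ACYT.RiemannianBianchi nabla ↔
      (ACYT.IsParallel nablaG (ACYT.torsionForm nabla) ∧
        ACYT.IsParallel nabla (ACYT.torsionForm nabla)) := by
    constructor
    · intro hB
      have hp := ACYT.isParallel_torsionForm hACYT hB
      exact ⟨ACYT.isParallel_leviCivita_torsionForm hACYT hLC hp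
        fun x u v w z => ACYT.sigma_eq_zero hACYT hB u v w z, hp⟩
    · rintro ⟨hpG, hp⟩
      exact ACYT.riemannianBianchi_of_isParallel hACYT hLC hpG hp
  refine ⟨hAB.trans hBT, fun h => ?_, hAB⟩
  obtain ⟨hpG, hp⟩ := hBT.1 (hAB.1 h)
  exact ⟨ACYT.isHarmonic_torsionForm hACYT hLC hpG, (ACYT.nijenhuisForm_parallel hACYT hp).2,
    ACYT.isParallel_dForm_kaehlerForm hACYT hp⟩
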